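/- **Setting.** Let $G$ be a (finite-dimensional) complex Lie group with Lie algebra $\mathfrak g$, and let $\mathfrak a\subset\mathfrak g$ be an abelian Lie subalgebra with basis $(y_i)$; let $(y^i)$ be the dual basis of $\mathfrak a^*$. Put $H=U(\mathfrak g)[[\hbar]]$, with coproduct $\Delta$ and counit $\varepsilon$, and let $\tilde H^\times=(1+\hbar H)\rtimes G$, where $G$ acts on $H$ through the adjoint action; this is the extension of $G$ by $1+\hbar H$ that corresponds to the Lie algebra $\{y\in H: y\bmod\hbar\in\mathfrak g\}$. Likewise $\widetilde{(H\otimes H)}^{\times}=\bigl(1+\hbar\,(U(\mathfrak g)\otimes U(\mathfrak g))[[\hbar]]\bigr)\rtimes(G\times G)$. An expression $F(\lambda-\hbar h^{(i)})$ denotes the formal Taylor expansion of $F$ along $-\hbar\sum_j y_j^{(i)}y^j$, where $y_j^{(i)}$ is $y_j$ placed in the $i$-th tensor factor. Holomorphic functions with values in $B[[\hbar]]$, for a vector space $B$, are those whose coefficients are locally finite sums of constant vectors with holomorphic coefficients. Let $D\subset\mathfrak a^*$ and $\Omega\subset\mathfrak a^*\times\mathfrak a^*$ be open with $(\lambda,\lambda)\in\Omega$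 for all $\lambda\in D$, and let $f:D\to\mathfrak a^*$ and $g:\Omega\to G$ be holomorphic. (For meromorphic $f$ and $g$, with $g$ well defined at generic points of the diagonal, take for $\Omega$ the set of points where $g$ is regular and for $D$ the set of $\lambda$ where $f$ is regular and $(\lambda,\lambda)\in\Omega$.) **Proposition.** Assume that for all $(\lambda,\mu)\in\Omega$ with $\lambda,\mu\in D$ one has $\mathrm{Ad}_{g(\lambda,\mu)}\mathfrak a\subset\mathfrak a$ and $$(\lambda-\mu)\circ \mathrm{Ad}_{g(\lambda,\mu)}=f(\lambda)-f(\mu)\quad\text{on }\mathfrak a .$$ Let $x(\lambda)=g(\lambda,\lambda-\hbar h^{(1)})\in\tilde H^\times$, $\lambda\in D$, be the element with inverse $$x(\lambda)^{-1}=\;:g^{-1}(\lambda,\lambda-\hbar h^{(1)}):\,,$$ where colons mean normal ordering: after Taylor expansion, the elements $h^{(i)}$ are put to the extreme right. Then: 1. $x$ is a formal vertex-IRF transformation of $1\otimes1$ on $D$: it is holomorphic, $\varepsilon(x(\lambda))=1$, and $$J(\lambda)=\Delta(x(\lambda))\,x^2(\lambda)^{-1}\,x^1(\lambda-\hbar h^{(2)})^{-1}\in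 1+\hbar\,(U(\mathfrak g)\otimes U(\mathfrak g))[[\hbar]]$$ has zero weight, i.e. commutes with $y\otimes 1+1\otimes y$ for $y\in\mathfrak a$. It realizes $f$: the element $x(\lambda)$ normalizes $U(\mathfrak a)[[\hbar]]$, and, viewing elements of $U(\mathfrak a)[[\hbar]]=S(\mathfrak a)[[\hbar]]$ as functions on $\mathfrak a^*$, the transformation $\pi(x(\lambda))$ of $\mathfrak a^*$ defined by $x(\lambda)\,\varphi\,x(\lambda)^{-1}=\varphi\circ\pi(x(\lambda))^{-1}$ satisfies $$\pi(x(\lambda))^{-1}(\mu)=\hbar^{-1}\bigl(f(\lambda)-f(\lambda-\hbar\mu)\bigr).$$ 2. $J$ is a formal dynamical twist on $D$: it is holomorphic, of zero weight, equal to $1\otimes1$ modulo $\hbar$, and satisfies $$J^{12,3}(\lambda)\,J^{12}(\lambda-\hbar h^{(3)})=J^{1,23}(\lambda)\,J^{23}(\lambda),\qquad (\varepsilon\otimes\mathrm{id})J(\lambda)=(\mathrm{id}\otimes\varepsilon)J(\lambda)=1 ,$$ where $J^{12,3}=(\Delta\otimes\mathrm{id})J$, $J^{1,23}=(\mathrm{id}\otimes\Delta)J$,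 $J^{12}=J\otimes1$, $J^{23}=1\otimes J$. For all $\lambda\in D$, $$J(\lambda)=\;:g(\lambda,\lambda-\hbar(h^{(1)}+h^{(2)}))\,g^{-1}(\lambda-\hbar h^{(2)},\lambda-\hbar(h^{(1)}+h^{(2)}))\otimes g(\lambda,\lambda-\hbar(h^{(1)}+h^{(2)}))\,g^{-1}(\lambda,\lambda-\hbar h^{(2)}):\,.$$ -/

import Mathlib

open scoped Manifold ContDiff TensorProduct Topology PowerSeries

noncomputable section

namespace VertexIRF

/-! ### The group `1 + ℏ A[[ℏ]]` -/

section OnePlus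

variable {A B : Type*} [Ring A] [Ring B]

/-- The multiplicative group `1 + ℏ A[[ℏ]]`: the formal power series in `ℏ` (which is
`PowerSeries.X`) with constant term `1`, realised inside the group of units of `A[[ℏ]]`. -/
def onePlusSubgroup (A : Type*) [Ring A] : Subgroup (A⟦X⟧)ˣ :=
  (Units.map (PowerSeries.constantCoeff (R := A)).toMonoidHom).ker

/-- The group `1 + ℏ A[[ℏ]]` as a type. -/
abbrev OnePlus (A : Type*) [Ring A] : Type _ := ↥(onePlusSubgroup A)

/-- The series underlying an element of `1 + ℏ A[[ℏ]]`. -/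
def OnePlus.ser (u : OnePlus A) : A⟦X⟧ := ((u : (A⟦X⟧)ˣ) : A⟦X⟧)

theorem OnePlus.constantCoeff_ser (u : OnePlus A) :
    PowerSeries.constantCoeff u.ser = 1 := by
  exact congrArg Units.val (MonoidHom.mem_ker.mp u.2)

/-- A series with constant term `1`, as an element of the group `1 + ℏ A[[ℏ]]`. -/
def OnePlus.mk (p : A⟦X⟧) (hp : PowerSeries.constantCoeff p = 1) : OnePlus A :=
  ⟨⟨p, PowerSeries.invOfUnit p 1,
      PowerSeries.mul_invOfUnit p 1 (hp.trans Units.val_one.symm),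
      MvPowerSeries.invOfUnit_mul p 1 (hp.trans Units.val_one.symm)⟩, by
    rw [onePlusSubgroup, MonoidHom.mem_ker, Units.ext_iff]
    exact hp⟩

/-- The homomorphism `1 + ℏ A[[ℏ]] → 1 + ℏ B[[ℏ]]` induced by a ring homomorphism `A → B`. -/
def OnePlus.map (φ : A →+* B) : OnePlus A →* OnePlus B :=
  ((Units.map (PowerSeries.map φ).toMonoidHom).comp (onePlusSubgroup A).subtype).codRestrict
    (onePlusSubgroup B) (by
      intro u
      rw [onePlusSubgroup, MonoidHom.mem_ker, Units.ext_iff]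
      change PowerSeries.constantCoeff (PowerSeries.map φ (OnePlus.ser u)) = 1
      rw [← PowerSeries.coeff_zero_eq_constantCoeff_apply, PowerSeries.coeff_map,
        PowerSeries.coeff_zero_eq_constantCoeff_apply, OnePlus.constantCoeff_ser, map_one])

theorem OnePlus.ext_ser {u v : OnePlus A} (h : u.ser = v.ser) : u = v :=
  Subtype.ext (Units.ext h)

end OnePlus

/-- Apply a linear map to every coefficient of a power series. -/
def mapLin {A B : Type*} [Ring A] [Algebra ℂ A] [Ring B] [Algebra ℂ B]
    (m : A →ₗ[ℂ] B) (p : A⟦X⟧) : B⟦X⟧ :=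
  PowerSeries.mk fun n => m (PowerSeries.coeff n p)

/-! ### The extension of a group by `1 + ℏ A[[ℏ]]` -/

section Extension

variable {Γ A : Type*} [Group Γ] [Ring A] [Algebra ℂ A]

/-- The coefficientwise action of a group `Γ` on `1 + ℏ A[[ℏ]]` that comes from an action of `Γ`
on `A` by algebra automorphisms. -/
def actHat (ρ : Γ →* (A ≃ₐ[ℂ] A)) : Γ →* MulAut (OnePlus A) where
  toFun g :=
    { OnePlus.map (ρ g : A →+* A) with
      invFun := OnePlus.map (ρ g⁻¹ : A →+* A)
      left_inv := by
        intro u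
        apply OnePlus.ext_ser
        ext n
        change (ρ g⁻¹) ((ρ g) _) = _
        rw [← AlgEquiv.mul_apply, ← map_mul, inv_mul_cancel, map_one]
        rfl
      right_inv := by
        intro u
        apply OnePlus.ext_ser
        ext n
        change (ρ g) ((ρ g⁻¹) _) = _
        rw [← AlgEquiv.mul_apply, ← map_mul, mul_inv_cancel, map_one]
        rfl }
  map_one' := by
    ext1 u
    apply OnePlus.ext_ser
    ext n
    change (ρ 1) _ = _
    rw [map_one]
    rfl
  map_mul' g h := by
    ext1 u
    apply OnePlus.ext_ser
    ext n
    change (ρ (g * h)) _ = (ρ g) ((ρ h) _)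
    rw [map_mul]
    rfl

/-- The extension `1 → 1 + ℏ A[[ℏ]] → Ext ρ → Γ → 1`.  For `A = U(𝔤)` and `Γ = G`, a Lie group
with Lie algebra `𝔤` acting by the adjoint action, this is the group `H̃^×` of the Hopf algebra
`H = U(𝔤)[[ℏ]]`: the extension of Lie algebras `0 → ℏH → {y ∈ H | y mod ℏ ∈ 𝔤} → 𝔤 → 0` is split
by the constant series, so that the corresponding group is the semidirect product.
The element `⟨X, γ⟩` is the product `X · γ`. -/
abbrev Ext (ρ : Γ →* (A ≃ₐ[ℂ] A)) : Type _ := OnePlus A ⋊[actHat ρ] Γ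

/-- The conjugation action `p ↦ x p x⁻¹` of the group `Ext ρ` on `A[[ℏ]]`. -/
def conj {ρ : Γ →* (A ≃ₐ[ℂ] A)} (x : Ext ρ) (p : A⟦X⟧) : A⟦X⟧ :=
  x.left.ser * PowerSeries.map (ρ x.right : A →+* A) p * (x.left⁻¹).ser

end Extension

/-! ### Holomorphic functions with values in a vector space, and formal Taylor expansions -/

section Taylor

variable {W B S J : Type*} [NormedAddCommGroup W] [NormedSpace ℂ W]

/-- A function with values in a complex vector space `B` (without topology, usually
infinite-dimensional) is holomorphic at `p` if near `p` it is a finite combination of constant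
vectors with holomorphic coefficients. -/
def HolAt [AddCommGroup B] [Module ℂ B] (F : W → B) (p : W) : Prop :=
  ∃ (n : ℕ) (φ : Fin n → W → ℂ) (u : Fin n → B),
    (∀ j, AnalyticAt ℂ (φ j) p) ∧ ∀ᶠ q in 𝓝 p, F q = ∑ j, φ j q • u j

open Classical in
/-- The `k`-th iterated directional derivative `∂_{w₁} ⋯ ∂_{w_k} F (p) ∈ B`, characterised by
`ℓ (∂_{w₁} ⋯ ∂_{w_k} F (p)) = ∂_{w₁} ⋯ ∂_{w_k} (ℓ ∘ F) (p)` for all linear functionals `ℓ`. It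
exists if `F` is holomorphic at `p`, and it is unique. -/
def dirDeriv [AddCommGroup B] [Module ℂ B] (F : W → B) (p : W) (k : ℕ) (w : Fin k → W) : B :=
  if h : ∃ d : B, ∀ l : Module.Dual ℂ B, l d = iteratedFDeriv ℂ k (fun q => l (F q)) p w
  then h.choose else 0

theorem dirDeriv_eq [AddCommGroup B] [Module ℂ B] {F : W → B} {p : W} {k : ℕ} {w : Fin k → W}
    {d : B} (hd : ∀ l : Module.Dual ℂ B, l d = iteratedFDeriv ℂ k (fun q => l (F q)) p w) :
    dirDeriv F p k w = d := by
  have h : ∃ d : B, ∀ l : Module.Dual ℂ B,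
      l d = iteratedFDeriv ℂ k (fun q => l (F q)) p w := ⟨d, hd⟩
  rw [dirDeriv, dif_pos h, ← sub_eq_zero, ← Module.forall_dual_apply_eq_zero_iff ℂ]
  intro l
  rw [map_sub, h.choose_spec l, hd l, sub_self]

variable [Ring S] [Algebra ℂ S] [Fintype J]

/-- The formal Taylor expansion
`F (p + ℏ ∑_j s_j w_j) = ∑_k (ℏ^k / k!) ∑_{j₁, …, j_k} ∂_{w_{j₁}} ⋯ ∂_{w_{j_k}} F (p) ⊗ s_{j₁} ⋯ s_{j_k}`
in `(B ⊗ S)[[ℏ]]`, where `w` is a finite family of vectors and `s` is a family of pairwise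
commuting elements of an algebra `S`. -/
def shift [AddCommGroup B] [Module ℂ B] (F : W → B) (p : W) (w : J → W) (s : J → S) :
    (B ⊗[ℂ] S)⟦X⟧ :=
  PowerSeries.mk fun k => ((k.factorial : ℂ)⁻¹) •
    ∑ i : Fin k → J, dirDeriv F p k (fun m => w (i m)) ⊗ₜ[ℂ] (List.ofFn fun m => s (i m)).prod

/-- The formal Taylor expansion `F (p + ℏ ∑_j s_j w_j) ∈ (B ⊗ S)[[ℏ]]` of a function with values
in `B[[ℏ]]`. -/
def shiftSeries [Ring B] [Algebra ℂ B] (F : W → B⟦X⟧) (p : W) (w : J → W) (s : J → S) :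
    (B ⊗[ℂ] S)⟦X⟧ :=
  PowerSeries.mk fun n => ∑ m ∈ Finset.HasAntidiagonal.antidiagonal n,
    PowerSeries.coeff m.2 (shift (fun q => PowerSeries.coeff m.1 (F q)) p w s)

theorem constantCoeff_shiftSeries [Ring B] [Algebra ℂ B] (F : W → OnePlus B) (p : W)
    (w : J → W) (s : J → S) :
    PowerSeries.constantCoeff (shiftSeries (fun q => (F q).ser) p w s) = 1 := by
  have h1 : ∀ i : Fin 0 → J,
      dirDeriv (fun q => PowerSeries.constantCoeff (F q).ser) p 0 (fun m => w (i m)) = 1 := by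
    intro i
    apply dirDeriv_eq
    intro l
    rw [iteratedFDeriv_zero_apply, OnePlus.constantCoeff_ser]
  rw [← PowerSeries.coeff_zero_eq_constantCoeff_apply, shiftSeries, PowerSeries.coeff_mk]
  simp [shift, h1, Algebra.TensorProduct.one_def]

end Taylor

/-! ### Formal linear differential equations -/

section ODE

variable {A : Type*} [Ring A] [Algebra ℂ A]

/-- The coefficients of the solution of `dZ/dℏ = Z · η`, `Z(0) = 1`. -/
def odeCoeff (η : A⟦X⟧) : ℕ → A
  | 0 => 1
  | n + 1 => ((n + 1 : ℂ)⁻¹) •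
      ∑ i : Fin (n + 1), odeCoeff η i.1 * PowerSeries.coeff (n - i.1) η

/-- The unique solution `Z ∈ 1 + ℏ A[[ℏ]]` of `dZ/dℏ = Z · η`. -/
def odeSol (η : A⟦X⟧) : OnePlus A :=
  OnePlus.mk (PowerSeries.mk (odeCoeff η)) (by
    rw [← PowerSeries.coeff_zero_eq_constantCoeff_apply, PowerSeries.coeff_mk, odeCoeff])

end ODE

/-! ### The Hopf algebra structure of the universal enveloping algebra -/

section Hopf

attribute [local instance 100] LieRing.ofAssociativeRing

variable (L : Type*) [LieRing L] [LieAlgebra ℂ L]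

/-- The canonical linear map `𝔤 → U(𝔤)`. -/
def iota : L →ₗ[ℂ] UniversalEnvelopingAlgebra ℂ L :=
  (UniversalEnvelopingAlgebra.ι ℂ : L →ₗ⁅ℂ⁆ UniversalEnvelopingAlgebra ℂ L)

/-- The coproduct `Δ : U(𝔤) → U(𝔤) ⊗ U(𝔤)`, `Δ(y) = y ⊗ 1 + 1 ⊗ y` for `y ∈ 𝔤`. -/
def comul : UniversalEnvelopingAlgebra ℂ L →ₐ[ℂ]
    UniversalEnvelopingAlgebra ℂ L ⊗[ℂ] UniversalEnvelopingAlgebra ℂ L :=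
  UniversalEnvelopingAlgebra.lift ℂ
    { toFun := fun y => iota L y ⊗ₜ[ℂ] 1 + 1 ⊗ₜ[ℂ] iota L y
      map_add' := fun y z => by
        rw [map_add, TensorProduct.add_tmul, TensorProduct.tmul_add]
        abel
      map_smul' := fun c y => by
        rw [map_smul, TensorProduct.tmul_smul, RingHom.id_apply, smul_add,
          ← TensorProduct.smul_tmul']
      map_lie' := fun {y z} => by
        have h : iota L ⁅y, z⁆ = iota L y * iota L z - iota L z * iota L y :=
          (UniversalEnvelopingAlgebra.ι ℂ : L →ₗ⁅ℂ⁆ _).map_lie y z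
        simp only [h, LieRing.of_associative_ring_bracket, mul_add, add_mul,
          Algebra.TensorProduct.tmul_mul_tmul, one_mul, mul_one, TensorProduct.sub_tmul,
          TensorProduct.tmul_sub]
        abel }

theorem comul_iota (y : L) :
    comul L (iota L y) = iota L y ⊗ₜ[ℂ] 1 + 1 ⊗ₜ[ℂ] iota L y :=
  UniversalEnvelopingAlgebra.lift_ι_apply ℂ _ y

/-- The counit `ε : U(𝔤) → ℂ`, `ε(y) = 0` for `y ∈ 𝔤`. -/
def counit : UniversalEnvelopingAlgebra ℂ L →ₐ[ℂ] ℂ :=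
  UniversalEnvelopingAlgebra.lift ℂ (0 : L →ₗ⁅ℂ⁆ ℂ)

end Hopf

/-! ### Lie groups: the adjoint action and Taylor expansions of group-valued functions -/

section LieGroup

variable (E : Type*) [NormedAddCommGroup E] [NormedSpace ℂ E] [CompleteSpace E]
  (G : Type*) [TopologicalSpace G] [ChartedSpace E G] [Group G] [LieGroup 𝓘(ℂ, E) ω G]

/-- The Lie algebra `𝔤` of the complex Lie group `G`. -/
abbrev LieAlg : Type _ := GroupLieAlgebra 𝓘(ℂ, E) G

/-- The universal enveloping algebra `U(𝔤)`. -/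
abbrev Env : Type _ := UniversalEnvelopingAlgebra ℂ (LieAlg E G)

variable {G}

/-- The differential at the identity of the conjugation `h ↦ g h g⁻¹`, as a linear map. -/
def AdLin (g : G) : LieAlg E G →L[ℂ] LieAlg E G :=
  mfderiv 𝓘(ℂ, E) 𝓘(ℂ, E) (fun h : G => g * h * g⁻¹) 1


variable {E}

set_option linter.unusedSectionVars false

theorem contMDiff_conj (g : G) :
    ContMDiff 𝓘(ℂ, E) 𝓘(ℂ, E) ω (fun h : G => g * h * g⁻¹) := by
  have : ContMDiff 𝓘(ℂ, E) 𝓘(ℂ, E) ω ((fun h : G => h * g⁻¹) ∘ (fun h : G => g * h)) :=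
    contMDiff_mul_right.comp contMDiff_mul_left
  exact this

theorem mdifferentiableAt_conj (g h : G) :
    MDifferentiableAt 𝓘(ℂ, E) 𝓘(ℂ, E) (fun h : G => g * h * g⁻¹) h :=
  (contMDiff_conj g).contMDiffAt.mdifferentiableAt (by simp)

theorem AdLin_eq (g h : G) (hh : h = 1) (v : E) :
    (mfderiv 𝓘(ℂ, E) 𝓘(ℂ, E) (fun h : G => g * h * g⁻¹) h : E → E) v = AdLin E g v := by
  subst hh
  rfl

theorem AdLin_mul (g g' : G) (v : LieAlg E G) :
    AdLin E (g * g') v = AdLin E g (AdLin E g' v) := by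
  have h1 : (fun h : G => (g * g') * h * (g * g')⁻¹) =
      (fun h : G => g * h * g⁻¹) ∘ (fun h : G => g' * h * g'⁻¹) := by
    ext h
    simp only [Function.comp_apply]
    group
  rw [AdLin, h1, mfderiv_comp 1 (mdifferentiableAt_conj g _) (mdifferentiableAt_conj g' _)]
  exact AdLin_eq g (g' * 1 * g'⁻¹) (by simp) _

theorem AdLin_one (v : LieAlg E G) : AdLin E (1 : G) v = v := by
  have h1 : (fun h : G => 1 * h * (1 : G)⁻¹) = id := by
    ext h
    simp
  rw [AdLin, h1, mfderiv_id]
  rfl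

theorem isInvertible_mfderiv_conj (g h : G) :
    (mfderiv 𝓘(ℂ, E) 𝓘(ℂ, E) (fun h : G => g * h * g⁻¹) h).IsInvertible := by
  have e1 : (fun h : G => g⁻¹ * h * g⁻¹⁻¹) ∘ (fun h : G => g * h * g⁻¹) = id := by
    ext h
    simp only [Function.comp_apply, id]
    group
  have e2 : (fun h : G => g * h * g⁻¹) ∘ (fun h : G => g⁻¹ * h * g⁻¹⁻¹) = id := by
    ext h
    simp only [Function.comp_apply, id]
    group
  have a1 : mfderiv 𝓘(ℂ, E) 𝓘(ℂ, E)
      ((fun h : G => g⁻¹ * h * g⁻¹⁻¹) ∘ (fun h : G => g * h * g⁻¹)) h =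
      ContinuousLinearMap.id _ _ := by
    rw [e1, id_eq, mfderiv_id]
  have a2 : mfderiv 𝓘(ℂ, E) 𝓘(ℂ, E)
      ((fun h : G => g * h * g⁻¹) ∘ (fun h : G => g⁻¹ * h * g⁻¹⁻¹)) (g * h * g⁻¹) =
      ContinuousLinearMap.id _ _ := by
    rw [e2, id_eq, mfderiv_id]
  rw [mfderiv_comp (I' := 𝓘(ℂ, E)) _ (mdifferentiableAt_conj _ _)
    (mdifferentiableAt_conj _ _)] at a1 a2
  have e3 : g⁻¹ * (g * h * g⁻¹) * g⁻¹⁻¹ = h := by group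
  rw [e3] at a2
  exact ContinuousLinearMap.IsInvertible.of_inverse a2 a1

theorem mpullback_conj (g : G) (v : LieAlg E G) :
    VectorField.mpullback 𝓘(ℂ, E) 𝓘(ℂ, E) (fun h : G => g * h * g⁻¹)
      (mulInvariantVectorField (I := 𝓘(ℂ, E)) (AdLin E g v)) =
      mulInvariantVectorField (I := 𝓘(ℂ, E)) v := by
  have hl : ∀ a b : G, MDifferentiableAt 𝓘(ℂ, E) 𝓘(ℂ, E) (fun x : G => a * x) b := fun a b =>
    (contMDiff_mul_left (I := 𝓘(ℂ, E)) (n := ω)).contMDiffAt.mdifferentiableAt (by simp)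
  ext h
  rw [VectorField.mpullback_apply]
  have e : (fun x : G => (g * h * g⁻¹) * x) ∘ (fun x : G => g * x * g⁻¹) =
      (fun x : G => g * x * g⁻¹) ∘ (fun x : G => h * x) := by
    ext x
    simp only [Function.comp_apply]
    group
  have d := congrArg (fun F : G → G => (mfderiv 𝓘(ℂ, E) 𝓘(ℂ, E) F 1 : E → E) v) e
  have d1 : (mfderiv 𝓘(ℂ, E) 𝓘(ℂ, E)
      ((fun x : G => (g * h * g⁻¹) * x) ∘ (fun x : G => g * x * g⁻¹)) 1 : E → E) v =
      mulInvariantVectorField (I := 𝓘(ℂ, E)) (AdLin E g v) (g * h * g⁻¹) := by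
    have hk : ∀ k : G, k = 1 → ∀ u : E, (mfderiv 𝓘(ℂ, E) 𝓘(ℂ, E)
        (fun x : G => (g * h * g⁻¹) * x) k : E → E) u =
        (mulInvariantVectorField (I := 𝓘(ℂ, E)) (G := G) u (g * h * g⁻¹) : E) := by
      rintro k rfl u
      rfl
    rw [mfderiv_comp 1 (hl _ _) (mdifferentiableAt_conj _ _)]
    exact hk (g * 1 * g⁻¹) (by simp) _
  have d2 : (mfderiv 𝓘(ℂ, E) 𝓘(ℂ, E)
      ((fun x : G => g * x * g⁻¹) ∘ (fun x : G => h * x)) 1 : E → E) v =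
      (mfderiv 𝓘(ℂ, E) 𝓘(ℂ, E) (fun h : G => g * h * g⁻¹) h : E → E)
        (mulInvariantVectorField (I := 𝓘(ℂ, E)) v h) := by
    have hk : ∀ k : G, k = h → ∀ u : E, (mfderiv 𝓘(ℂ, E) 𝓘(ℂ, E)
        (fun x : G => g * x * g⁻¹) k : E → E) u =
        (mfderiv 𝓘(ℂ, E) 𝓘(ℂ, E) (fun x : G => g * x * g⁻¹) h : E → E) u := by
      rintro k rfl u
      rfl
    rw [mfderiv_comp 1 (mdifferentiableAt_conj _ _) (hl _ _)]
    exact hk (h * 1) (by simp) _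
  have d3 := d1.symm.trans (d.trans d2)
  obtain ⟨M, hM⟩ := isInvertible_mfderiv_conj (E := E) g h
  rw [← hM] at d3 ⊢
  rw [ContinuousLinearMap.inverse_equiv]
  erw [d3]
  exact M.symm_apply_apply _

theorem AdLin_lie (g : G) (v w : LieAlg E G) :
    AdLin E g ⁅v, w⁆ = ⁅AdLin E g v, AdLin E g w⁆ := by
  have h1 := VectorField.mpullback_mlieBracket (I := 𝓘(ℂ, E)) (I' := 𝓘(ℂ, E)) (n := ω)
    (f := fun h : G => g * h * g⁻¹) (x₀ := (1 : G))
    (mdifferentiableAt_mulInvariantVectorField (I := 𝓘(ℂ, E)) (AdLin E g v))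
    (mdifferentiableAt_mulInvariantVectorField (I := 𝓘(ℂ, E)) (AdLin E g w))
    (contMDiff_conj g).contMDiffAt le_top
  rw [mpullback_conj, mpullback_conj, VectorField.mpullback_apply] at h1
  have key : ∀ u : TangentSpace 𝓘(ℂ, E) (g * 1 * g⁻¹),
      (mfderiv 𝓘(ℂ, E) 𝓘(ℂ, E) (fun h : G => g * h * g⁻¹) 1)
        ((mfderiv 𝓘(ℂ, E) 𝓘(ℂ, E) (fun h : G => g * h * g⁻¹) 1).inverse u) = u := by
    obtain ⟨M, hM⟩ := isInvertible_mfderiv_conj (E := E) g (1 : G)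
    intro u
    rw [← hM, ContinuousLinearMap.inverse_equiv]
    exact M.apply_symm_apply _
  have h2 : ∀ k : G, k = 1 → (VectorField.mlieBracket 𝓘(ℂ, E)
      (mulInvariantVectorField (I := 𝓘(ℂ, E)) (AdLin E g v))
      (mulInvariantVectorField (I := 𝓘(ℂ, E)) (AdLin E g w)) k : E) =
      (⁅AdLin E g v, AdLin E g w⁆ : LieAlg E G) := by
    rintro k rfl
    rfl
  rw [GroupLieAlgebra.bracket_def, ← h1]
  exact (key _).trans (h2 (g * 1 * g⁻¹) (by simp))

section

attribute [local instance 100] LieRing.ofAssociativeRing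

/-- The adjoint action of `g ∈ G` on `U(𝔤)`: the algebra endomorphism that extends `Ad_g`. -/
def AdEnv (g : G) : Env E G →ₐ[ℂ] Env E G :=
  UniversalEnvelopingAlgebra.lift ℂ
    ((UniversalEnvelopingAlgebra.ι ℂ : LieAlg E G →ₗ⁅ℂ⁆ Env E G).comp
      { (AdLin E g : LieAlg E G →ₗ[ℂ] LieAlg E G) with
        map_lie' := fun {v w} => AdLin_lie g v w })

theorem AdEnv_iota (g : G) (v : LieAlg E G) :
    AdEnv g (iota (LieAlg E G) v) = iota (LieAlg E G) (AdLin E g v) :=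
  UniversalEnvelopingAlgebra.lift_ι_apply ℂ _ v

theorem algHom_ext {φ ψ : Env E G →ₐ[ℂ] Env E G}
    (h : ∀ v, φ (iota (LieAlg E G) v) = ψ (iota (LieAlg E G) v)) : φ = ψ := by
  apply UniversalEnvelopingAlgebra.hom_ext
  ext v
  exact h v

end

theorem AdEnv_mul (g h : G) :
    AdEnv (E := E) (g * h) = (AdEnv (E := E) g).comp (AdEnv (E := E) h) := by
  apply algHom_ext
  intro v
  rw [AlgHom.comp_apply, AdEnv_iota, AdEnv_iota, AdEnv_iota, AdLin_mul]

theorem AdEnv_one : AdEnv (E := E) (1 : G) = AlgHom.id ℂ _ := by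
  apply algHom_ext
  intro v
  rw [AdEnv_iota, AdLin_one, AlgHom.id_apply]

variable (E G)

/-- The adjoint action of `G` on `U(𝔤)`. -/
def act : G →* (Env E G ≃ₐ[ℂ] Env E G) where
  toFun g := AlgEquiv.ofAlgHom (AdEnv g) (AdEnv g⁻¹)
    (by rw [← AdEnv_mul, mul_inv_cancel, AdEnv_one])
    (by rw [← AdEnv_mul, inv_mul_cancel, AdEnv_one])
  map_one' := by
    ext u
    exact DFunLike.congr_fun AdEnv_one u
  map_mul' g h := by
    ext u
    exact DFunLike.congr_fun (AdEnv_mul g h) u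

/-- The adjoint action of `G × G` on `U(𝔤) ⊗ U(𝔤)`. -/
def act₂ : G × G →* (Env E G ⊗[ℂ] Env E G ≃ₐ[ℂ] Env E G ⊗[ℂ] Env E G) where
  toFun g := Algebra.TensorProduct.congr (act E G g.1) (act E G g.2)
  map_one' := by
    ext u
    induction u with
    | zero => simp
    | tmul a b => simp
    | add a b ha hb => rw [map_add, ha, hb, map_add]
  map_mul' g h := by
    ext u
    induction u with
    | zero => simp
    | tmul a b => simp
    | add a b ha hb => rw [map_add, ha, hb, map_add]

/-- The group `H̃^×` for `H = U(𝔤)[[ℏ]]`. -/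
abbrev HTilde : Type _ := Ext (act E G)

/-- The group `H̃^×` for the Hopf algebra `H ⊗ H = (U(𝔤) ⊗ U(𝔤))[[ℏ]]`; the corresponding Lie
group is `G × G`. -/
abbrev HTilde₂ : Type _ := Ext (act₂ E G)

variable {E G}
variable {W S J : Type*} [NormedAddCommGroup W] [NormedSpace ℂ W] [Ring S] [Algebra ℂ S]
  [Fintype J]

/-- The left logarithmic derivative `φ(q)⁻¹ · ∂_w φ (q) ∈ 𝔤` of a `G`-valued function `φ`. -/
def logDeriv (φ : W → G) (q w : W) : LieAlg E G :=
  (mfderiv 𝓘(ℂ, W) 𝓘(ℂ, E) (fun q' => (φ q)⁻¹ * φ q') q : W → E) w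

/-- The formal Taylor expansion of a `G`-valued holomorphic function: the series
`Z = φ(p)⁻¹ · φ(p + ℏ ∑_j s_j w_j) ∈ 1 + ℏ (U(𝔤) ⊗ S)[[ℏ]]`, for pairwise commuting `s_j ∈ S`. With
`h = ∑_j s_j w_j` it is the solution of `dZ/dℏ = Z · η` with `Z(0) = 1`, where
`η = φ(p + ℏh)⁻¹ ∂_h φ (p + ℏh)` is the Taylor expansion of the logarithmic derivative. -/
def groupShift (φ : W → G) (p : W) (w : J → W) (s : J → S) : OnePlus (Env E G ⊗[ℂ] S) :=
  odeSol (∑ j, shift (fun q => iota (LieAlg E G) (logDeriv φ q (w j))) p w s *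
    PowerSeries.C (1 ⊗ₜ[ℂ] s j))

/-! ### The dynamical variable

Let `𝔞 ⊆ 𝔤` be a subalgebra with basis `b = (y_i)`. The dual space `𝔞*` is identified with
`Fin r → ℂ` through the dual basis: `t` is the functional with `t (y_i) = t i`. The expression
`F(lam - ℏh)` is the Taylor expansion along `-ℏ ∑_i h_i y^i`, where `y^i` is the dual basis and
`h_i` is `y_i ∈ 𝔞` placed in the indicated tensor factor. -/

variable {a : LieSubalgebra ℂ (LieAlg E G)} {r : ℕ}

/-- The element `y_i` of the basis of `𝔞`, in `U(𝔤)`. -/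
def hvec (b : Module.Basis (Fin r) ℂ a) (i : Fin r) : Env E G :=
  iota (LieAlg E G) (b i : LieAlg E G)

/-- The element `y^i` of the dual basis of `𝔞*`. -/
def dualVec {r : ℕ} (i : Fin r) : Fin r → ℂ := Pi.single i 1

/-- A function with values in `B[[ℏ]]` is holomorphic on `D` if all its coefficients are. -/
def HolSeriesOn {B : Type*} [Ring B] [Algebra ℂ B] (F : W → B⟦X⟧) (D : Set W) : Prop :=
  ∀ p ∈ D, ∀ n : ℕ, HolAt (fun q => PowerSeries.coeff n (F q)) p

/-- A function with values in `U(𝔤)^{⊗2}[[ℏ]]` has zero weight on `D` if its values commute with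
`y ⊗ 1 + 1 ⊗ y` for all `y ∈ 𝔞`. -/
def ZeroWeightOn (a : LieSubalgebra ℂ (LieAlg E G))
    (J : W → (Env E G ⊗[ℂ] Env E G)⟦X⟧) (D : Set W) : Prop :=
  ∀ p ∈ D, ∀ y ∈ a,
    PowerSeries.C (comul (LieAlg E G) (iota (LieAlg E G) y)) * J p =
      J p * PowerSeries.C (comul (LieAlg E G) (iota (LieAlg E G) y))

/-- A formal dynamical twist for `U(𝔤)[[ℏ]]`, holomorphic on the open set `D ⊆ 𝔞*`:
`J^{12,3}(lam) J^{12}(lam - ℏh^{(3)}) = J^{1,23}(lam) J^{23}(lam)` and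
`(ε ⊗ id) J(lam) = (id ⊗ ε) J(lam) = 1`. -/
structure IsFormalDynamicalTwist (b : Module.Basis (Fin r) ℂ a)
    (J : (Fin r → ℂ) → (Env E G ⊗[ℂ] Env E G)⟦X⟧) (D : Set (Fin r → ℂ)) : Prop where
  holomorphic : HolSeriesOn J D
  zero_weight : ZeroWeightOn a J D
  constantCoeff_eq : ∀ lam ∈ D, PowerSeries.constantCoeff (J lam) = 1
  twist : ∀ lam ∈ D,
    PowerSeries.map (Algebra.TensorProduct.map (comul (LieAlg E G))
        (AlgHom.id ℂ (Env E G))).toRingHom (J lam) *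
      shiftSeries J lam (fun i => -dualVec i) (hvec b) =
    PowerSeries.map ((Algebra.TensorProduct.assoc ℂ ℂ ℂ (Env E G) (Env E G)
        (Env E G)).symm.toAlgHom.comp (Algebra.TensorProduct.map
          (AlgHom.id ℂ (Env E G)) (comul (LieAlg E G)))).toRingHom (J lam) *
      PowerSeries.map ((Algebra.TensorProduct.assoc ℂ ℂ ℂ (Env E G) (Env E G)
        (Env E G)).symm.toAlgHom.comp
          (Algebra.TensorProduct.includeRight (A := Env E G))).toRingHom (J lam)
  counit_left : ∀ lam ∈ D,
    PowerSeries.map ((Algebra.TensorProduct.lid ℂ (Env E G)).toAlgHom.comp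
      (Algebra.TensorProduct.map (counit (LieAlg E G))
        (AlgHom.id ℂ (Env E G)))).toRingHom (J lam) = 1
  counit_right : ∀ lam ∈ D,
    PowerSeries.map ((Algebra.TensorProduct.rid ℂ ℂ (Env E G)).toAlgHom.comp
      (Algebra.TensorProduct.map (AlgHom.id ℂ (Env E G))
        (counit (LieAlg E G)))).toRingHom (J lam) = 1

/-- `Δ(x)`, with `Δ(γ) = (γ, γ)` for `γ ∈ G`. -/
def delta (x : HTilde E G) : HTilde₂ E G :=
  ⟨OnePlus.map (comul (LieAlg E G)).toRingHom x.left, (x.right, x.right)⟩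

/-- `x² = 1 ⊗ x`. -/
def slotTwo (x : HTilde E G) : HTilde₂ E G :=
  ⟨OnePlus.map (Algebra.TensorProduct.includeRight (A := Env E G)).toRingHom x.left,
    (1, x.right)⟩

/-- `x¹(lam - ℏh^{(2)})`: if `x = X · γ` with `X ∈ 1 + ℏ U(𝔤)[[ℏ]]` and `γ ∈ G`, this is
`X¹(lam - ℏh^{(2)}) · γ¹(lam - ℏh^{(2)})`. -/
def slotOneShift (b : Module.Basis (Fin r) ℂ a) (x : (Fin r → ℂ) → HTilde E G)
    (lam : Fin r → ℂ) : HTilde₂ E G :=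
  SemidirectProduct.inl
      (OnePlus.mk (shiftSeries (fun q => (x q).left.ser) lam (fun i => -dualVec i) (hvec b))
        (constantCoeff_shiftSeries _ _ _ _)) *
    SemidirectProduct.inr ((x lam).right, 1) *
    SemidirectProduct.inl
      (groupShift (fun q => (x q).right) lam (fun i => -dualVec i) (hvec b))

/-- The transform `(1 ⊗ 1)^x = Δ(x(lam)) x²(lam)⁻¹ x¹(lam - ℏh^{(2)})⁻¹` of the twist `1 ⊗ 1`,
as an element of the group. -/
def transformGrp (b : Module.Basis (Fin r) ℂ a) (x : (Fin r → ℂ) → HTilde E G)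
    (lam : Fin r → ℂ) : HTilde₂ E G :=
  delta (x lam) * (slotTwo (x lam))⁻¹ * (slotOneShift b x lam)⁻¹

theorem transformGrp_right (b : Module.Basis (Fin r) ℂ a) (x : (Fin r → ℂ) → HTilde E G)
    (lam : Fin r → ℂ) : (transformGrp b x lam).right = 1 := by
  simp [transformGrp, delta, slotTwo, slotOneShift]

/-- The transform `(1 ⊗ 1)^x` of the twist `1 ⊗ 1`; its component in `G × G` is trivial, so
that it is an element of `1 + ℏ (U(𝔤) ⊗ U(𝔤))[[ℏ]]`. -/
def transform (b : Module.Basis (Fin r) ℂ a) (x : (Fin r → ℂ) → HTilde E G)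
    (lam : Fin r → ℂ) : (Env E G ⊗[ℂ] Env E G)⟦X⟧ :=
  (transformGrp b x lam).left.ser

/-- `x` is a (formal) vertex-IRF transformation of `1 ⊗ 1`, holomorphic on the open set `D`:
`ε(x) = 1`, and `(1 ⊗ 1)^x` has zero weight. -/
structure IsVertexIRF (b : Module.Basis (Fin r) ℂ a) (x : (Fin r → ℂ) → HTilde E G)
    (D : Set (Fin r → ℂ)) : Prop where
  holomorphic_group : ContMDiffOn 𝓘(ℂ, Fin r → ℂ) 𝓘(ℂ, E) ω (fun lam => (x lam).right) D
  holomorphic_series : HolSeriesOn (fun lam => (x lam).left.ser) D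
  counit_eq : ∀ lam ∈ D,
    PowerSeries.map (counit (LieAlg E G)).toRingHom (x lam).left.ser = 1
  zero_weight : ZeroWeightOn a (transform b x) D

/-- The subalgebra `U(𝔞)[[ℏ]]` of `U(𝔤)[[ℏ]]`. -/
def seriesOver (a : LieSubalgebra ℂ (LieAlg E G)) : Set (Env E G)⟦X⟧ :=
  {p | ∀ n : ℕ, PowerSeries.coeff n p ∈
    Algebra.adjoin ℂ ((fun y => iota (LieAlg E G) y) '' (a : Set (LieAlg E G)))}

/-- `x` realizes the function `f : 𝔞* → 𝔞*` on `D`: the element `x(lam)` normalizes the algebra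
`U(𝔞)[[ℏ]]` of functions on `𝔞*`, and the formal transformation `π(x(lam))` of `𝔞*`, defined by
`x(lam) φ x(lam)⁻¹ = φ ∘ π(x(lam))⁻¹`, is given by
`π(x(lam))⁻¹(μ) = ℏ⁻¹ (f(lam) - f(lam - ℏμ))`. The last condition is stated for the linear
functions `φ = y_i`, and multiplied by `ℏ`. -/
structure Realizes (b : Module.Basis (Fin r) ℂ a) (x : (Fin r → ℂ) → HTilde E G)
    (f : (Fin r → ℂ) → (Fin r → ℂ)) (D : Set (Fin r → ℂ)) : Prop where
  normalizes : ∀ lam ∈ D, conj (x lam) '' seriesOver a = seriesOver a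
  conj_eq : ∀ lam ∈ D, ∀ i : Fin r,
    PowerSeries.X * conj (x lam) (PowerSeries.C (hvec b i)) =
      PowerSeries.C (algebraMap ℂ (Env E G) (f lam i)) -
        mapLin (TensorProduct.lid ℂ (Env E G)).toLinearMap
          (shift (fun q => f q i) lam (fun j => -dualVec j) (hvec b))

/-- Normal ordering: `u ⊗ s ↦ u s`, so that the elements `h` are put to the extreme right. -/
def normalOrder {A : Type*} [Ring A] [Algebra ℂ A] (p : (A ⊗[ℂ] A)⟦X⟧) : A⟦X⟧ :=
  mapLin (LinearMap.mul' ℂ A) p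

theorem constantCoeff_normalOrder {A : Type*} [Ring A] [Algebra ℂ A] (Z : OnePlus (A ⊗[ℂ] A)) :
    PowerSeries.constantCoeff (normalOrder Z.ser) = 1 := by
  have h := Z.constantCoeff_ser
  rw [← PowerSeries.coeff_zero_eq_constantCoeff_apply] at h ⊢
  rw [normalOrder, mapLin, PowerSeries.coeff_mk, h, Algebra.TensorProduct.one_def,
    LinearMap.mul'_apply, mul_one]

/-- The normally ordered element `:g⁻¹(lam, lam - ℏh^{(1)}):` of `H̃^×`. -/
def inverseElement (b : Module.Basis (Fin r) ℂ a) (g : (Fin r → ℂ) → (Fin r → ℂ) → G)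
    (lam : Fin r → ℂ) : HTilde E G :=
  SemidirectProduct.inr (g lam lam)⁻¹ *
    SemidirectProduct.inl
      (OnePlus.mk (normalOrder (groupShift (fun μ => (g lam μ)⁻¹) lam
        (fun i => -dualVec i) (hvec b)).ser) (constantCoeff_normalOrder _))

/-- The quasi-grouplike element `x(lam) = g(lam, lam - ℏh^{(1)})`, given by
`x(lam)⁻¹ = :g⁻¹(lam, lam - ℏh^{(1)}):`. -/
def quasiGrouplike (b : Module.Basis (Fin r) ℂ a) (g : (Fin r → ℂ) → (Fin r → ℂ) → G)
    (lam : Fin r → ℂ) : HTilde E G :=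
  (inverseElement b g lam)⁻¹

/-- The Taylor expansion of `φ(ℏh^{(1)}, ℏh^{(2)})` in `1 + ℏ (U(𝔤) ⊗ (U(𝔤) ⊗ U(𝔤)))[[ℏ]]`, for a
`G`-valued function `φ` on `𝔞* × 𝔞*` with `φ(0, 0) = 1`. -/
def twoShift (b : Module.Basis (Fin r) ℂ a) (φ : (Fin r → ℂ) × (Fin r → ℂ) → G) :
    OnePlus (Env E G ⊗[ℂ] (Env E G ⊗[ℂ] Env E G)) :=
  groupShift φ 0
    (Sum.elim (fun i => (dualVec i, 0)) (fun i => (0, dualVec i)))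
    (Sum.elim (fun i => hvec b i ⊗ₜ[ℂ] 1) (fun i => 1 ⊗ₜ[ℂ] hvec b i))

/-- The normally ordered expression
`:φ₁(ℏh^{(1)}, ℏh^{(2)}) ⊗ φ₂(ℏh^{(1)}, ℏh^{(2)}):`. -/
def normalOrdered₂ (b : Module.Basis (Fin r) ℂ a)
    (φ₁ φ₂ : (Fin r → ℂ) × (Fin r → ℂ) → G) : (Env E G ⊗[ℂ] Env E G)⟦X⟧ :=
  normalOrder
    (PowerSeries.map (Algebra.TensorProduct.map
        (Algebra.TensorProduct.includeLeft : Env E G →ₐ[ℂ] Env E G ⊗[ℂ] Env E G)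
        (AlgHom.id ℂ (Env E G ⊗[ℂ] Env E G))).toRingHom (twoShift b φ₁).ser *
      PowerSeries.map (Algebra.TensorProduct.map
        (Algebra.TensorProduct.includeRight : Env E G →ₐ[ℂ] Env E G ⊗[ℂ] Env E G)
        (AlgHom.id ℂ (Env E G ⊗[ℂ] Env E G))).toRingHom (twoShift b φ₂).ser)

end LieGroup
end VertexIRF

/-! Every normally ordered Taylor expansion is treated as a parallel transport. For holomorphic `φ :
P → G` the left logarithmic derivative `θ = φ⁻¹dφ` is a flat connection (`maurerCartan`). For
directions `w_j` and commuting elements `c_j` of an algebra `C`, let `T x = ∑ (∂_{w_j} x + θ(w_j) x)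
c_j` act on `C`-valued functions (`op`). Then `exp(ℏT) 1` at `p` is `φ(p)⁻¹ φ(p + ℏ ∑ c_j w_j)` with
the `c_j` put to the right (`odeSol_evS`, `mapLin_groupShift`). Three properties carry the proof:
(a) by flatness, operators `T` with commuting coefficients commute, so transports may be composed in
any order (`op_commute`, `expS_comp`); (b) `exp(ℏT)` is multiplicative on products whose factors
commute with the right things (`expS_op_mul`); (c) a section `V` with `∂V = [V, θ]` is intertwined
by transport with its own Taylor expansion (`evS_expS_intertwine`). This applies to `V = Ad_{φ⁻¹} y`
(`dT_adSec`).

Write `x = X⁻¹ · g(λ,λ)` with `X = :g(λ,λ) g⁻¹(λ, λ-ℏh):`. Property (c) with `φ = g⁻¹` shows that `x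
y_i x⁻¹` is the expansion of `Ad_{g(λ,μ)} y_i` at `μ = λ - ℏh`. The coordinates of `λ - μ` expand to
`ℏh_k`, so the hypothesis turns `ℏ` times this series into `f_i(λ) - f_i(λ-ℏh)` (`X_mul_adTaylor`).

The definition of `J` unwinds to `Δ(X) J = X² M`, where `M = :g(λ,λ) g⁻¹(λ-ℏh⁽²⁾, λ-ℏ(h⁽¹⁾+h⁽²⁾)):`
sits in the first factor (`transform_eq_evS`, `map_comul_mul_serJ`). Let `N` be the normally ordered
expansion of the claimed pair `(A, B)`. The hypothesis yields `z₁∘Ad_{A⁻¹} + z₂∘Ad_{B⁻¹} = z₁ + z₂`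
on `𝔞` (`pairing_comp`), and (c) in `G × G` gives that `N` commutes with `Δ(y)`, `y ∈ 𝔞`. Now
consider the pair `(g(λ,λ-t)⁻¹A(z), g(λ,λ-t)⁻¹B(z))` along the graph `t = z₁ + z₂`. Moving in `t`
and `z` separately gives `Δ(X) N`, because `N` commutes with `Δ(h)`. On the graph the pair is
`(g(λ-z₂, λ-z₁-z₂)⁻¹, g(λ,λ-z₂)⁻¹)`, which gives `X² M` (`comul_mul_normalForm`). Hence `J = N`, and
`J` has zero weight.

The twist equation then follows formally from `Δ(X) J = X² M`, the zero weight and coassociativity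
(`twist_of_eq`). -/

namespace VertexIRF

/-! ### Exponentials of linear operators on formal power series. -/

section ExpS

open Finset PowerSeries

variable {V V' : Type*} [Ring V] [Algebra ℂ V] [Ring V'] [Algebra ℂ V']

/-- The divided power `T ^ k / k!`. -/
def divPow (T : Module.End ℂ V) (k : ℕ) : Module.End ℂ V := ((k.factorial : ℂ)⁻¹) • T ^ k

theorem divPow_zero (T : Module.End ℂ V) : divPow T 0 = 1 := by simp [divPow]

theorem succ_smul_divPow (T : Module.End ℂ V) (k : ℕ) :
    ((k : ℂ) + 1) • divPow T (k + 1) = T * divPow T k := by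
  rw [divPow, divPow, smul_smul, Nat.factorial_succ, pow_succ', mul_smul_comm]
  congr 1
  have h1 : ((k : ℂ) + 1) ≠ 0 := Nat.cast_add_one_ne_zero k
  have h2 : (k.factorial : ℂ) ≠ 0 := Nat.cast_ne_zero.mpr (Nat.factorial_ne_zero k)
  push_cast
  field_simp

theorem succ_smul_divPow_apply (T : Module.End ℂ V) (k : ℕ) (v : V) :
    ((k : ℂ) + 1) • divPow T (k + 1) v = T (divPow T k v) := by
  rw [← LinearMap.smul_apply, succ_smul_divPow]; rfl

theorem divPow_mem {T : Module.End ℂ V} {P : V → Prop} (hP : ∀ v, P v → P (T v))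
    (hs : ∀ (c : ℂ) v, P v → P (c • v)) (k : ℕ) {v : V} (hv : P v) : P (divPow T k v) := by
  apply hs
  induction k with
  | zero => exact hv
  | succ k ih => rw [pow_succ']; exact hP _ ih

/-- Since `n + 1 = m₁ + m₂`, the weight splits in two, and each half loses the boundary term where
its own weight vanishes. This drives the inductions for divided powers, which are carried out after
multiplication by `n + 1`. -/
theorem sum_antidiagonal_succ_smul {M : Type*} [AddCommGroup M] [Module ℂ M] (n : ℕ)
    (F : ℕ → ℕ → M) :
    ((n : ℂ) + 1) • ∑ m ∈ antidiagonal (n + 1), F m.1 m.2 =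
      ∑ m ∈ antidiagonal n, (((m.1 : ℂ) + 1) • F (m.1 + 1) m.2 +
        ((m.2 : ℂ) + 1) • F m.1 (m.2 + 1)) := by
  have h : ((n : ℂ) + 1) • ∑ m ∈ antidiagonal (n + 1), F m.1 m.2 =
      ∑ m ∈ antidiagonal (n + 1), (m.1 : ℂ) • F m.1 m.2 +
        ∑ m ∈ antidiagonal (n + 1), (m.2 : ℂ) • F m.1 m.2 := by
    rw [smul_sum, ← sum_add_distrib]
    refine sum_congr rfl fun m hm => ?_
    rw [← add_smul]
    congr 1
    rw [HasAntidiagonal.mem_antidiagonal] at hm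
    exact_mod_cast hm.symm
  rw [h, Finset.Nat.sum_antidiagonal_succ, Finset.Nat.sum_antidiagonal_succ', sum_add_distrib]
  simp

theorem divPow_add {T S : Module.End ℂ V} (h : Commute T S) (n : ℕ) :
    divPow (T + S) n = ∑ m ∈ antidiagonal n, divPow T m.1 * divPow S m.2 := by
  induction n with
  | zero => simp [divPow_zero]
  | succ n ih =>
    have hn : ((n : ℂ) + 1) ≠ 0 := Nat.cast_add_one_ne_zero n
    have hS : ∀ k, Commute S (divPow T k) := fun k => by
      unfold divPow
      exact (h.symm.pow_right k).smul_right _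
    apply smul_right_injective _ hn
    change ((n : ℂ) + 1) • _ = ((n : ℂ) + 1) • _
    rw [succ_smul_divPow, ih, sum_antidiagonal_succ_smul n (fun a b => divPow T a * divPow S b),
      mul_sum]
    refine sum_congr rfl fun m _ => ?_
    rw [← smul_mul_assoc, succ_smul_divPow, ← mul_smul_comm, succ_smul_divPow, add_mul,
      mul_assoc, ← mul_assoc S, (hS m.1).eq, mul_assoc]

/-- Iterated Leibniz rule. The rule for `T` is only available on products of an element of `P` and
an element of `Q`, so these classes have to be stable under the operators for the induction to
proceed. -/
theorem divPow_mul {T T₁ T₂ : Module.End ℂ V} {P Q : V → Prop}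
    (hP : ∀ v, P v → P (T₁ v)) (hPs : ∀ (c : ℂ) v, P v → P (c • v))
    (hQ : ∀ v, Q v → Q (T₂ v)) (hQs : ∀ (c : ℂ) v, Q v → Q (c • v))
    (hT : ∀ u v, P u → Q v → T (u * v) = T₁ u * v + u * T₂ v)
    {u v : V} (hu : P u) (hv : Q v) (n : ℕ) :
    divPow T n (u * v) = ∑ m ∈ antidiagonal n, divPow T₁ m.1 u * divPow T₂ m.2 v := by
  induction n with
  | zero => simp [divPow_zero]
  | succ n ih =>
    have hn : ((n : ℂ) + 1) ≠ 0 := Nat.cast_add_one_ne_zero n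
    apply smul_right_injective _ hn
    change ((n : ℂ) + 1) • _ = ((n : ℂ) + 1) • _
    rw [succ_smul_divPow_apply, ih,
      sum_antidiagonal_succ_smul n (fun a b => divPow T₁ a u * divPow T₂ b v), map_sum]
    refine sum_congr rfl fun m _ => ?_
    rw [hT _ _ (divPow_mem hP hPs _ hu) (divPow_mem hQ hQs _ hv), ← smul_mul_assoc,
      succ_smul_divPow_apply, ← mul_smul_comm, succ_smul_divPow_apply]

/-- The action of `exp (ℏ T)` on power series in `ℏ`, for a linear operator `T`. -/
def expS (T : Module.End ℂ V) (p : V⟦X⟧) : V⟦X⟧ :=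
  PowerSeries.mk fun n => ∑ m ∈ antidiagonal n, divPow T m.2 (coeff m.1 p)

theorem coeff_expS (T : Module.End ℂ V) (p : V⟦X⟧) (n : ℕ) :
    coeff n (expS T p) = ∑ m ∈ antidiagonal n, divPow T m.2 (coeff m.1 p) := coeff_mk _ _

theorem coeff_expS_C (T : Module.End ℂ V) (v : V) (n : ℕ) :
    coeff n (expS T (C v)) = divPow T n v := by
  rw [coeff_expS, Finset.sum_eq_single (0, n)]
  · simp
  · intro m hm hne
    rw [coeff_C, if_neg, map_zero]
    intro h0
    apply hne
    rw [HasAntidiagonal.mem_antidiagonal, h0, zero_add] at hm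
    exact Prod.ext h0 hm
  · intro h
    exact absurd (HasAntidiagonal.mem_antidiagonal.mpr (zero_add n)) h

theorem coeff_expS_one (T : Module.End ℂ V) (n : ℕ) :
    coeff n (expS T 1) = divPow T n 1 := by
  rw [← map_one (C (R := V)), coeff_expS_C]

theorem constantCoeff_expS (T : Module.End ℂ V) (p : V⟦X⟧) :
    constantCoeff (expS T p) = constantCoeff p := by
  rw [← coeff_zero_eq_constantCoeff_apply, coeff_expS]
  simp [divPow_zero]

theorem expS_add_right (T : Module.End ℂ V) (p q : V⟦X⟧) :
    expS T (p + q) = expS T p + expS T q := by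
  ext n
  simp only [coeff_expS, map_add, sum_add_distrib]

/-- The binomial formula `divPow_add` reduces this to a reindexing of triples: degree in `p`, power
of `T`, power of `S`. -/
theorem expS_comp {T S : Module.End ℂ V} (h : Commute T S) (p : V⟦X⟧) :
    expS (T + S) p = expS T (expS S p) := by
  ext n
  simp only [coeff_expS, divPow_add h, LinearMap.sum_apply, map_sum, Finset.sum_sigma',
    Module.End.mul_apply]
  refine Finset.sum_nbij' (fun x => ⟨(x.1.1 + x.2.2, x.2.1), (x.1.1, x.2.2)⟩)
    (fun x => ⟨(x.2.1, x.2.2 + x.1.2), (x.1.2, x.2.2)⟩) ?_ ?_ ?_ ?_ ?_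
  · rintro ⟨⟨a, b⟩, ⟨c, d⟩⟩ hx
    simp only [mem_sigma, HasAntidiagonal.mem_antidiagonal] at hx ⊢
    obtain ⟨h1, h2⟩ := hx
    exact ⟨by omega, trivial⟩
  · rintro ⟨⟨a, b⟩, ⟨c, d⟩⟩ hx
    simp only [mem_sigma, HasAntidiagonal.mem_antidiagonal] at hx ⊢
    omega
  · rintro ⟨⟨a, b⟩, ⟨c, d⟩⟩ hx
    simp only [mem_sigma, HasAntidiagonal.mem_antidiagonal] at hx
    obtain ⟨h1, h2⟩ := hx
    subst h2
    simp [add_comm]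
  · rintro ⟨⟨a, b⟩, ⟨c, d⟩⟩ hx
    simp only [mem_sigma, HasAntidiagonal.mem_antidiagonal] at hx
    obtain ⟨h1, h2⟩ := hx
    subst h2
    simp
  · rintro ⟨⟨a, b⟩, ⟨c, d⟩⟩ hx
    rfl

theorem expS_mul {T T₁ T₂ : Module.End ℂ V} (P Q : V → Prop)
    (hP : ∀ v, P v → P (T₁ v)) (hPs : ∀ (c : ℂ) v, P v → P (c • v))
    (hQ : ∀ v, Q v → Q (T₂ v)) (hQs : ∀ (c : ℂ) v, Q v → Q (c • v))
    (hT : ∀ u v, P u → Q v → T (u * v) = T₁ u * v + u * T₂ v)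
    {p q : V⟦X⟧} (hp : ∀ n, P (coeff n p)) (hq : ∀ n, Q (coeff n q)) :
    expS T (p * q) = expS T₁ p * expS T₂ q := by
  ext n
  simp only [coeff_mul, coeff_expS, map_sum, divPow_mul hP hPs hQ hQs hT (hp _) (hq _),
    Finset.sum_mul_sum]
  simp only [Finset.sum_sigma']
  -- Four degrees are summed: those in `p` and `q`, and those in `T₁` and `T₂`. Exchanging the two
  -- middle ones regroups them by factor, and the exchange is its own inverse.
  refine Finset.sum_nbij'
    (fun x => ⟨(x.2.1.1 + x.2.2.1, x.2.1.2 + x.2.2.2),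
      ⟨(x.2.1.1, x.2.2.1), (x.2.1.2, x.2.2.2)⟩⟩)
    (fun x => ⟨(x.2.1.1 + x.2.2.1, x.2.1.2 + x.2.2.2),
      ⟨(x.2.1.1, x.2.2.1), (x.2.1.2, x.2.2.2)⟩⟩) ?_ ?_ ?_ ?_ ?_
  · rintro ⟨⟨a, b⟩, ⟨⟨c, d⟩, ⟨e, f⟩⟩⟩ hx
    simp only [mem_sigma, HasAntidiagonal.mem_antidiagonal] at hx ⊢
    obtain ⟨h1, h2, h3⟩ := hx
    exact ⟨by omega, trivial, trivial⟩
  · rintro ⟨⟨a, b⟩, ⟨⟨c, d⟩, ⟨e, f⟩⟩⟩ hx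
    simp only [mem_sigma, HasAntidiagonal.mem_antidiagonal] at hx ⊢
    obtain ⟨h1, h2, h3⟩ := hx
    exact ⟨by omega, trivial, trivial⟩
  · rintro ⟨⟨a, b⟩, ⟨⟨c, d⟩, ⟨e, f⟩⟩⟩ hx
    simp only [mem_sigma, HasAntidiagonal.mem_antidiagonal] at hx
    obtain ⟨h1, h2, h3⟩ := hx
    subst h2 h3
    rfl
  · rintro ⟨⟨a, b⟩, ⟨⟨c, d⟩, ⟨e, f⟩⟩⟩ hx
    simp only [mem_sigma, HasAntidiagonal.mem_antidiagonal] at hx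
    obtain ⟨h1, h2, h3⟩ := hx
    subst h2 h3
    rfl
  · rintro ⟨⟨a, b⟩, ⟨⟨c, d⟩, ⟨e, f⟩⟩⟩ hx
    rfl

theorem coeff_mapLin (m : V →ₗ[ℂ] V') (p : V⟦X⟧) (n : ℕ) :
    coeff n (mapLin m p) = m (coeff n p) := coeff_mk _ _

theorem mapLin_algHom (f : V →ₐ[ℂ] V') (p : V⟦X⟧) :
    mapLin f.toLinearMap p = PowerSeries.map f.toRingHom p := by
  ext n
  rw [coeff_mapLin, coeff_map]
  rfl

/-- An intertwiner of two operators on a stable set intertwines their exponentials. -/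
theorem mapLin_expS_of_mem {m : V →ₗ[ℂ] V'} {T : Module.End ℂ V} {T' : Module.End ℂ V'}
    (P : V → Prop) (hP : ∀ v, P v → P (T v)) (h : ∀ v, P v → m (T v) = T' (m v))
    {p : V⟦X⟧} (hp : ∀ n, P (coeff n p)) :
    mapLin m (expS T p) = expS T' (mapLin m p) := by
  have h1 : ∀ k v, P v → P ((T ^ k) v) := by
    intro k v hv
    induction k with
    | zero => exact hv
    | succ k ih => rw [pow_succ']; exact hP _ ih
  have h2 : ∀ k v, P v → m ((T ^ k) v) = (T' ^ k) (m v) := by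
    intro k v hv
    induction k with
    | zero => rfl
    | succ k ih =>
      rw [pow_succ', pow_succ', Module.End.mul_apply, Module.End.mul_apply, h _ (h1 k v hv), ih]
  ext n
  simp only [coeff_mapLin, coeff_expS, map_sum, divPow, LinearMap.smul_apply, map_smul]
  exact sum_congr rfl fun k _ => by rw [h2 _ _ (hp _)]

theorem mapLin_expS {m : V →ₗ[ℂ] V'} {T : Module.End ℂ V} {T' : Module.End ℂ V'}
    (h : ∀ v, m (T v) = T' (m v)) (p : V⟦X⟧) :
    mapLin m (expS T p) = expS T' (mapLin m p) :=
  mapLin_expS_of_mem (fun _ => True) (fun _ _ => trivial) (fun v _ => h v) (fun _ => trivial)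

theorem map_expS {f : V →ₐ[ℂ] V'} {T : Module.End ℂ V} {T' : Module.End ℂ V'}
    (h : ∀ v, f (T v) = T' (f v)) (p : V⟦X⟧) :
    PowerSeries.map f.toRingHom (expS T p) = expS T' (PowerSeries.map f.toRingHom p) := by
  rw [← mapLin_algHom, ← mapLin_algHom]
  exact mapLin_expS h p

theorem expS_of_forall_eq_zero {T : Module.End ℂ V} {p : V⟦X⟧} (h : ∀ n, T (coeff n p) = 0) :
    expS T p = p := by
  ext n
  rw [coeff_expS, Finset.sum_eq_single (n, 0)]
  · rw [divPow_zero]; rfl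
  · rintro ⟨a, b⟩ hm hne
    obtain ⟨c, rfl⟩ : ∃ c, b = c + 1 := Nat.exists_eq_succ_of_ne_zero (by
      rintro rfl
      exact hne (by simpa using hm))
    rw [divPow, LinearMap.smul_apply, pow_succ, Module.End.mul_apply, h, map_zero, smul_zero]
  · intro h
    exact absurd (HasAntidiagonal.mem_antidiagonal.mpr (add_zero n)) h

theorem coeff_expS_mem {T : Module.End ℂ V} (S : Submodule ℂ V) (hT : ∀ v ∈ S, T v ∈ S)
    {p : V⟦X⟧} (hp : ∀ n, coeff n p ∈ S) (n : ℕ) : coeff n (expS T p) ∈ S := by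
  rw [coeff_expS]
  exact S.sum_mem fun m _ => divPow_mem (P := (· ∈ S)) hT (fun c v hv => S.smul_mem c hv) _ (hp _)

end ExpS

end VertexIRF

namespace VertexIRF

/-! ### Flat connections and covariant Taylor operators over an algebra of functions. -/

section Operators

open Finset PowerSeries

/-- A module `P` of directions acting on a commutative algebra `O` by commuting derivations. -/
structure DirDer (P O : Type*) [AddCommGroup P] [Module ℂ P] [CommRing O] [Algebra ℂ O] where
  /-- The derivation along a direction. -/
  der : P →ₗ[ℂ] Derivation ℂ O O
  comm : ∀ v w f, der v (der w f) = der w (der v f)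

variable {O O' C C' P P' J : Type*} [CommRing O] [Algebra ℂ O] [CommRing O'] [Algebra ℂ O']
  [Ring C] [Algebra ℂ C] [Ring C'] [Algebra ℂ C'] [AddCommGroup P] [Module ℂ P]
  [AddCommGroup P'] [Module ℂ P']

/-- Extension of a linear map of the coefficients. -/
abbrev lL (O : Type*) [CommRing O] [Algebra ℂ O] (f : C →ₗ[ℂ] C') : O ⊗[ℂ] C →ₗ[ℂ] O ⊗[ℂ] C' :=
  f.lTensor O

/-- Extension of an algebra homomorphism of the coefficients. -/
abbrev lT (O : Type*) [CommRing O] [Algebra ℂ O] (f : C →ₐ[ℂ] C') : O ⊗[ℂ] C →ₐ[ℂ] O ⊗[ℂ] C' :=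
  Algebra.TensorProduct.map (AlgHom.id ℂ O) f

/-- Change of the ring of functions. -/
abbrev rT (C : Type*) [Ring C] [Algebra ℂ C] (ψ : O →ₐ[ℂ] O') : O ⊗[ℂ] C →ₐ[ℂ] O' ⊗[ℂ] C :=
  Algebra.TensorProduct.map ψ (AlgHom.id ℂ C)

/-- Evaluation of `C`-valued functions at a point. -/
def evT (C : Type*) [Ring C] [Algebra ℂ C] (ε : O →ₐ[ℂ] ℂ) : O ⊗[ℂ] C →ₐ[ℂ] C :=
  (Algebra.TensorProduct.lid ℂ C).toAlgHom.comp (rT C ε)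

@[simp] theorem evT_tmul (ε : O →ₐ[ℂ] ℂ) (f : O) (c : C) : evT C ε (f ⊗ₜ c) = ε f • c := by
  simp [evT]

theorem evT_lL (ε : O →ₐ[ℂ] ℂ) (f : C →ₗ[ℂ] C') (t : O ⊗[ℂ] C) :
    evT C' ε (lL O f t) = f (evT C ε t) := by
  induction t with
  | zero => simp
  | tmul a c => simp
  | add x y hx hy => rw [map_add, map_add, hx, hy, map_add, map_add]

theorem evT_lT (ε : O →ₐ[ℂ] ℂ) (f : C →ₐ[ℂ] C') (t : O ⊗[ℂ] C) :
    evT C' ε (lT O f t) = f (evT C ε t) := evT_lL ε f.toLinearMap t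

theorem evT_rT (ε : O' →ₐ[ℂ] ℂ) (ψ : O →ₐ[ℂ] O') (t : O ⊗[ℂ] C) :
    evT C ε (rT C ψ t) = evT C (ε.comp ψ) t := by
  induction t with
  | zero => simp
  | tmul a c => simp
  | add x y hx hy => rw [map_add, map_add, hx, hy, map_add]

variable (dd : DirDer P O) (dd' : DirDer P' O')

/-- The derivation of `C`-valued functions along a direction. -/
def dT (C : Type*) [Ring C] [Algebra ℂ C] (w : P) : Module.End ℂ (O ⊗[ℂ] C) :=
  (dd.der w).toLinearMap.rTensor C

@[simp] theorem dT_tmul (w : P) (f : O) (c : C) : dT dd C w (f ⊗ₜ c) = dd.der w f ⊗ₜ c := rfl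

theorem dT_add (v w : P) : dT dd C (v + w) = dT dd C v + dT dd C w := by
  ext f c
  simp [TensorProduct.add_tmul]

theorem dT_mul (w : P) (x y : O ⊗[ℂ] C) :
    dT dd C w (x * y) = dT dd C w x * y + x * dT dd C w y := by
  induction x with
  | zero => simp
  | add x x' hx hx' => rw [add_mul, map_add, hx, hx', map_add, add_mul, add_mul]; abel
  | tmul f c =>
    induction y with
    | zero => simp
    | add y y' hy hy' => rw [mul_add, map_add, hy, hy', map_add, mul_add, mul_add]; abel
    | tmul f' c' =>
      simp only [Algebra.TensorProduct.tmul_mul_tmul, dT_tmul, Derivation.leibniz,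
        TensorProduct.add_tmul, smul_eq_mul]
      rw [add_comm, mul_comm f']

theorem dT_one_tmul (w : P) (c : C) : dT dd C w (1 ⊗ₜ c) = 0 := by simp

theorem dT_one (w : P) : dT dd C w 1 = 0 := dT_one_tmul dd w 1

theorem dT_comm (v w : P) (x : O ⊗[ℂ] C) :
    dT dd C v (dT dd C w x) = dT dd C w (dT dd C v x) := by
  induction x with
  | zero => simp
  | tmul f c => simp [dd.comm v w f]
  | add x y hx hy => simp only [map_add, hx, hy]

theorem lL_dT (f : C →ₗ[ℂ] C') (w : P) (x : O ⊗[ℂ] C) :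
    lL O f (dT dd C w x) = dT dd C' w (lL O f x) := by
  induction x with
  | zero => simp
  | tmul f c => simp
  | add x y hx hy => simp only [map_add, hx, hy]

theorem lT_dT (f : C →ₐ[ℂ] C') (w : P) (x : O ⊗[ℂ] C) :
    lT O f (dT dd C w x) = dT dd C' w (lT O f x) := lL_dT dd f.toLinearMap w x

variable {dd dd'} in
theorem rT_dT {ψ : O →ₐ[ℂ] O'} {v : P} {w : P'} (h : ∀ f, ψ (dd.der v f) = dd'.der w (ψ f))
    (x : O ⊗[ℂ] C) : rT C ψ (dT dd C v x) = dT dd' C w (rT C ψ x) := by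
  induction x with
  | zero => simp
  | tmul f c => simp [h]
  | add x y hx hy => simp only [map_add, hx, hy]

theorem lL_mul_one_tmul {f : C →ₗ[ℂ] C'} {c : C} {c' : C'} (h : ∀ x, f (x * c) = f x * c')
    (x : O ⊗[ℂ] C) : lL O f (x * 1 ⊗ₜ c) = lL O f x * 1 ⊗ₜ c' := by
  induction x with
  | zero => simp
  | tmul g b => simp [h]
  | add x y hx hy => simp only [add_mul, map_add, hx, hy]

/-- The legs of two algebra homomorphisms with commuting images commute. -/
theorem lT_commute {C₁ C₂ : Type*} [Ring C₁] [Algebra ℂ C₁] [Ring C₂] [Algebra ℂ C₂]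
    {f : C₁ →ₐ[ℂ] C} {g : C₂ →ₐ[ℂ] C} (h : ∀ a b, Commute (f a) (g b))
    (x : O ⊗[ℂ] C₁) (y : O ⊗[ℂ] C₂) : Commute (lT O f x) (lT O g y) := by
  induction x with
  | zero => simp
  | add x x' hx hx' => rw [map_add]; exact hx.add_left hx'
  | tmul a b =>
    induction y with
    | zero => simp
    | add y y' hy hy' => rw [map_add]; exact hy.add_right hy'
    | tmul a' b' =>
      simp only [Algebra.TensorProduct.map_tmul, AlgHom.coe_id, id_eq, Commute, SemiconjBy,
        Algebra.TensorProduct.tmul_mul_tmul]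
      rw [mul_comm, (h b b').eq]

theorem lT_commute_tmul {C₁ : Type*} [Ring C₁] [Algebra ℂ C₁]
    {f : C₁ →ₐ[ℂ] C} {c : C} (h : ∀ a, Commute (f a) c) (x : O ⊗[ℂ] C₁) :
    Commute (lT O f x) (1 ⊗ₜ c) := by
  induction x with
  | zero => simp
  | add x x' hx hx' => rw [map_add]; exact hx.add_left hx'
  | tmul a b =>
    simp only [Algebra.TensorProduct.map_tmul, AlgHom.coe_id, id_eq, Commute, SemiconjBy,
        Algebra.TensorProduct.tmul_mul_tmul, mul_one, one_mul, (h b).eq]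

theorem tmul_commute_tmul {c c' : C} (h : Commute c c') (f g : O) :
    Commute (f ⊗ₜ[ℂ] c) (g ⊗ₜ[ℂ] c') := by
  simp only [Commute, SemiconjBy, Algebra.TensorProduct.tmul_mul_tmul, mul_comm f, h.eq]

theorem dT_commute_one_tmul {w : P} {c : C} {x : O ⊗[ℂ] C} (h : Commute x (1 ⊗ₜ c)) :
    Commute (dT dd C w x) (1 ⊗ₜ c) := by
  have h1 := congrArg (dT dd C w) h.eq
  rw [dT_mul, dT_mul, dT_one_tmul, mul_zero, add_zero, zero_mul, zero_add] at h1
  exact h1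

/-- Flatness of a connection. -/
def IsFlat (θ : P →ₗ[ℂ] O ⊗[ℂ] C) : Prop :=
  ∀ v w, dT dd C v (θ w) - dT dd C w (θ v) + (θ v * θ w - θ w * θ v) = 0

/-- The covariant derivative. -/
def cov (θ : P →ₗ[ℂ] O ⊗[ℂ] C) (w : P) : Module.End ℂ (O ⊗[ℂ] C) :=
  dT dd C w + LinearMap.mulLeft ℂ (θ w)

theorem cov_apply (θ : P →ₗ[ℂ] O ⊗[ℂ] C) (w : P) (x : O ⊗[ℂ] C) :
    cov dd θ w x = dT dd C w x + θ w * x := rfl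

theorem cov_add (θ : P →ₗ[ℂ] O ⊗[ℂ] C) (v w : P) (x : O ⊗[ℂ] C) :
    cov dd θ (v + w) x = cov dd θ v x + cov dd θ w x := by
  simp only [cov_apply, dT_add, map_add, add_mul, LinearMap.add_apply]
  abel

variable {dd}

/-- The commutator of two covariant derivatives is left multiplication by the curvature. -/
theorem IsFlat.cov_comm {θ : P →ₗ[ℂ] O ⊗[ℂ] C} (h : IsFlat dd θ) (v w : P) (x : O ⊗[ℂ] C) :
    cov dd θ v (cov dd θ w x) = cov dd θ w (cov dd θ v x) := by
  have h1 := congrArg (· * x) (h v w)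
  simp only [add_mul, sub_mul, zero_mul] at h1
  simp only [cov_apply, map_add, dT_mul, dT_comm dd v w, ← mul_assoc]
  rw [← sub_eq_zero, ← h1]
  abel

theorem IsFlat.lT {θ : P →ₗ[ℂ] O ⊗[ℂ] C} (h : IsFlat dd θ) (f : C →ₐ[ℂ] C') :
    IsFlat dd ((lT O f).toLinearMap ∘ₗ θ) := by
  intro v w
  have h1 := congrArg (VertexIRF.lT O f) (h v w)
  simp only [map_add, map_sub, map_mul, map_zero] at h1
  rw [lT_dT, lT_dT] at h1
  exact h1

/-- The curvature of a sum differs from the sum of the curvatures by commutators between the two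
connections, and these vanish. -/
theorem IsFlat.add {θ₁ θ₂ : P →ₗ[ℂ] O ⊗[ℂ] C} (h₁ : IsFlat dd θ₁) (h₂ : IsFlat dd θ₂)
    (h : ∀ v w, Commute (θ₁ v) (θ₂ w)) : IsFlat dd (θ₁ + θ₂) := by
  intro v w
  have e := congrArg₂ (· + ·) (h₁ v w) (h₂ v w)
  simp only [add_zero] at e
  simp only [LinearMap.add_apply, map_add, add_mul, mul_add, (h v w).eq, (h w v).eq]
  rw [← e]
  abel

variable (dd) [Fintype J] {K : Type*} [Fintype K]

/-- The operator `x ↦ ∑ j, (D_{w j} x) c_j`, whose exponential is the covariant Taylor expansion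
along `∑ j, c_j w_j`, with the elements `c_j` put to the extreme right. -/
def op (θ : P →ₗ[ℂ] O ⊗[ℂ] C) (w : J → P) (c : J → C) : Module.End ℂ (O ⊗[ℂ] C) :=
  ∑ j, LinearMap.mulRight ℂ (1 ⊗ₜ c j) * cov dd θ (w j)

theorem op_apply (θ : P →ₗ[ℂ] O ⊗[ℂ] C) (w : J → P) (c : J → C) (x : O ⊗[ℂ] C) :
    op dd θ w c x = ∑ j, (dT dd C (w j) x + θ (w j) * x) * 1 ⊗ₜ c j := by
  simp only [op, LinearMap.sum_apply]
  rfl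

theorem op_sumElim (θ : P →ₗ[ℂ] O ⊗[ℂ] C) (w : J → P) (w' : K → P) (c : J → C) (c' : K → C) :
    op dd θ (Sum.elim w w') (Sum.elim c c') = op dd θ w c + op dd θ w' c' := by
  simp [op]

theorem op_add_dir (θ : P →ₗ[ℂ] O ⊗[ℂ] C) (v w : J → P) (c : J → C) :
    op dd θ (fun j => v j + w j) c = op dd θ v c + op dd θ w c := by
  apply LinearMap.ext
  intro x
  simp only [op_apply, ← cov_apply, cov_add, LinearMap.add_apply, add_mul,
    Finset.sum_add_distrib]

theorem op_add_coeff (θ : P →ₗ[ℂ] O ⊗[ℂ] C) (w : J → P) (c c' : J → C) :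
    op dd θ w (fun j => c j + c' j) = op dd θ w c + op dd θ w c' := by
  apply LinearMap.ext
  intro x
  simp only [op_apply, LinearMap.add_apply, TensorProduct.tmul_add, mul_add,
    Finset.sum_add_distrib]

variable {dd}

/-- Right multiplications by constants commute with covariant derivatives, which act by derivation
and by left multiplication. Covariant derivatives commute by flatness, and right multiplications
because the coefficients do. This is path independence of the transport in formal terms. -/
theorem op_commute {θ : P →ₗ[ℂ] O ⊗[ℂ] C} (h : IsFlat dd θ) {w : J → P} {w' : K → P}
    {c : J → C} {c' : K → C} (hc : ∀ j k, Commute (c j) (c' k)) :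
    Commute (op dd θ w c) (op dd θ w' c') := by
  have hR : ∀ (c : C) (v : P),
      Commute (LinearMap.mulRight ℂ ((1 : O) ⊗ₜ[ℂ] c)) (cov dd θ v) := by
    intro c v
    apply LinearMap.ext
    intro x
    simp only [Module.End.mul_apply, LinearMap.mulRight_apply, cov_apply, dT_mul, dT_one_tmul,
      mul_zero, add_zero, add_mul, mul_assoc]
  refine Commute.sum_left _ _ _ fun j _ => Commute.sum_right _ _ _ fun k _ => ?_
  refine Commute.mul_left (Commute.mul_right ?_ (hR _ _)) (Commute.mul_right (hR _ _).symm ?_)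
  · apply LinearMap.ext
    intro x
    simp only [Module.End.mul_apply, LinearMap.mulRight_apply, mul_assoc]
    rw [(tmul_commute_tmul (hc j k) 1 1).eq]
  · apply LinearMap.ext
    intro x
    exact h.cov_comm _ _ x

theorem lL_op {f : C →ₗ[ℂ] C'} {θ : P →ₗ[ℂ] O ⊗[ℂ] C} {θ' : P →ₗ[ℂ] O ⊗[ℂ] C'} {w : J → P}
    {c : J → C} {c' : J → C'} (hc : ∀ j x, f (x * c j) = f x * c' j)
    (hθ : ∀ j x, lL O f (θ (w j) * x) = θ' (w j) * lL O f x) (x : O ⊗[ℂ] C) :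
    lL O f (op dd θ w c x) = op dd θ' w c' (lL O f x) := by
  rw [op_apply, op_apply, map_sum]
  refine Finset.sum_congr rfl fun j _ => ?_
  rw [lL_mul_one_tmul (hc j), map_add, lL_dT, hθ]

theorem lT_op {f : C →ₐ[ℂ] C'} {θ : P →ₗ[ℂ] O ⊗[ℂ] C} {θ' : P →ₗ[ℂ] O ⊗[ℂ] C'} {w : J → P}
    {c : J → C} {c' : J → C'} (hc : ∀ j, f (c j) = c' j)
    (hθ : ∀ j, lT O f (θ (w j)) = θ' (w j)) (x : O ⊗[ℂ] C) :
    lT O f (op dd θ w c x) = op dd θ' w c' (lT O f x) := by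
  rw [op_apply, op_apply, map_sum]
  refine Finset.sum_congr rfl fun j _ => ?_
  rw [map_mul, map_add, lT_dT, map_mul, hθ, Algebra.TensorProduct.map_tmul, hc, map_one]

theorem rT_op {dd' : DirDer P' O'} {ψ : O →ₐ[ℂ] O'} {θ : P →ₗ[ℂ] O ⊗[ℂ] C}
    {θ' : P' →ₗ[ℂ] O' ⊗[ℂ] C} {v : J → P} {w : J → P'} {c : J → C}
    (h : ∀ j f, ψ (dd.der (v j) f) = dd'.der (w j) (ψ f))
    (hθ : ∀ j, rT C ψ (θ (v j)) = θ' (w j)) (x : O ⊗[ℂ] C) :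
    rT C ψ (op dd θ v c x) = op dd' θ' w c (rT C ψ x) := by
  rw [op_apply, op_apply, map_sum]
  refine Finset.sum_congr rfl fun j _ => ?_
  rw [map_mul, map_add, rT_dT (h j), map_mul, hθ, Algebra.TensorProduct.map_tmul, map_one]
  rfl

/-- In the product, `x` has to pass `θ₂`, so that `θ₂` acts on `y` from the left, and `y` has to
pass the coefficients, so that those of the first term return to the derivative of `x`. -/
theorem op_add_mul {θ₁ θ₂ : P →ₗ[ℂ] O ⊗[ℂ] C} {w : J → P} {c : J → C} {x y : O ⊗[ℂ] C}
    (hx : ∀ j, Commute x (θ₂ (w j))) (hy : ∀ j, Commute y (1 ⊗ₜ c j)) :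
    op dd (θ₁ + θ₂) w c (x * y) = op dd θ₁ w c x * y + x * op dd θ₂ w c y := by
  simp only [op_apply, Finset.sum_mul, Finset.mul_sum, ← Finset.sum_add_distrib, dT_mul,
    LinearMap.add_apply]
  refine Finset.sum_congr rfl fun j _ => ?_
  have h1 := (hx j).eq
  have h2 := (hy j).eq
  simp only [add_mul, mul_add, mul_assoc, h2]
  rw [← mul_assoc x (θ₂ (w j)), h1]
  simp only [mul_assoc]
  abel

theorem op_commute_coeff {θ : P →ₗ[ℂ] O ⊗[ℂ] C} {w : J → P} {c : J → C} {d : C} {x : O ⊗[ℂ] C}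
    (hx : Commute x (1 ⊗ₜ d)) (hc : ∀ j, Commute (c j) d)
    (hθ : ∀ j, Commute (θ (w j)) (1 ⊗ₜ d)) : Commute (op dd θ w c x) (1 ⊗ₜ d) := by
  rw [op_apply]
  exact Commute.sum_left _ _ _ fun j _ =>
    ((dT_commute_one_tmul dd hx).add_left ((hθ j).mul_left hx)).mul_left
      (tmul_commute_tmul (hc j) 1 1)

/-- The exponential of `op` is multiplicative for sums of connections, under conditions on the
commutation of the factors. -/
theorem expS_op_mul {θ₁ θ₂ : P →ₗ[ℂ] O ⊗[ℂ] C} {w : J → P} {c : J → C}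
    (S : Submodule ℂ (O ⊗[ℂ] C)) (hS : ∀ x ∈ S, op dd θ₁ w c x ∈ S)
    (hSθ : ∀ x ∈ S, ∀ j, Commute x (θ₂ (w j)))
    (hθ : ∀ i j, Commute (θ₂ (w i)) (1 ⊗ₜ c j)) (hc : ∀ i j, Commute (c i) (c j))
    {p q : (O ⊗[ℂ] C)⟦X⟧} (hp : ∀ n, coeff n p ∈ S)
    (hq : ∀ n j, Commute (coeff n q) (1 ⊗ₜ c j)) :
    expS (op dd (θ₁ + θ₂) w c) (p * q) = expS (op dd θ₁ w c) p * expS (op dd θ₂ w c) q :=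
  expS_mul (· ∈ S) (fun y => ∀ j, Commute y (1 ⊗ₜ c j)) hS (fun a _ h => S.smul_mem a h)
    (fun _ h j => op_commute_coeff (h j) (fun i => hc i j) (fun i => hθ i j))
    (fun a _ h j => (h j).smul_left a)
    (fun _ _ hx hy => op_add_mul (hSθ _ hx) hy) hp hq

/-- With trivial second connection nothing is required of the left factor, and the right factor
undergoes the ordinary Taylor expansion. This is how covariant expansions are reduced to ordinary
ones. -/
theorem expS_op_mul_zero {θ : P →ₗ[ℂ] O ⊗[ℂ] C} {w : J → P} {c : J → C}
    (hc : ∀ i j, Commute (c i) (c j)) (p : (O ⊗[ℂ] C)⟦X⟧) {q : (O ⊗[ℂ] C)⟦X⟧}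
    (hq : ∀ n j, Commute (coeff n q) (1 ⊗ₜ c j)) :
    expS (op dd θ w c) (p * q) = expS (op dd θ w c) p * expS (op dd 0 w c) q := by
  have h := expS_op_mul (dd := dd) (θ₁ := θ) (θ₂ := 0) (w := w) ⊤ (fun _ _ => trivial)
    (fun x _ j => Commute.zero_right x) (fun i j => Commute.zero_left _) hc
    (p := p) (fun _ => trivial) hq
  rwa [add_zero] at h

end Operators

end VertexIRF

namespace VertexIRF

/-! ### Logarithmic derivatives of holomorphic group-valued functions. -/

section LogDeriv

variable {E : Type*} [NormedAddCommGroup E] [NormedSpace ℂ E] [CompleteSpace E]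
  {G : Type*} [TopologicalSpace G] [ChartedSpace E G] [Group G] [LieGroup 𝓘(ℂ, E) ω G]
  {W : Type*} [NormedAddCommGroup W] [NormedSpace ℂ W]
  {W' : Type*} [NormedAddCommGroup W'] [NormedSpace ℂ W']

set_option linter.unusedSectionVars false

/-- A `G`-valued function is holomorphic at a point. -/
abbrev GHolAt (E : Type*) [NormedAddCommGroup E] [NormedSpace ℂ E] {G : Type*}
    [TopologicalSpace G] [ChartedSpace E G] {W : Type*} [NormedAddCommGroup W] [NormedSpace ℂ W]
    (φ : W → G) (q : W) : Prop :=
  ContMDiffAt 𝓘(ℂ, W) 𝓘(ℂ, E) ω φ q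

theorem GHolAt.mul {φ ψ : W → G} {q : W} (hφ : GHolAt E φ q) (hψ : GHolAt E ψ q) :
    GHolAt E (fun q => φ q * ψ q) q := ContMDiffAt.mul hφ hψ

theorem GHolAt.inv {φ : W → G} {q : W} (hφ : GHolAt E φ q) :
    GHolAt E (fun q => (φ q)⁻¹) q := ContMDiffAt.inv hφ

theorem GHolAt.const (γ : G) (q : W) : GHolAt E (fun _ : W => γ) q := contMDiffAt_const

theorem GHolAt.comp {φ : W → G} {ι : W' → W} {q : W'} (hφ : GHolAt E φ (ι q))
    (hι : ContDiffAt ℂ ω ι q) : GHolAt E (fun q => φ (ι q)) q :=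
  ContMDiffAt.comp q hφ hι.contMDiffAt

theorem GHolAt.eventually {φ : W → G} {q : W} (hφ : GHolAt E φ q) :
    ∀ᶠ q' in 𝓝 q, GHolAt E φ q' := (contMDiffAt_iff_contMDiffAt_nhds (by simp)).mp hφ

theorem GHolAt.mdifferentiableAt {φ : W → G} {q : W} (hφ : GHolAt E φ q) :
    MDifferentiableAt 𝓘(ℂ, W) 𝓘(ℂ, E) φ q := ContMDiffAt.mdifferentiableAt hφ (by simp)

theorem logDeriv_const_mul (γ : G) (φ : W → G) :
    logDeriv (E := E) (fun q => γ * φ q) = logDeriv φ := by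
  funext q w
  simp only [logDeriv]
  congr 2
  funext q'
  group

theorem logDeriv_const (γ : G) (q w : W) : logDeriv (E := E) (fun _ => γ) q w = 0 := by
  simp only [logDeriv, mfderiv_const]
  rfl

theorem logDeriv_add (φ : W → G) (q v w : W) :
    logDeriv (E := E) φ q (v + w) = logDeriv φ q v + logDeriv φ q w :=
  map_add (mfderiv 𝓘(ℂ, W) 𝓘(ℂ, E) (fun q' => (φ q)⁻¹ * φ q') q : W →L[ℂ] E) v w

theorem logDeriv_smul (φ : W → G) (q : W) (a : ℂ) (w : W) :
    logDeriv (E := E) φ q (a • w) = a • logDeriv φ q w :=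
  map_smul (mfderiv 𝓘(ℂ, W) 𝓘(ℂ, E) (fun q' => (φ q)⁻¹ * φ q') q : W →L[ℂ] E) a w

theorem logDeriv_comp {φ : W → G} {ι : W' → W} {q : W'} (hφ : GHolAt E φ (ι q))
    {L : W' →L[ℂ] W} (hι : HasFDerivAt ι L q) (w : W') :
    logDeriv (E := E) (fun q => φ (ι q)) q w = logDeriv φ (ι q) (L w) := by
  have h1 : MDifferentiableAt 𝓘(ℂ, W) 𝓘(ℂ, E) (fun q' => (φ (ι q))⁻¹ * φ q') (ι q) :=
    ((GHolAt.const (E := E) (φ (ι q))⁻¹ (ι q)).mul hφ).mdifferentiableAt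
  have h2 : MDifferentiableAt 𝓘(ℂ, W') 𝓘(ℂ, W) ι q := hι.differentiableAt.mdifferentiableAt
  have h3 : mfderiv 𝓘(ℂ, W') 𝓘(ℂ, E) ((fun q' => (φ (ι q))⁻¹ * φ q') ∘ ι) q = _ :=
    mfderiv_comp q h1 h2
  have h4 : mfderiv 𝓘(ℂ, W') 𝓘(ℂ, W) ι q = L := by
    rw [mfderiv_eq_fderiv]; exact hι.fderiv
  rw [h4] at h3
  exact congrArg (fun f : W' →L[ℂ] E => f w) h3

theorem logDeriv_mul_const {φ : W → G} {q : W} (hφ : GHolAt E φ q) (γ : G) (w : W) :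
    logDeriv (E := E) (fun q => φ q * γ) q w = AdLin E γ⁻¹ (logDeriv φ q w) := by
  have h1 : MDifferentiableAt 𝓘(ℂ, W) 𝓘(ℂ, E) (fun q' => (φ q)⁻¹ * φ q') q :=
    ((GHolAt.const (E := E) (φ q)⁻¹ q).mul hφ).mdifferentiableAt
  have e : (fun q' => (φ q * γ)⁻¹ * (φ q' * γ)) =
      (fun h => γ⁻¹ * h * γ⁻¹⁻¹) ∘ (fun q' => (φ q)⁻¹ * φ q') := by
    funext q'
    simp only [Function.comp_apply]
    group
  have h3 : mfderiv 𝓘(ℂ, W) 𝓘(ℂ, E)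
      ((fun h : G => γ⁻¹ * h * γ⁻¹⁻¹) ∘ (fun q' => (φ q)⁻¹ * φ q')) q = _ :=
    mfderiv_comp q (mdifferentiableAt_conj γ⁻¹ _) h1
  rw [← e] at h3
  have h4 := congrArg (fun f : W →L[ℂ] E => f w) h3
  exact h4.trans (AdLin_eq γ⁻¹ _ (inv_mul_cancel _) _)

theorem mfderiv_eq_mulInvariantVectorField {φ : W → G} {q : W} (hφ : GHolAt E φ q) (w : W) :
    (mfderiv 𝓘(ℂ, W) 𝓘(ℂ, E) φ q : W → E) w =
      (mulInvariantVectorField (I := 𝓘(ℂ, E)) (logDeriv φ q w : LieAlg E G) (φ q) : E) := by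
  have h1 : MDifferentiableAt 𝓘(ℂ, W) 𝓘(ℂ, E) (fun q' => (φ q)⁻¹ * φ q') q :=
    ((GHolAt.const (E := E) (φ q)⁻¹ q).mul hφ).mdifferentiableAt
  have e : φ = (fun h => φ q * h) ∘ (fun q' => (φ q)⁻¹ * φ q') := by
    funext q'
    simp
  have hl : ∀ b : G, MDifferentiableAt 𝓘(ℂ, E) 𝓘(ℂ, E) (fun x : G => φ q * x) b := fun b =>
    (contMDiff_mul_left (I := 𝓘(ℂ, E)) (n := ω)).contMDiffAt.mdifferentiableAt (by simp)
  have h3 : mfderiv 𝓘(ℂ, W) 𝓘(ℂ, E)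
      ((fun h : G => φ q * h) ∘ (fun q' => (φ q)⁻¹ * φ q')) q = _ :=
    mfderiv_comp q (hl _) h1
  rw [← e] at h3
  have hk : ∀ k : G, k = 1 → ∀ u : E, (mfderiv 𝓘(ℂ, E) 𝓘(ℂ, E)
      (fun x : G => φ q * x) k : E → E) u =
      (mulInvariantVectorField (I := 𝓘(ℂ, E)) (G := G) u (φ q) : E) := by
    rintro k rfl u
    rfl
  exact (congrArg (fun f : W →L[ℂ] E => f w) h3).trans (hk _ (inv_mul_cancel _) _)

/-- The derivative of a family of `G`-valued functions at points that it maps to `1` is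
holomorphic in the parameter. -/
theorem analyticAt_mfderiv_family {M : Type*} [TopologicalSpace M] {F : Type*}
    [NormedAddCommGroup F] [NormedSpace ℂ F] [ChartedSpace F M] [IsManifold 𝓘(ℂ, F) ω M]
    (f : W → M → G) (c : W → M) {q : W}
    (hf : ContMDiffAt (𝓘(ℂ, W).prod 𝓘(ℂ, F)) 𝓘(ℂ, E) ω (Function.uncurry f) (q, c q))
    (hc : ContMDiffAt 𝓘(ℂ, W) 𝓘(ℂ, F) ω c q)
    (h1 : ∀ q, f q (c q) = 1)
    (hco : ∀ q', (tangentBundleCore 𝓘(ℂ, F) M).coordChange (achart F (c q)) (achart F (c q'))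
      (c q') = ContinuousLinearMap.id ℂ F) (v : F) :
    AnalyticAt ℂ (fun q => (mfderiv 𝓘(ℂ, F) 𝓘(ℂ, E) (f q) (c q) : F → E) v) q := by
  have h := ContMDiffAt.mfderiv (m := ω) f c hf hc le_rfl
  have h2 := (contMDiffAt_iff_contDiffAt.mp h).analyticAt
  have h3 : AnalyticAt ℂ (E := W) (F := F →L[ℂ] E)
      (fun q => (mfderiv 𝓘(ℂ, F) 𝓘(ℂ, E) (f q) (c q) : F →L[ℂ] E)) q := by
    refine h2.congr ?_
    have hcs : ∀ᶠ q' in 𝓝 q, c q' ∈ (chartAt F (c q)).source :=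
      hc.continuousAt.eventually_mem ((chartAt F (c q)).open_source.mem_nhds (mem_chart_source _ _))
    filter_upwards [hcs] with q' hq'
    -- Holomorphy is known for the derivative in trivialised tangent coordinates. On the target side
    -- all base points equal `1`, so the coordinate change is the identity and the trivialised
    -- derivative is the derivative itself.
    have e : ∀ k k' : G, k = 1 → k' = 1 →
        (tangentBundleCore 𝓘(ℂ, E) G).coordChange (achart E k) (achart E k') k =
        ContinuousLinearMap.id ℂ E := by
      rintro k k' rfl rfl
      ext u
      exact (tangentBundleCore 𝓘(ℂ, E) G).coordChange_self (achart E 1) 1 (mem_achart_source E 1) u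
    have hy : f q' (c q') ∈ (chartAt E (f q (c q))).source := by
      rw [h1, h1]; exact mem_chart_source _ _
    refine (inTangentCoordinates_eq (I := 𝓘(ℂ, F)) (I' := 𝓘(ℂ, E)) c (fun x => f x (c x))
      (fun x => (mfderiv 𝓘(ℂ, F) 𝓘(ℂ, E) (f x) (c x) : F →L[ℂ] E)) hq' hy).trans ?_
    refine (congrArg₂ (fun (A : E →L[ℂ] E) (B : F →L[ℂ] F) =>
      A ∘L (mfderiv 𝓘(ℂ, F) 𝓘(ℂ, E) (f q') (c q') : F →L[ℂ] E) ∘L B)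
      (e _ _ (h1 q') (h1 q)) (hco q')).trans ?_
    ext u
    rfl
  exact (ContinuousLinearMap.apply ℂ E v).analyticAt _ |>.comp h3

theorem analyticAt_logDeriv {φ : W → G} {q : W} (hφ : GHolAt E φ q) (w : W) :
    AnalyticAt ℂ (E := W) (F := E) (fun q => logDeriv φ q w) q := by
  refine analyticAt_mfderiv_family (E := E) (fun q q' => (φ q)⁻¹ * φ q') id ?_ contMDiffAt_id
    (fun q => inv_mul_cancel _) ?_ w
  · have h1 : ContMDiffAt (𝓘(ℂ, W).prod 𝓘(ℂ, W)) 𝓘(ℂ, E) ω (fun p : W × W => φ p.1) (q, q) :=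
      ContMDiffAt.comp (q, q) (g := φ) hφ contMDiffAt_fst
    have h2 : ContMDiffAt (𝓘(ℂ, W).prod 𝓘(ℂ, W)) 𝓘(ℂ, E) ω (fun p : W × W => φ p.2) (q, q) :=
      ContMDiffAt.comp (q, q) (g := φ) hφ contMDiffAt_snd
    exact h1.inv.mul h2
  · intro q'
    exact tangentBundleCore_coordChange_model_space _ _ _

theorem analyticAt_AdLin {φ : W → G} {q : W} (hφ : GHolAt E φ q) (v : LieAlg E G) :
    AnalyticAt ℂ (E := W) (F := E) (fun q => AdLin E (φ q) v) q := by
  refine analyticAt_mfderiv_family (E := E) (F := E) (fun q h => φ q * h * (φ q)⁻¹) (fun _ => 1) ?_ contMDiffAt_const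
    (fun q => by simp) ?_ (v : E)
  · have h1 : ContMDiffAt (𝓘(ℂ, W).prod 𝓘(ℂ, E)) 𝓘(ℂ, E) ω (fun p : W × G => φ p.1) (q, 1) :=
      ContMDiffAt.comp (q, (1 : G)) (g := φ) hφ contMDiffAt_fst
    exact (h1.mul contMDiffAt_snd).mul h1.inv
  · intro q'
    ext u
    exact (tangentBundleCore 𝓘(ℂ, E) G).coordChange_self (achart E 1) 1 (mem_achart_source E 1) u

end LogDeriv

end VertexIRF

namespace VertexIRF

/-! ### The Maurer-Cartan equation. -/

section MaurerCartan

variable {E : Type*} [NormedAddCommGroup E] [NormedSpace ℂ E] [CompleteSpace E]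
  {G : Type*} [TopologicalSpace G] [ChartedSpace E G] [Group G] [LieGroup 𝓘(ℂ, E) ω G]
  {W : Type*} [NormedAddCommGroup W] [NormedSpace ℂ W]

set_option linter.unusedSectionVars false

/-- On a finite-dimensional space an operator is the sum of its values on a basis times the
coordinate functionals. The point is to pass from single left-invariant vector fields to the
operator-valued map `chartField`. -/
theorem differentiableAt_of_apply {F F' : Type*} [NormedAddCommGroup F] [NormedSpace ℂ F]
    [NormedAddCommGroup F'] [NormedSpace ℂ F'] [FiniteDimensional ℂ F] {L : W → F →L[ℂ] F'} {x : W}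
    (h : ∀ u, DifferentiableAt ℂ (fun y => L y u) x) : DifferentiableAt ℂ L x := by
  let B := Module.finBasis ℂ F
  have e : L = fun y => ∑ i, (LinearMap.toContinuousLinearMap (B.coord i)).smulRight (L y (B i)) := by
    funext y
    ext u
    simp only [_root_.sum_apply, ContinuousLinearMap.smulRight_apply,
      LinearMap.coe_toContinuousLinearMap', Module.Basis.coord_apply]
    conv_lhs => rw [← B.sum_repr u, map_sum]
    simp
  rw [e]
  refine DifferentiableAt.fun_sum fun i _ => ?_
  exact ((ContinuousLinearMap.smulRightL ℂ F F'
    (LinearMap.toContinuousLinearMap (B.coord i))).differentiableAt.comp x (h (B i)) :)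

variable (E G) in
/-- The Lie bracket of `𝔤`, on the underlying vector space. -/
def lieBr (u v : LieAlg E G) : E := (⁅u, v⁆ : LieAlg E G)

/-- The left logarithmic derivative, as a vector of the model space. -/
def logVec (φ : W → G) (q w : W) : E := logDeriv (E := E) φ q w

variable (E G) in
/-- The left-invariant vector fields in the chart at the identity. -/
def chartField (x : E) : E →L[ℂ] E :=
  (mfderivWithin 𝓘(ℂ, E) 𝓘(ℂ, E) (extChartAt 𝓘(ℂ, E) (1 : G)).symm (Set.range 𝓘(ℂ, E)) x :
    E →L[ℂ] E).inverse.comp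
    (mfderiv 𝓘(ℂ, E) 𝓘(ℂ, E) (fun h : G => (extChartAt 𝓘(ℂ, E) (1 : G)).symm x * h) 1 : E →L[ℂ] E)

theorem chartField_apply (u x : E) : chartField E G x u =
    VectorField.mpullbackWithin 𝓘(ℂ, E) 𝓘(ℂ, E) (extChartAt 𝓘(ℂ, E) (1 : G)).symm
      (mulInvariantVectorField (I := 𝓘(ℂ, E)) (G := G) u) (Set.range 𝓘(ℂ, E)) x := rfl

theorem chartField_extChartAt {g : G} (hg : g ∈ (extChartAt 𝓘(ℂ, E) (1 : G)).source) (u : E) :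
    chartField E G (extChartAt 𝓘(ℂ, E) (1 : G) g) u =
      (mfderiv 𝓘(ℂ, E) 𝓘(ℂ, E) (extChartAt 𝓘(ℂ, E) (1 : G)) g : E → E)
        (mulInvariantVectorField (I := 𝓘(ℂ, E)) (G := G) u g : E) := by
  have h1 := mfderiv_extChartAt_comp_mfderivWithin_extChartAt_symm' (I := 𝓘(ℂ, E)) hg
  have h2 := mfderivWithin_extChartAt_symm_comp_mfderiv_extChartAt' (I := 𝓘(ℂ, E)) hg
  have h3 : (mfderivWithin 𝓘(ℂ, E) 𝓘(ℂ, E) (extChartAt 𝓘(ℂ, E) (1 : G)).symm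
      (Set.range 𝓘(ℂ, E)) (extChartAt 𝓘(ℂ, E) (1 : G) g) : E →L[ℂ] E).inverse =
      (mfderiv 𝓘(ℂ, E) 𝓘(ℂ, E) (extChartAt 𝓘(ℂ, E) (1 : G)) g : E →L[ℂ] E) :=
    ContinuousLinearMap.inverse_eq h2 h1
  have h4 : ∀ k : G, k = g → (mfderiv 𝓘(ℂ, E) 𝓘(ℂ, E) (fun h : G => k * h) 1 : E → E) u =
      (mulInvariantVectorField (I := 𝓘(ℂ, E)) (G := G) u g : E) := by
    rintro k rfl
    rfl
  have h5 := h4 _ ((extChartAt 𝓘(ℂ, E) (1 : G)).left_inv hg)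
  unfold chartField
  rw [h3]
  exact congrArg _ h5

theorem chartField_one (u : E) :
    chartField E G (extChartAt 𝓘(ℂ, E) (1 : G) 1) u =
      (mfderiv 𝓘(ℂ, E) 𝓘(ℂ, E) (extChartAt 𝓘(ℂ, E) (1 : G)) 1 : E → E) u := by
  rw [chartField_extChartAt (mem_extChartAt_source _)]
  have h1 : (fun h : G => 1 * h) = id := by ext; simp
  have h2 : mfderiv 𝓘(ℂ, E) 𝓘(ℂ, E) (fun h : G => 1 * h) 1 =
      ContinuousLinearMap.id ℂ E := by
    rw [h1]; exact mfderiv_id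
  exact congrArg _ (congrArg (fun f : E →L[ℂ] E => f u) h2)

theorem differentiableAt_chartField [FiniteDimensional ℂ E] :
    DifferentiableAt ℂ (chartField E G) (extChartAt 𝓘(ℂ, E) (1 : G) 1) := by
  apply differentiableAt_of_apply
  intro u
  have h := MDifferentiableWithinAt.differentiableWithinAt_mpullbackWithin_vectorField
    (s := Set.univ) (mdifferentiableAt_mulInvariantVectorField (I := 𝓘(ℂ, E)) (G := G) (g := 1)
      u).mdifferentiableWithinAt
  simp only [Set.preimage_univ, Set.univ_inter, modelWithCornersSelf_coe, Set.range_id] at h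
  simp only [chartField_apply, modelWithCornersSelf_coe, Set.range_id]
  exact differentiableWithinAt_univ.mp h

theorem mfderiv_extChartAt_lie (u v : E) :
    (mfderiv 𝓘(ℂ, E) 𝓘(ℂ, E) (extChartAt 𝓘(ℂ, E) (1 : G)) 1 : E → E) (lieBr E G u v) =
      VectorField.lieBracket ℂ (fun x => chartField E G x u) (fun x => chartField E G x v)
        (extChartAt 𝓘(ℂ, E) (1 : G) 1) := by
  have h : lieBr E G u v = _ := GroupLieAlgebra.bracket_def (I := 𝓘(ℂ, E)) (G := G) u v
  rw [← VectorField.mlieBracketWithin_univ, VectorField.mlieBracketWithin_apply] at h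
  simp only [Set.preimage_univ, Set.univ_inter, modelWithCornersSelf_coe, Set.range_id] at h
  simp only [chartField_apply, modelWithCornersSelf_coe, Set.range_id]
  rw [h]
  obtain ⟨M, hM⟩ := isInvertible_mfderiv_extChartAt (I := 𝓘(ℂ, E))
    (mem_extChartAt_source (I := 𝓘(ℂ, E)) (1 : G))
  rw [← hM, ContinuousLinearMap.inverse_equiv]
  exact (M.apply_symm_apply _).trans 
    (congrFun (VectorField.lieBracketWithin_univ (E := E)) _)

theorem fderiv_extChartAt_comp {φ : W → G} {q : W} (hφ : GHolAt E φ q)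
    (hq : φ q ∈ (extChartAt 𝓘(ℂ, E) (1 : G)).source) (u : W) :
    fderiv ℂ (fun q => extChartAt 𝓘(ℂ, E) (1 : G) (φ q)) q u =
      chartField E G (extChartAt 𝓘(ℂ, E) (1 : G) (φ q)) (logVec φ q u) := by
  have hκ : MDifferentiableAt 𝓘(ℂ, E) 𝓘(ℂ, E) (extChartAt 𝓘(ℂ, E) (1 : G)) (φ q) :=
    mdifferentiableAt_extChartAt (by rwa [← extChartAt_source 𝓘(ℂ, E)])
  have h3 : mfderiv 𝓘(ℂ, W) 𝓘(ℂ, E) ((extChartAt 𝓘(ℂ, E) (1 : G)) ∘ φ) q = _ :=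
    mfderiv_comp q hκ hφ.mdifferentiableAt
  rw [mfderiv_eq_fderiv] at h3
  refine (congrArg (fun f : W →L[ℂ] E => f u) h3).trans ?_
  refine Eq.trans ?_ (chartField_extChartAt hq _).symm
  exact congrArg (mfderiv 𝓘(ℂ, E) 𝓘(ℂ, E) (extChartAt 𝓘(ℂ, E) (1 : G)) (φ q) : E → E)
    (mfderiv_eq_mulInvariantVectorField (E := E) hφ u)

theorem differentiableAt_logVec {φ : W → G} {q : W} (hφ : GHolAt E φ q) (w : W) :
    DifferentiableAt ℂ (fun q => logVec (E := E) φ q w) q :=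
  (analyticAt_logDeriv hφ w).differentiableAt

/-- The Maurer-Cartan equation for the left logarithmic derivative. -/
theorem maurerCartan [FiniteDimensional ℂ E] {φ : W → G} {q : W} (hφ : GHolAt E φ q) (v w : W) :
    fderiv ℂ (fun q => logVec (E := E) φ q w) q v -
      fderiv ℂ (fun q => logVec (E := E) φ q v) q w +
      lieBr E G (logVec (E := E) φ q v) (logVec (E := E) φ q w) = 0 := by
  -- Left translation by `(φ q)⁻¹` does not change the logarithmic derivative, so the chart at the
  -- identity suffices.
  wlog h1 : φ q = 1 generalizing φ
  · have h := this ((GHolAt.const (E := E) (φ q)⁻¹ q).mul hφ) (inv_mul_cancel _)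
    have e : logVec (E := E) (fun q' => (φ q)⁻¹ * φ q') = logVec φ := logDeriv_const_mul _ φ
    rwa [e] at h
  have hsrc : ∀ᶠ q' in 𝓝 q, φ q' ∈ (extChartAt 𝓘(ℂ, E) (1 : G)).source := by
    apply hφ.continuousAt.eventually_mem
    rw [h1]
    exact extChartAt_source_mem_nhds _
  obtain ⟨F, hF⟩ : ∃ F : W → E, F = fun q' => extChartAt 𝓘(ℂ, E) (1 : G) (φ q') := ⟨_, rfl⟩
  have hFq : F q = extChartAt 𝓘(ℂ, E) (1 : G) 1 := by rw [hF]; simp only [h1]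
  have hFan : ContDiffAt ℂ ω F q := by
    have h2 : ContMDiffAt 𝓘(ℂ, E) 𝓘(ℂ, E) ω (extChartAt 𝓘(ℂ, E) (1 : G)) (φ q) := by
      rw [h1]
      exact contMDiffAt_extChartAt
    rw [hF]
    exact (h2.comp q hφ).contDiffAt
  -- In the chart, the derivative of `φ` along `u` is the left-invariant field generated by the
  -- logarithmic derivative along `u`.
  have hD : ∀ᶠ q' in 𝓝 q, ∀ u, fderiv ℂ F q' u = chartField E G (F q') (logVec φ q' u) := by
    filter_upwards [hsrc, hφ.eventually] with q' hq' hφ' u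
    rw [hF]
    exact fderiv_extChartAt_comp hφ' hq' u
  have h4 : DifferentiableAt ℂ (chartField E G) (F q) := by
    rw [hFq]; exact differentiableAt_chartField
  have hdF1 : DifferentiableAt ℂ F q := hFan.differentiableAt (by simp)
  have hL : DifferentiableAt ℂ (fun q' => chartField E G (F q')) q := h4.comp q hdF1
  have hdF : DifferentiableAt ℂ (fderiv ℂ F) q := by
    have h5 : ContDiffAt ℂ 1 (fderiv ℂ F) q := hFan.fderiv_right (by simp)
    exact h5.differentiableAt (by simp)
  have hc : ∀ u u' : E, fderiv ℂ (fun x => chartField E G x u) (F q) u' =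
      fderiv ℂ (chartField E G) (F q) u' u := by
    intro u u'
    rw [fderiv_clm_apply h4 (differentiableAt_const u)]
    simp
  -- Differentiating once more gives the derivative of the logarithmic derivative plus a derivative
  -- of the field along another left-invariant field. The left side is symmetric in `v` and `w`;
  -- antisymmetrising, the last terms form the Lie bracket of left-invariant fields, that is, the
  -- bracket of `𝔤`.
  have hD2 : ∀ v w, fderiv ℂ (fderiv ℂ F) q v w =
      chartField E G (F q) (fderiv ℂ (fun q => logVec (E := E) φ q w) q v) +
      fderiv ℂ (chartField E G) (F q) (chartField E G (F q) (logVec φ q v)) (logVec φ q w) := by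
    intro v w
    have h6 : fderiv ℂ (fderiv ℂ F) q v w = fderiv ℂ (fun q' => fderiv ℂ F q' w) q v := by
      rw [fderiv_clm_apply hdF (differentiableAt_const w)]
      simp
    have h7 : (fun q' => fderiv ℂ F q' w) =ᶠ[𝓝 q]
        fun q' => chartField E G (F q') (logVec φ q' w) := by
      filter_upwards [hD] with q' h
      exact h w
    rw [h6, h7.fderiv_eq, fderiv_clm_apply hL (differentiableAt_logVec hφ w)]
    have h8 : fderiv ℂ (fun q' => chartField E G (F q')) q v =
        fderiv ℂ (chartField E G) (F q) (chartField E G (F q) (logVec φ q v)) := by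
      have h9 := fderiv_comp q h4 hdF1
      rw [← hD.self_of_nhds v]
      exact congrArg (fun f => f v) h9
    rw [← h8]
    simp
  have hsym : fderiv ℂ (fderiv ℂ F) q v w = fderiv ℂ (fderiv ℂ F) q w v :=
    (hFan.isSymmSndFDerivAt (by simp)).eq v w
  rw [hD2, hD2] at hsym
  have hbr := mfderiv_extChartAt_lie (E := E) (G := G) (logVec φ q v) (logVec φ q w)
  have hM := chartField_one (E := E) (G := G)
  rw [← hM, VectorField.lieBracket_eq, ← hFq] at hbr
  simp only [hc] at hbr
  obtain ⟨M, hMe⟩ := isInvertible_mfderiv_extChartAt (I := 𝓘(ℂ, E))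
    (mem_extChartAt_source (I := 𝓘(ℂ, E)) (1 : G))
  have hM' : ∀ u : E, M u = chartField E G (F q) u := by
    intro u
    rw [hFq, hM]
    exact congrArg (fun f : E →L[ℂ] E => f u) hMe
  apply M.injective
  refine (hM' _).trans (Eq.trans ?_ (map_zero M).symm)
  rw [map_add, map_sub, hbr]
  rw [← sub_eq_zero] at hsym
  refine Eq.trans ?_ hsym
  abel

end MaurerCartan

end VertexIRF

namespace VertexIRF

/-! ### The derivative of the adjoint action. -/

section AdDeriv

variable {E : Type*} [NormedAddCommGroup E] [NormedSpace ℂ E] [CompleteSpace E]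
  {G : Type*} [TopologicalSpace G] [ChartedSpace E G] [Group G] [LieGroup 𝓘(ℂ, E) ω G]
  {W : Type*} [NormedAddCommGroup W] [NormedSpace ℂ W]

set_option linter.unusedSectionVars false

theorem chartField_one_injective :
    Function.Injective (chartField E G (extChartAt 𝓘(ℂ, E) (1 : G) 1)) := by
  obtain ⟨M, hMe⟩ := isInvertible_mfderiv_extChartAt (I := 𝓘(ℂ, E))
    (mem_extChartAt_source (I := 𝓘(ℂ, E)) (1 : G))
  have hM' : ∀ u : E, M u = chartField E G (extChartAt 𝓘(ℂ, E) (1 : G) 1) u := by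
    intro u
    rw [chartField_one]
    exact congrArg (fun f : E →L[ℂ] E => f u) hMe
  intro u v h
  rw [← hM', ← hM'] at h
  exact M.injective h

/-- Every element of the Lie algebra is the velocity of a holomorphic curve through `1`. -/
theorem exists_curve (y : E) :
    ∃ c : ℂ → G, GHolAt E c 0 ∧ c 0 = 1 ∧ logVec (E := E) c 0 1 = y := by
  set k := extChartAt 𝓘(ℂ, E) (1 : G) with hk
  -- The curve is a straight line in the chart at the identity, in the direction of the image of `y`
  -- under the differential of the chart.
  set y' := chartField E G (k 1) y with hy'
  have h0 : k 1 + (0 : ℂ) • y' = k 1 := by simp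
  have hι : ContDiffAt ℂ ω (fun t : ℂ => k 1 + t • y') 0 := by fun_prop
  have hsymm : ContMDiffAt 𝓘(ℂ, E) 𝓘(ℂ, E) ω k.symm (k 1) :=
    (contMDiffOn_extChartAt_symm (I := 𝓘(ℂ, E)) (1 : G)).contMDiffAt
      (extChartAt_target_mem_nhds (I := 𝓘(ℂ, E)) (1 : G))
  have hc : GHolAt E (fun t : ℂ => k.symm (k 1 + t • y')) 0 := by
    refine ContMDiffAt.comp (0 : ℂ) (g := k.symm) ?_ hι.contMDiffAt
    rw [h0]
    exact hsymm
  have hc0 : k.symm (k 1 + (0 : ℂ) • y') = 1 := by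
    rw [h0]
    exact extChartAt_to_inv _
  refine ⟨_, hc, hc0, ?_⟩
  have h1 := fderiv_extChartAt_comp hc (by
    simp only [hc0]; exact mem_extChartAt_source _) 1
  simp only [hc0] at h1
  apply chartField_one_injective (G := G)
  rw [← h1]
  have h2 : ∀ᶠ t : ℂ in 𝓝 0, k (k.symm (k 1 + t • y')) = k 1 + t • y' := by
    have h3 : ∀ᶠ t : ℂ in 𝓝 0, k 1 + t • y' ∈ k.target := by
      apply hι.continuousAt.eventually_mem
      rw [h0]
      exact extChartAt_target_mem_nhds _
    filter_upwards [h3] with t ht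
    exact k.right_inv ht
  have h2' : (fun t : ℂ => k (k.symm (k 1 + t • y'))) =ᶠ[𝓝 0] fun t => k 1 + t • y' := h2
  rw [h2'.fderiv_eq]
  have h5 : HasFDerivAt (fun t : ℂ => k 1 + t • y')
      ((ContinuousLinearMap.id ℂ ℂ).smulRight y') 0 :=
    ((ContinuousLinearMap.id ℂ ℂ).smulRight y').hasFDerivAt.const_add (k 1)
  rw [h5.fderiv, ContinuousLinearMap.smulRight_apply, ContinuousLinearMap.id_apply, one_smul]

/-- The vector `Ad_γ y`, in the model space. -/
def adVec (E : Type*) [NormedAddCommGroup E] [NormedSpace ℂ E] [CompleteSpace E]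
    {G : Type*} [TopologicalSpace G] [ChartedSpace E G] [Group G] [LieGroup 𝓘(ℂ, E) ω G]
    (γ : G) (y : E) : E := AdLin E γ y

/-- Apply the Maurer-Cartan equation to `(t, q) ↦ c(t) φ(q)`, where `c` is a curve through `1` with
velocity `y`. The logarithmic derivative in a direction of `q` does not depend on `t`, and the one
in the direction of `t` at `t = 0` is `Ad_{φ⁻¹} y`. Only one of the two derivative terms survives.
-/
theorem fderiv_Ad_inv [FiniteDimensional ℂ E] {φ : W → G} {q : W} (hφ : GHolAt E φ q) (y : E)
    (w : W) : fderiv ℂ (fun q => adVec E (φ q)⁻¹ y) q w =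
      - lieBr E G (logVec (E := E) φ q w) (adVec E (φ q)⁻¹ y) := by
  obtain ⟨c, hc, hc0, hcy⟩ := exists_curve (E := E) (G := G) y
  have hΦ : GHolAt E (fun p : ℂ × W => c p.1 * φ p.2) (0, q) :=
    GHolAt.mul (GHolAt.comp (ι := Prod.fst) hc contDiffAt_fst)
      (GHolAt.comp (ι := Prod.snd) hφ contDiffAt_snd)
  have hMC := maurerCartan hΦ (0, w) (1, 0)
  have hW : ∀ p : ℂ × W, GHolAt E (fun p : ℂ × W => c p.1 * φ p.2) p →
      logVec (E := E) (fun p : ℂ × W => c p.1 * φ p.2) p (0, w) = logVec φ p.2 w := by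
    rintro ⟨t, q'⟩ hp
    have h := logDeriv_comp (E := E) (ι := fun q' : W => (t, q'))
      (L := ContinuousLinearMap.inr ℂ ℂ W) hp (hasFDerivAt_prodMk_right t q') w
    have h' := congrFun (congrFun (logDeriv_const_mul (E := E) (c t) φ) q') w
    exact h.symm.trans h'
  have hT : ∀ q', GHolAt E φ q' → logVec (E := E) (fun p : ℂ × W => c p.1 * φ p.2) (0, q') (1, 0) =
      adVec E (φ q')⁻¹ y := by
    intro q' hφ'
    have hp : GHolAt E (fun p : ℂ × W => c p.1 * φ p.2) (0, q') :=
      GHolAt.mul (GHolAt.comp (ι := Prod.fst) hc contDiffAt_fst)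
        (GHolAt.comp (ι := Prod.snd) hφ' contDiffAt_snd)
    have h := logDeriv_comp (E := E) (ι := fun t : ℂ => (t, q'))
      (L := ContinuousLinearMap.inl ℂ ℂ W) hp (hasFDerivAt_prodMk_left 0 q') 1
    have h' := logDeriv_mul_const (E := E) hc (φ q') 1
    rw [← hcy]
    exact h.symm.trans h'
  have e1 : fderiv ℂ (fun p : ℂ × W => logVec (E := E) (fun p : ℂ × W => c p.1 * φ p.2) p (0, w))
      (0, q) (1, 0) = 0 := by
    have h1 : (fun p : ℂ × W => logVec (E := E) (fun p : ℂ × W => c p.1 * φ p.2) p (0, w)) =ᶠ[𝓝 (0, q)]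
        fun p => logVec φ p.2 w := by
      filter_upwards [hΦ.eventually] with p hp
      exact hW p hp
    rw [h1.fderiv_eq]
    have h2 := fderiv_comp (0, q) (g := fun q => logVec (E := E) φ q w) (f := @Prod.snd ℂ W)
      (differentiableAt_logVec hφ w) differentiableAt_snd
    refine (congrArg (fun f : ℂ × W →L[ℂ] E => f (1, 0)) h2).trans ?_
    simp [fderiv_snd]
  have e2 : fderiv ℂ (fun p : ℂ × W => logVec (E := E) (fun p : ℂ × W => c p.1 * φ p.2) p (1, 0))
      (0, q) (0, w) = fderiv ℂ (fun q => adVec E (φ q)⁻¹ y) q w := by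
    have h1 : (fun q => adVec E (φ q)⁻¹ y) =ᶠ[𝓝 q] fun q' =>
        logVec (E := E) (fun p : ℂ × W => c p.1 * φ p.2) (0, q') (1, 0) := by
      filter_upwards [hφ.eventually] with p hp
      exact (hT p hp).symm
    rw [h1.fderiv_eq]
    have h2 := (differentiableAt_logVec hΦ (1, 0)).hasFDerivAt.comp q
      (hasFDerivAt_prodMk_right (0 : ℂ) q)
    refine Eq.trans ?_ (congrArg (fun f : W →L[ℂ] E => f w) h2.fderiv).symm
    simp
  rw [e1, e2, sub_zero, hW _ hΦ, hT q hφ] at hMC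
  exact eq_neg_of_add_eq_zero_left hMC

end AdDeriv

end VertexIRF

namespace VertexIRF

set_option linter.unusedSectionVars false

/-! ### The algebra of holomorphic functions on an open set. -/

section HolRing

open TopologicalSpace

variable {P P' : Type*} [NormedAddCommGroup P] [NormedSpace ℂ P]
  [NormedAddCommGroup P'] [NormedSpace ℂ P']

open Classical in
/-- The extension by zero of a function on an open set. -/
def ext0 {U : Opens P} (f : U → ℂ) (p : P) : ℂ := if h : p ∈ U then f ⟨p, h⟩ else 0

theorem ext0_of_mem {U : Opens P} (f : U → ℂ) {p : P} (h : p ∈ U) : ext0 f p = f ⟨p, h⟩ :=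
  dif_pos h

theorem ext0_add {U : Opens P} (f g : U → ℂ) : ext0 (f + g) = ext0 f + ext0 g := by
  funext p
  by_cases h : p ∈ U <;> simp [ext0, h]

theorem ext0_mul {U : Opens P} (f g : U → ℂ) : ext0 (f * g) = ext0 f * ext0 g := by
  funext p
  by_cases h : p ∈ U <;> simp [ext0, h]

theorem ext0_smul {U : Opens P} (a : ℂ) (f : U → ℂ) : ext0 (a • f) = a • ext0 f := by
  funext p
  by_cases h : p ∈ U <;> simp [ext0, h]

theorem ext0_restrict {U : Opens P} (F : P → ℂ) {p : P} (h : p ∈ U) :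
    ext0 (fun q : U => F q) =ᶠ[𝓝 p] F := by
  filter_upwards [U.isOpen.mem_nhds h] with q hq
  exact ext0_of_mem _ hq

/-- The algebra of holomorphic functions on an open set. -/
def holSubalgebra (U : Opens P) : Subalgebra ℂ (U → ℂ) where
  carrier := {f | ∀ p ∈ U, AnalyticAt ℂ (ext0 f) p}
  mul_mem' hf hg p hp := by rw [ext0_mul]; exact (hf p hp).mul (hg p hp)
  add_mem' hf hg p hp := by rw [ext0_add]; exact (hf p hp).add (hg p hp)
  algebraMap_mem' c p hp :=
    (analyticAt_const (v := c)).congr (ext0_restrict (fun _ => c) hp).symm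

/-- The algebra of holomorphic functions on an open set, as a type. -/
def Hol (U : Opens P) : Type _ := holSubalgebra U

instance (U : Opens P) : CommRing (Hol U) := inferInstanceAs (CommRing (holSubalgebra U))

instance (U : Opens P) : Algebra ℂ (Hol U) := inferInstanceAs (Algebra ℂ (holSubalgebra U))

/-- The restriction of a holomorphic function to an open set. -/
def toHol (U : Opens P) (F : P → ℂ) (hF : ∀ p ∈ U, AnalyticAt ℂ F p) : Hol U :=
  ⟨fun q => F q, fun p hp => (hF p hp).congr (ext0_restrict F hp).symm⟩

theorem hol_analyticAt {U : Opens P} (f : Hol U) {p : P} (hp : p ∈ U) :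
    AnalyticAt ℂ (ext0 f.1) p := f.2 p hp

theorem analyticAt_fderiv_apply {F : P → ℂ} {p : P} (h : AnalyticAt ℂ F p) (w : P) :
    AnalyticAt ℂ (fun q => fderiv ℂ F q w) p :=
  ((ContinuousLinearMap.apply ℂ ℂ w).analyticAt _).comp h.fderiv

/-- The directional derivative on the algebra of holomorphic functions. -/
def holDer (U : Opens P) (w : P) : Derivation ℂ (Hol U) (Hol U) :=
  Derivation.mk'
    { toFun := fun f => toHol U (fun q => fderiv ℂ (ext0 f.1) q w)
        fun p hp => analyticAt_fderiv_apply (hol_analyticAt f hp) w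
      map_add' := fun f g => by
        apply Subtype.ext
        funext q
        change fderiv ℂ (ext0 (f.1 + g.1)) q w = _
        rw [ext0_add, fderiv_add (hol_analyticAt f q.2).differentiableAt
          (hol_analyticAt g q.2).differentiableAt]
        rfl
      map_smul' := fun a f => by
        apply Subtype.ext
        funext q
        change fderiv ℂ (ext0 (a • f.1)) q w = _
        rw [ext0_smul, fderiv_const_smul (hol_analyticAt f q.2).differentiableAt]
        rfl }
    (fun f g => by
      apply Subtype.ext
      funext q
      change fderiv ℂ (ext0 (f.1 * g.1)) q w = _
      rw [ext0_mul, fderiv_mul (hol_analyticAt f q.2).differentiableAt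
        (hol_analyticAt g q.2).differentiableAt, ext0_of_mem f.1 q.2, ext0_of_mem g.1 q.2]
      rfl)

theorem holDer_apply (U : Opens P) (w : P) (f : Hol U) (q : U) :
    (holDer U w f).1 q = fderiv ℂ (ext0 f.1) q w := rfl

/-- The action of the directions on the algebra of holomorphic functions. -/
def holDir (U : Opens P) : DirDer P (Hol U) where
  der :=
    { toFun := holDer U
      map_add' := fun v w => by
        ext f
        apply Subtype.ext
        funext q
        exact map_add (fderiv ℂ (ext0 f.1) q) v w
      map_smul' := fun a w => by
        ext f
        apply Subtype.ext
        funext q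
        exact map_smul (fderiv ℂ (ext0 f.1) q) a w }
  comm v w f := by
    apply Subtype.ext
    funext q
    have h : ∀ v w : P, (holDer U v (holDer U w f)).1 q = fderiv ℂ (fderiv ℂ (ext0 f.1)) q v w := by
      intro v w
      rw [holDer_apply]
      have h1 : ext0 (holDer U w f).1 =ᶠ[𝓝 (q : P)] fun p => fderiv ℂ (ext0 f.1) p w :=
        ext0_restrict (fun p => fderiv ℂ (ext0 f.1) p w) q.2
      have h2 : DifferentiableAt ℂ (fderiv ℂ (ext0 f.1)) q :=
        (hol_analyticAt f q.2).fderiv.differentiableAt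
      rw [h1.fderiv_eq, fderiv_clm_apply h2 (differentiableAt_const w)]
      simp
    have hs : fderiv ℂ (fderiv ℂ (ext0 f.1)) q v w = fderiv ℂ (fderiv ℂ (ext0 f.1)) q w v :=
      ((hol_analyticAt f q.2).contDiffAt.isSymmSndFDerivAt (n := ω) (by simp)).eq v w
    exact (h v w).trans (hs.trans (h w v).symm)

theorem holDir_apply (U : Opens P) (w : P) (f : Hol U) (q : U) :
    ((holDir U).der w f).1 q = fderiv ℂ (ext0 f.1) q w := rfl

/-- Evaluation of holomorphic functions at a point. -/
def evp {U : Opens P} {p : P} (hp : p ∈ U) : Hol U →ₐ[ℂ] ℂ :=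
  (Pi.evalAlgHom ℂ (fun _ : U => ℂ) ⟨p, hp⟩).comp (holSubalgebra U).val

theorem evp_toHol {U : Opens P} {p : P} (hp : p ∈ U) (F : P → ℂ) (hF) :
    evp hp (toHol U F hF) = F p := rfl

theorem evp_der {U : Opens P} {p : P} (hp : p ∈ U) (w : P) (f : Hol U) :
    evp hp ((holDir U).der w f) = fderiv ℂ (ext0 f.1) p w := rfl

theorem evp_der_toHol {U : Opens P} {p : P} (hp : p ∈ U) (w : P) (F : P → ℂ) (hF) :
    evp hp ((holDir U).der w (toHol U F hF)) = fderiv ℂ F p w := by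
  have h : ext0 (toHol U F hF).1 =ᶠ[𝓝 p] F := ext0_restrict F hp
  exact congrArg (fun L : P →L[ℂ] ℂ => L w) h.fderiv_eq

/-- Functions with values in an algebra that agree at all points are equal. -/
theorem ext_ev {C : Type*} [Ring C] [Algebra ℂ C] {U : Opens P} {t t' : Hol U ⊗[ℂ] C}
    (h : ∀ p (hp : p ∈ U), evT C (evp hp) t = evT C (evp hp) t') : t = t' := by
  rw [← sub_eq_zero]
  set u := t - t' with hu
  have h0 : ∀ p (hp : p ∈ U), evT C (evp hp) u = 0 := fun p hp => by
    rw [hu, map_sub, h p hp, sub_self]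
  -- With respect to a basis of `C` over `ℂ` the tensor has coordinates in the algebra of
  -- holomorphic functions, and these are determined by their values.
  let b := Module.Basis.ofVectorSpace ℂ C
  let B := Algebra.TensorProduct.basis (Hol U) b
  have key : ∀ (u : Hol U ⊗[ℂ] C) p (hp : p ∈ U) i,
      evp hp (B.repr u i) = b.repr (evT C (evp hp) u) i := by
    intro u p hp i
    induction u with
    | zero => simp
    | add x y hx hy => simp only [map_add, Finsupp.add_apply, hx, hy]
    | tmul f c =>
      rw [Algebra.TensorProduct.basis_repr_tmul]
      simp
  apply B.repr.injective
  ext i : 1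
  apply Subtype.ext
  funext q
  have := key u q q.2 i
  rw [h0, map_zero] at this
  rw [map_zero]
  exact this

/-- Pullback of holomorphic functions along an affine map `q ↦ p₀ + L q`. -/
def pull {U : Opens P} {U' : Opens P'} (p₀ : P) (L : P' →L[ℂ] P)
    (h : ∀ q ∈ U', p₀ + L q ∈ U) : Hol U →ₐ[ℂ] Hol U' where
  toFun f := ⟨fun q => f.1 ⟨p₀ + L q, h q q.2⟩, fun q hq => by
    have h1 : AnalyticAt ℂ (fun q => ext0 f.1 (p₀ + L q)) q :=
      (hol_analyticAt f (h q hq)).comp_of_eq (analyticAt_const.add (L.analyticAt q)) rfl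
    refine h1.congr ?_
    filter_upwards [U'.isOpen.mem_nhds hq] with q' hq'
    rw [ext0_of_mem _ hq', ext0_of_mem _ (h q' hq')]⟩
  map_one' := rfl
  map_mul' _ _ := rfl
  map_zero' := rfl
  map_add' _ _ := rfl
  commutes' _ := rfl

theorem evp_comp_pull {U : Opens P} {U' : Opens P'} (p₀ : P) (L : P' →L[ℂ] P)
    (h : ∀ q ∈ U', p₀ + L q ∈ U) {q : P'} (hq : q ∈ U') :
    (evp hq).comp (pull p₀ L h) = evp (h q hq) := rfl

theorem pull_der {U : Opens P} {U' : Opens P'} (p₀ : P) (L : P' →L[ℂ] P)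
    (h : ∀ q ∈ U', p₀ + L q ∈ U) (w : P') (f : Hol U) :
    pull p₀ L h ((holDir U).der (L w) f) = (holDir U').der w (pull p₀ L h f) := by
  apply Subtype.ext
  funext q
  have h1 : ext0 (pull p₀ L h f).1 =ᶠ[𝓝 (q : P')] fun q => ext0 f.1 (p₀ + L q) := by
    filter_upwards [U'.isOpen.mem_nhds q.2] with q' hq'
    rw [ext0_of_mem _ hq', ext0_of_mem _ (h q' hq')]
    rfl
  rw [holDir_apply, h1.fderiv_eq]
  have h2 := ((hol_analyticAt f (h q q.2)).differentiableAt.hasFDerivAt).comp (q : P')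
    ((L.hasFDerivAt).const_add p₀)
  exact (congrArg (fun g : P' →L[ℂ] ℂ => g w) h2.fderiv).symm

section VecHol

variable {E : Type*} [NormedAddCommGroup E] [NormedSpace ℂ E] [FiniteDimensional ℂ E]
  {C : Type*} [Ring C] [Algebra ℂ C]

theorem analyticAt_coord {F : P → E} {p : P} (hF : AnalyticAt ℂ F p) (l : E →ₗ[ℂ] ℂ) :
    AnalyticAt ℂ (fun q => l (F q)) p :=
  ((LinearMap.toContinuousLinearMap l).analyticAt _).comp hF

/-- The `C`-valued function `q ↦ m (F q)`, for a holomorphic function `F` with values in a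
finite-dimensional space and a linear map `m`. -/
def vecHol (U : Opens P) (m : E →ₗ[ℂ] C) (F : P → E) (hF : ∀ p ∈ U, AnalyticAt ℂ F p) :
    Hol U ⊗[ℂ] C :=
  ∑ i, toHol U (fun q => (Module.finBasis ℂ E).coord i (F q))
    (fun p hp => analyticAt_coord (hF p hp) _) ⊗ₜ m (Module.finBasis ℂ E i)

theorem evT_vecHol {U : Opens P} (m : E →ₗ[ℂ] C) (F : P → E) (hF) {p : P} (hp : p ∈ U) :
    evT C (evp hp) (vecHol U m F hF) = m (F p) := by
  simp only [vecHol, map_sum, evT_tmul, evp_toHol]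
  conv_rhs => rw [← (Module.finBasis ℂ E).sum_repr (F p), map_sum]
  simp

theorem evT_dT_vecHol {U : Opens P} (m : E →ₗ[ℂ] C) (F : P → E) (hF) {p : P} (hp : p ∈ U)
    (w : P) : evT C (evp hp) (dT (holDir U) C w (vecHol U m F hF)) = m (fderiv ℂ F p w) := by
  simp only [vecHol, map_sum, dT_tmul, evT_tmul, evp_der_toHol]
  conv_rhs => rw [← (Module.finBasis ℂ E).sum_repr (fderiv ℂ F p w), map_sum]
  simp only [map_smul]
  refine Finset.sum_congr rfl fun i _ => ?_
  congr 1
  have h := (LinearMap.toContinuousLinearMap ((Module.finBasis ℂ E).coord i)).hasFDerivAt.comp p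
    (hF p hp).differentiableAt.hasFDerivAt
  exact congrArg (fun f : P →L[ℂ] ℂ => f w) h.fderiv

end VecHol

end HolRing

end VertexIRF

namespace VertexIRF

set_option linter.unusedSectionVars false

/-! ### Evaluation at points, and Taylor expansions as exponentials. -/

section Evaluation

open TopologicalSpace PowerSeries

variable {P P' : Type*} [NormedAddCommGroup P] [NormedSpace ℂ P]
  [NormedAddCommGroup P'] [NormedSpace ℂ P'] {B S C J : Type*} [Ring B] [Algebra ℂ B]
  [Ring S] [Algebra ℂ S] [Ring C] [Algebra ℂ C] [Fintype J]

/-- Coefficientwise evaluation at a point. -/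
def evS (C : Type*) [Ring C] [Algebra ℂ C] {U : Opens P} {p : P} (hp : p ∈ U)
    (F : (Hol U ⊗[ℂ] C)⟦X⟧) : C⟦X⟧ := PowerSeries.map (evT C (evp hp)).toRingHom F

theorem coeff_evS {U : Opens P} {p : P} (hp : p ∈ U) (F : (Hol U ⊗[ℂ] C)⟦X⟧) (n : ℕ) :
    coeff n (evS C hp F) = evT C (evp hp) (coeff n F) := PowerSeries.coeff_map _ _ _

theorem evS_mul {U : Opens P} {p : P} (hp : p ∈ U) (F F' : (Hol U ⊗[ℂ] C)⟦X⟧) :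
    evS C hp (F * F') = evS C hp F * evS C hp F' := map_mul _ _ _

theorem evS_one {U : Opens P} {p : P} (hp : p ∈ U) : evS C hp (1 : (Hol U ⊗[ℂ] C)⟦X⟧) = 1 :=
  map_one _

theorem evS_add {U : Opens P} {p : P} (hp : p ∈ U) (F F' : (Hol U ⊗[ℂ] C)⟦X⟧) :
    evS C hp (F + F') = evS C hp F + evS C hp F' := map_add _ _ _

/-- The function `q ↦ l (t q)`. -/
def slice (U : Opens P) (l : Module.Dual ℂ B) : Hol U ⊗[ℂ] B →ₗ[ℂ] Hol U :=
  (TensorProduct.rid ℂ (Hol U)).toLinearMap ∘ₗ l.lTensor (Hol U)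

theorem slice_tmul (U : Opens P) (l : Module.Dual ℂ B) (f : Hol U) (c : B) :
    slice U l (f ⊗ₜ c) = l c • f := by simp [slice]

theorem evp_slice {U : Opens P} {p : P} (hp : p ∈ U) (l : Module.Dual ℂ B) (t : Hol U ⊗[ℂ] B) :
    evp hp (slice U l t) = l (evT B (evp hp) t) := by
  induction t with
  | zero => simp
  | tmul f c => simp [slice_tmul, mul_comm]
  | add x y hx hy => simp only [map_add, hx, hy]

theorem slice_dT {U : Opens P} (l : Module.Dual ℂ B) (w : P) (t : Hol U ⊗[ℂ] B) :
    slice U l (dT (holDir U) B w t) = (holDir U).der w (slice U l t) := by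
  induction t with
  | zero => simp
  | tmul f c => simp [slice_tmul]
  | add x y hx hy => simp only [map_add, hx, hy]

/-- Iterated directional derivatives. -/
def dIter {U : Opens P} (t : Hol U ⊗[ℂ] B) : (k : ℕ) → (Fin k → P) → Hol U ⊗[ℂ] B
  | 0, _ => t
  | k + 1, w => dT (holDir U) B (w 0) (dIter t k (Fin.tail w))

theorem dIter_dT {U : Opens P} (t : Hol U ⊗[ℂ] B) (v : P) (k : ℕ) (w : Fin k → P) :
    dIter (dT (holDir U) B v t) k w = dT (holDir U) B v (dIter t k w) := by
  induction k with
  | zero => rfl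
  | succ k ih => rw [dIter, ih, dT_comm]; rfl

/-- The space of values carries no topology, so analytic derivatives exist only after a linear
functional is applied. The lemma identifies them with the algebraic derivatives on the tensor
product, which then satisfy the characterisation in `dirDeriv`. -/
theorem iteratedFDeriv_slice {U : Opens P} (l : Module.Dual ℂ B) (t : Hol U ⊗[ℂ] B) (k : ℕ)
    (w : Fin k → P) {p : P} (hp : p ∈ U) :
    iteratedFDeriv ℂ k (ext0 (slice U l t).1) p w = evp hp (slice U l (dIter t k w)) := by
  induction k generalizing p with
  | zero => rw [iteratedFDeriv_zero_apply, ext0_of_mem _ hp]; rfl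
  | succ k ih =>
    have hd : DifferentiableAt ℂ (iteratedFDeriv ℂ k (ext0 (slice U l t).1)) p :=
      
      (AnalyticOnNhd.iteratedFDeriv (s := (U : Set P))
        (fun q hq => hol_analyticAt (slice U l t) hq) k p hp).differentiableAt
    rw [iteratedFDeriv_succ_apply_left, dIter, slice_dT, evp_der]
    have h1 : ext0 (slice U l (dIter t k (Fin.tail w))).1 =ᶠ[𝓝 p]
        fun q => iteratedFDeriv ℂ k (ext0 (slice U l t).1) q (Fin.tail w) := by
      filter_upwards [U.isOpen.mem_nhds hp] with q hq
      rw [ih _ hq, ext0_of_mem _ hq]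
      rfl
    rw [h1.fderiv_eq, fderiv_continuousMultilinear_apply_const_apply hd]

theorem dirDeriv_of_evT {U : Opens P} {F : P → B} {t : Hol U ⊗[ℂ] B}
    (hF : ∀ q (hq : q ∈ U), F q = evT B (evp hq) t) {p : P} (hp : p ∈ U) (k : ℕ)
    (w : Fin k → P) : dirDeriv F p k w = evT B (evp hp) (dIter t k w) := by
  apply dirDeriv_eq
  intro l
  have h1 : (fun q => l (F q)) =ᶠ[𝓝 p] ext0 (slice U l t).1 := by
    filter_upwards [U.isOpen.mem_nhds hp] with q hq
    rw [hF q hq, ← evp_slice, ext0_of_mem _ hq]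
    rfl
  rw [(Filter.EventuallyEq.iteratedFDeriv ℂ h1 k).self_of_nhds, iteratedFDeriv_slice _ _ _ _ hp, evp_slice]

theorem holAt_of_evT {U : Opens P} {F : P → B} {t : Hol U ⊗[ℂ] B}
    (hF : ∀ q (hq : q ∈ U), F q = evT B (evp hq) t) {p : P} (hp : p ∈ U) : HolAt F p := by
  obtain ⟨S, rfl⟩ := TensorProduct.exists_finset t
  refine ⟨S.card, fun j => ext0 (S.equivFin.symm j).1.1.1, fun j => (S.equivFin.symm j).1.2,
    fun j => hol_analyticAt _ hp, ?_⟩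
  filter_upwards [U.isOpen.mem_nhds hp] with q hq
  rw [hF q hq, map_sum, ← Finset.sum_coe_sort, ← S.equivFin.symm.sum_comp]
  refine Finset.sum_congr rfl fun j _ => ?_
  rw [evT_tmul, ext0_of_mem _ hq]
  rfl

/-- The element `u` stores the product of the coefficients extracted so far. It must be arbitrary
for the induction, in which each new coefficient is appended on the right. -/
theorem op_zero_pow {U : Opens P} (w : J → P) (s : J → C) (k : ℕ) (x : Hol U ⊗[ℂ] C) (u : C) :
    (op (holDir U) 0 w s ^ k) (x * 1 ⊗ₜ u) =
      ∑ i : Fin k → J, dIter x k (fun m => w (i m)) *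
        1 ⊗ₜ (u * (List.ofFn fun m => s (i m)).prod) := by
  induction k generalizing x u with
  | zero => simp [dIter]
  | succ k ih =>
    have h1 : op (holDir U) 0 w s (x * 1 ⊗ₜ u) =
        ∑ j, dT (holDir U) C (w j) x * 1 ⊗ₜ (u * s j) := by
      rw [op_apply]
      refine Finset.sum_congr rfl fun j _ => ?_
      rw [LinearMap.zero_apply, zero_mul, add_zero, dT_mul, dT_one_tmul, mul_zero, add_zero,
        mul_assoc, Algebra.TensorProduct.tmul_mul_tmul, one_mul]
    rw [pow_succ, Module.End.mul_apply, h1, map_sum,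
      ← (Fin.consEquiv fun _ : Fin (k + 1) => J).sum_comp, Fintype.sum_prod_type]
    refine Finset.sum_congr rfl fun j _ => ?_
    rw [ih]
    refine Finset.sum_congr rfl fun i _ => ?_
    rw [dIter_dT, mul_assoc u, List.ofFn_succ, List.prod_cons]
    rfl

theorem dIter_lT {U : Opens P} (j : B →ₐ[ℂ] C) (t : Hol U ⊗[ℂ] B) (k : ℕ) (w : Fin k → P) :
    dIter (lT (Hol U) j t) k w = lT (Hol U) j (dIter t k w) := by
  induction k with
  | zero => rfl
  | succ k ih => rw [dIter, ih, dIter, lT_dT]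

theorem coeff_shift_of_evT {U : Opens P} {F : P → B} {t : Hol U ⊗[ℂ] B}
    (hF : ∀ q (hq : q ∈ U), F q = evT B (evp hq) t) {p : P} (hp : p ∈ U) (w : J → P)
    (s : J → S) (n : ℕ) :
    coeff n (shift F p w s) = evT (B ⊗[ℂ] S) (evp hp)
      (divPow (op (holDir U) 0 w fun j => (1 : B) ⊗ₜ[ℂ] s j) n
        (lT (Hol U) Algebra.TensorProduct.includeLeft t)) := by
  have h := op_zero_pow (U := U) w (fun j => (1 : B) ⊗ₜ[ℂ] s j) n
    (lT (Hol U) Algebra.TensorProduct.includeLeft t) 1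
  rw [← Algebra.TensorProduct.one_def, mul_one] at h
  rw [shift, coeff_mk, divPow, LinearMap.smul_apply, map_smul, h, map_sum]
  congr 1
  refine Finset.sum_congr rfl fun i _ => ?_
  rw [dirDeriv_of_evT hF hp, map_mul, dIter_lT, evT_lT, evT_tmul, map_one, one_smul, one_mul]
  have h2 : (List.ofFn fun m => (1 : B) ⊗ₜ[ℂ] s (i m)).prod =
      1 ⊗ₜ[ℂ] (List.ofFn fun m => s (i m)).prod := by
    have h3 := map_list_prod (Algebra.TensorProduct.includeRight : S →ₐ[ℂ] B ⊗[ℂ] S)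
      (List.ofFn fun m => s (i m))
    rw [List.map_ofFn] at h3
    exact h3.symm
  rw [h2, Algebra.TensorProduct.includeLeft_apply, Algebra.TensorProduct.tmul_mul_tmul, mul_one,
    one_mul]

theorem shift_of_evT {U : Opens P} {F : P → B} {t : Hol U ⊗[ℂ] B}
    (hF : ∀ q (hq : q ∈ U), F q = evT B (evp hq) t) {p : P} (hp : p ∈ U) (w : J → P)
    (s : J → S) :
    shift F p w s = evS (B ⊗[ℂ] S) hp
      (expS (op (holDir U) 0 w fun j => (1 : B) ⊗ₜ[ℂ] s j)
        (PowerSeries.C (lT (Hol U) Algebra.TensorProduct.includeLeft t))) := by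
  ext n
  rw [coeff_shift_of_evT hF hp, coeff_evS, coeff_expS_C]

theorem shiftSeries_of_evS {U : Opens P} {F : P → B⟦X⟧} {t : (Hol U ⊗[ℂ] B)⟦X⟧}
    (hF : ∀ q (hq : q ∈ U), F q = evS B hq t) {p : P} (hp : p ∈ U) (w : J → P)
    (s : J → S) :
    shiftSeries F p w s = evS (B ⊗[ℂ] S) hp
      (expS (op (holDir U) 0 w fun j => (1 : B) ⊗ₜ[ℂ] s j)
        (PowerSeries.map (lT (Hol U) Algebra.TensorProduct.includeLeft).toRingHom t)) := by
  ext n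
  rw [shiftSeries, coeff_mk, coeff_evS, coeff_expS, map_sum]
  refine Finset.sum_congr rfl fun m _ => ?_
  rw [coeff_shift_of_evT (t := coeff m.1 t) (fun q hq => by rw [hF q hq, coeff_evS]) hp]
  rfl

theorem holSeriesOn_of_evS {U : Opens P} {F : P → B⟦X⟧} {t : (Hol U ⊗[ℂ] B)⟦X⟧}
    (hF : ∀ q (hq : q ∈ U), F q = evS B hq t) : HolSeriesOn F (U : Set P) := fun p hp n =>
  holAt_of_evT (t := coeff n t) (fun q hq => by rw [hF q hq, coeff_evS]) hp

end Evaluation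

end VertexIRF

namespace VertexIRF

set_option linter.unusedSectionVars false

/-! ### The flat connection of a group-valued function and its transport. -/

section Connection

open TopologicalSpace PowerSeries

variable {E : Type*} [NormedAddCommGroup E] [NormedSpace ℂ E] [CompleteSpace E]
  [FiniteDimensional ℂ E]
  {G : Type*} [TopologicalSpace G] [ChartedSpace E G] [Group G] [LieGroup 𝓘(ℂ, E) ω G]
  {P P' : Type*} [NormedAddCommGroup P] [NormedSpace ℂ P]
  [NormedAddCommGroup P'] [NormedSpace ℂ P']

theorem analyticAt_logVec {φ : P → G} {q : P} (hφ : GHolAt E φ q) (w : P) :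
    AnalyticAt ℂ (fun q => logVec (E := E) φ q w) q := analyticAt_logDeriv hφ w

theorem analyticAt_adVec_inv {φ : P → G} {q : P} (hφ : GHolAt E φ q) (y : E) :
    AnalyticAt ℂ (fun q => adVec E (φ q)⁻¹ y) q := analyticAt_AdLin hφ.inv y

theorem logVec_add (φ : P → G) (q v w : P) :
    logVec (E := E) φ q (v + w) = logVec (E := E) φ q v + logVec (E := E) φ q w :=
  logDeriv_add φ q v w

theorem logVec_smul (φ : P → G) (q : P) (a : ℂ) (w : P) :
    logVec (E := E) φ q (a • w) = a • logVec (E := E) φ q w := logDeriv_smul φ q a w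

variable (E G) in
/-- The canonical map `𝔤 → U(𝔤)`, on the underlying vector space. -/
def iotaVec : E →ₗ[ℂ] Env E G := iota (LieAlg E G)

theorem iotaVec_lieBr (u v : E) : iotaVec E G (lieBr E G u v) =
    iotaVec E G u * iotaVec E G v - iotaVec E G v * iotaVec E G u :=
  letI := LieRing.ofAssociativeRing (A := Env E G)
  (UniversalEnvelopingAlgebra.ι ℂ : LieAlg E G →ₗ⁅ℂ⁆ Env E G).map_lie u v

/-- The flat connection defined by the left logarithmic derivative of a group-valued function. -/
def conn (U : Opens P) (φ : P → G) (hφ : ∀ p ∈ U, GHolAt E φ p) :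
    P →ₗ[ℂ] Hol U ⊗[ℂ] Env E G where
  toFun w := vecHol U (iotaVec E G) (fun p => logVec φ p w)
    fun p hp => analyticAt_logVec (hφ p hp) w
  map_add' v w := ext_ev fun p hp => by
    simp only [map_add, evT_vecHol, logVec_add]
  map_smul' a w := ext_ev fun p hp => by
    simp only [RingHom.id_apply, map_smul, evT_vecHol, logVec_smul]

variable {U : Opens P} {φ : P → G} (hφ : ∀ p ∈ U, GHolAt E φ p)

theorem evT_conn (w : P) {p : P} (hp : p ∈ U) :
    evT _ (evp hp) (conn U φ hφ w) = iotaVec E G (logVec φ p w) :=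
  evT_vecHol _ _ (fun p hp => analyticAt_logVec (hφ p hp) w) hp

theorem evT_dT_conn (v w : P) {p : P} (hp : p ∈ U) :
    evT _ (evp hp) (dT (holDir U) _ v (conn U φ hφ w)) =
      iotaVec E G (fderiv ℂ (fun q => logVec (E := E) φ q w) p v) :=
  evT_dT_vecHol _ _ (fun p hp => analyticAt_logVec (hφ p hp) w) hp v

theorem isFlat_conn : IsFlat (holDir U) (conn U φ hφ) := fun v w => ext_ev fun p hp => by
  simp only [map_add, map_sub, map_mul, evT_conn, evT_dT_conn, map_zero]
  rw [← iotaVec_lieBr, ← map_sub, ← map_add, maurerCartan (hφ p hp), map_zero]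

/-- The left-invariant sections `Ad_{φ⁻¹} y`. -/
def adSec (y : E) : Hol U ⊗[ℂ] Env E G :=
  vecHol U (iotaVec E G) (fun p => adVec E (φ p)⁻¹ y) fun p hp => analyticAt_adVec_inv (hφ p hp) y

theorem evT_adSec (y : E) {p : P} (hp : p ∈ U) :
    evT _ (evp hp) (adSec hφ y) = iotaVec E G (adVec E (φ p)⁻¹ y) :=
  evT_vecHol _ _ (fun p hp => analyticAt_adVec_inv (hφ p hp) y) hp

/-- The section `Ad_{φ⁻¹} y` is covariantly constant for the connection acting by commutators. This
comes from `fderiv_Ad_inv`, with the bracket realised as a commutator in `U(𝔤)`. -/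
theorem dT_adSec (y : E) (w : P) : dT (holDir U) _ w (adSec hφ y) =
    adSec hφ y * conn U φ hφ w - conn U φ hφ w * adSec hφ y := ext_ev fun p hp => by
  rw [map_sub, map_mul, map_mul, evT_conn, evT_adSec, adSec, evT_dT_vecHol,
    fderiv_Ad_inv (hφ p hp), map_neg, iotaVec_lieBr, neg_sub]

variable {S C J : Type*} [Ring S] [Algebra ℂ S] [Ring C] [Algebra ℂ C] [Fintype J]

/-- The image of the connection of a group-valued function under a homomorphism. -/
def connMap (j : Env E G →ₐ[ℂ] C) : P →ₗ[ℂ] Hol U ⊗[ℂ] C :=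
  (lT (Hol U) j).toLinearMap ∘ₗ conn U φ hφ

theorem connMap_apply (j : Env E G →ₐ[ℂ] C) (w : P) :
    connMap hφ j w = lT (Hol U) j (conn U φ hφ w) := rfl

theorem isFlat_connMap (j : Env E G →ₐ[ℂ] C) : IsFlat (holDir U) (connMap hφ j) :=
  (isFlat_conn hφ).lT j

theorem evT_connMap (j : Env E G →ₐ[ℂ] C) (w : P) {p : P} (hp : p ∈ U) :
    evT _ (evp hp) (connMap hφ j w) = j (iotaVec E G (logVec φ p w)) := by
  rw [connMap_apply, evT_lT, evT_conn]

theorem connMap_commute {c : C} {j : Env E G →ₐ[ℂ] C} (h : ∀ a, Commute (j a) c) (w : P) :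
    Commute (connMap hφ j w) (1 ⊗ₜ c) := lT_commute_tmul h _

theorem odeCoeff_eq {A : Type*} [Ring A] [Algebra ℂ A] {η : A⟦X⟧} {e : ℕ → A} (h0 : e 0 = 1)
    (h : ∀ n : ℕ, ((n : ℂ) + 1) • e (n + 1) =
      ∑ m ∈ Finset.HasAntidiagonal.antidiagonal n, e m.1 * coeff m.2 η) (n : ℕ) : odeCoeff η n = e n := by
  induction n using Nat.strong_induction_on with
  | _ n ih =>
    cases n with
    | zero => rw [odeCoeff, h0]
    | succ n =>
      have hn : ((n : ℂ) + 1) ≠ 0 := Nat.cast_add_one_ne_zero n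
      rw [odeCoeff, inv_smul_eq_iff₀ hn, h,
        Finset.Nat.sum_antidiagonal_eq_sum_range_succ_mk, Finset.sum_range]
      refine Finset.sum_congr rfl fun i _ => ?_
      rw [ih _ i.2]

theorem coeff_C_commute {A : Type*} [Ring A] {x y : A} (h : Commute x y) (n : ℕ) :
    Commute (coeff n (PowerSeries.C x)) y := by
  rw [coeff_C]
  split_ifs
  · exact h
  · exact Commute.zero_left _

theorem expS_sum {V : Type*} [Ring V] [Algebra ℂ V] (T : Module.End ℂ V) (F : J → V⟦X⟧) :
    expS T (∑ j, F j) = ∑ j, expS T (F j) :=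
  map_sum (AddMonoidHom.mk' _ (expS_add_right T)) F _

section

variable {θ : P →ₗ[ℂ] Hol U ⊗[ℂ] C} {w : J → P} {c : J → C}
  (hc : ∀ i j, Commute (c i) (c j)) (hθ : ∀ i j, Commute (θ (w i)) (1 ⊗ₜ c j))

include hc hθ in
theorem op_one_commute (k : J) : Commute (op (holDir U) θ w c 1) (1 ⊗ₜ c k) := by
  rw [op_apply]
  refine Commute.sum_left _ _ _ fun j _ => ?_
  rw [dT_one, zero_add, mul_one]
  exact (hθ j k).mul_left (tmul_commute_tmul (hc _ _) _ _)

-- This is `dZ/dℏ = Z η` for `Z = exp(ℏT) 1`, coefficient by coefficient. As `T` commutes with its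
-- powers, `dZ/dℏ = exp(ℏT)(T 1)`; as `T 1` commutes with the expansion variables, multiplicativity
-- makes this `Z` times the ordinary Taylor expansion `η` of `T 1`.
include hc hθ in
theorem succ_smul_divPow_op_one (n : ℕ) :
    ((n : ℂ) + 1) • divPow (op (holDir U) θ w c) (n + 1) 1 = ∑ m ∈ Finset.HasAntidiagonal.antidiagonal n,
      divPow (op (holDir U) θ w c) m.1 1 *
        coeff m.2 (expS (op (holDir U) 0 w c) (PowerSeries.C (op (holDir U) θ w c 1))) := by
  have h1 := expS_op_mul_zero (dd := holDir U) (θ := θ) (w := w) hc 1 (q := PowerSeries.C (op (holDir U) θ w c 1))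
    (fun n k => coeff_C_commute (op_one_commute hc hθ k) n)
  have h2 := congrArg (coeff n) h1
  rw [one_mul, coeff_expS_C, coeff_mul] at h2
  simp only [coeff_expS_one] at h2
  rw [← h2, succ_smul_divPow_apply]
  change (op (holDir U) θ w c * divPow (op (holDir U) θ w c) n) 1 =
    (divPow (op (holDir U) θ w c) n * op (holDir U) θ w c) 1
  rw [divPow, mul_smul_comm, smul_mul_assoc, ← pow_succ, ← pow_succ']

include hc in
theorem expS_op_zero_op_one :
    expS (op (holDir U) 0 w c) (PowerSeries.C (op (holDir U) θ w c 1)) =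
      ∑ j, expS (op (holDir U) 0 w c) (PowerSeries.C (θ (w j))) * PowerSeries.C (1 ⊗ₜ[ℂ] c j) := by
  rw [op_apply, map_sum, expS_sum]
  refine Finset.sum_congr rfl fun j _ => ?_
  rw [dT_one, zero_add, mul_one, map_mul,
    expS_op_mul_zero hc _ (fun n k => coeff_C_commute (tmul_commute_tmul (hc j k) 1 1) n)]
  congr 1
  apply expS_of_forall_eq_zero
  intro n
  rw [coeff_C]
  split_ifs <;> simp [op_apply]

include hc hθ in
theorem odeSol_evS {p : P} (hp : p ∈ U) {η : C⟦X⟧} (hη : η = evS C hp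
      (expS (op (holDir U) 0 w c) (PowerSeries.C (op (holDir U) θ w c 1)))) :
    (odeSol η).ser = evS C hp (expS (op (holDir U) θ w c) 1) := by
  ext n
  change coeff n (PowerSeries.mk (odeCoeff η)) = _
  rw [coeff_mk, coeff_evS, coeff_expS_one]
  refine odeCoeff_eq (e := fun n => evT C (evp hp) (divPow (op (holDir U) θ w c) n 1)) ?_
    (fun n => ?_) n
  · rw [divPow_zero]
    exact map_one _
  · rw [← map_smul, succ_smul_divPow_op_one hc hθ, map_sum]
    refine Finset.sum_congr rfl fun m _ => ?_
    rw [map_mul, hη, coeff_evS]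

end

/-- The Taylor expansion of the logarithmic derivative. -/
theorem evS_expS_op_conn {p : P} (hp : p ∈ U) (w : J → P) (s : J → S)
    (hs : ∀ i j, Commute ((1 : Env E G) ⊗ₜ[ℂ] s i) (1 ⊗ₜ[ℂ] s j)) :
    ∑ j, shift (fun q => iota (LieAlg E G) (logDeriv φ q (w j))) p w s *
      PowerSeries.C (1 ⊗ₜ[ℂ] s j) = evS (Env E G ⊗[ℂ] S) hp
        (expS (op (holDir U) 0 w (fun j => 1 ⊗ₜ s j)) (PowerSeries.C (op (holDir U)
          (connMap hφ Algebra.TensorProduct.includeLeft) w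
            (fun j => 1 ⊗ₜ s j) 1))) := by
  rw [expS_op_zero_op_one hs, evS, map_sum]
  refine Finset.sum_congr rfl fun j _ => ?_
  rw [map_mul]
  refine congrArg₂ (· * ·)
    (shift_of_evT (fun q hq => (evT_conn hφ (w j) hq).symm) hp w s) ?_
  rw [PowerSeries.map_C]
  refine congrArg PowerSeries.C (Eq.symm ?_)
  refine (evT_tmul (evp hp) 1 _).trans ?_
  rw [map_one, one_smul]

theorem includeLeft_commute_tmul {A : Type*} [Ring A] [Algebra ℂ A] (a : A) (s : S) :
    Commute ((Algebra.TensorProduct.includeLeft : A →ₐ[ℂ] A ⊗[ℂ] S) a) (1 ⊗ₜ s) := by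
  simp only [Algebra.TensorProduct.includeLeft_apply, Commute, SemiconjBy,
    Algebra.TensorProduct.tmul_mul_tmul, mul_one, one_mul]

theorem one_tmul_commute {A : Type*} [Ring A] [Algebra ℂ A] {s t : S} (h : Commute s t) :
    Commute ((1 : A) ⊗ₜ[ℂ] s) (1 ⊗ₜ t) := by
  simp only [Commute, SemiconjBy, Algebra.TensorProduct.tmul_mul_tmul, h.eq]

/-- The differential equation in `ℏ` that defines `groupShift` is traded for an exponential, to
which flatness and the Leibniz rules apply. -/
theorem groupShift_ser {p : P} (hp : p ∈ U) (w : J → P) {s : J → S}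
    (hs : ∀ i j, Commute (s i) (s j)) :
    (groupShift φ p w s).ser = evS (Env E G ⊗[ℂ] S) hp (expS (op (holDir U)
      (connMap hφ Algebra.TensorProduct.includeLeft) w
      (fun j => 1 ⊗ₜ s j)) 1) := by
  have hcc : ∀ i j, Commute ((1 : Env E G) ⊗ₜ[ℂ] s i) (1 ⊗ₜ[ℂ] s j) :=
    fun i j => one_tmul_commute (hs i j)
  have h := odeSol_evS (w := w) hcc (fun i j => connMap_commute hφ
    (fun a => includeLeft_commute_tmul a (s j)) (w i)) hp (evS_expS_op_conn hφ hp w s hcc)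
  exact h

theorem evS_mapLin_lL (Λ : S →ₗ[ℂ] C) {p : P} (hp : p ∈ U) (F : (Hol U ⊗[ℂ] S)⟦X⟧) :
    mapLin Λ (evS S hp F) = evS C hp (mapLin (lL (Hol U) Λ) F) := by
  ext n
  rw [coeff_mapLin, coeff_evS, coeff_evS, coeff_mapLin, evT_lL]

theorem lL_mul_of {Λ : Env E G ⊗[ℂ] S →ₗ[ℂ] C} {j : Env E G →ₐ[ℂ] C}
    (hj : ∀ a x, Λ (a ⊗ₜ 1 * x) = j a * Λ x) (t : Hol U ⊗[ℂ] Env E G)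
    (x : Hol U ⊗[ℂ] (Env E G ⊗[ℂ] S)) :
    lL (Hol U) Λ (lT (Hol U) Algebra.TensorProduct.includeLeft t * x) =
      lT (Hol U) j t * lL (Hol U) Λ x := by
  induction t with
  | zero => simp
  | add t t' ht ht' => simp only [map_add, add_mul, ht, ht']
  | tmul f a =>
    induction x with
    | zero => simp
    | add x x' hx hx' => simp only [map_add, mul_add, hx, hx']
    | tmul g b => simp [hj]

/-- Taylor expansions of group-valued functions, with the expansion variables moved to the right
by a linear map `Λ`. -/
theorem mapLin_groupShift {p : P} (hp : p ∈ U) (w : J → P) {s : J → S}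
    (hs : ∀ i j, Commute (s i) (s j)) {Λ : Env E G ⊗[ℂ] S →ₗ[ℂ] C} {j : Env E G →ₐ[ℂ] C}
    {c : J → C} (h1 : Λ 1 = 1) (hj : ∀ a x, Λ (a ⊗ₜ 1 * x) = j a * Λ x)
    (hc : ∀ i x, Λ (x * 1 ⊗ₜ s i) = Λ x * c i) :
    mapLin Λ (groupShift φ p w s).ser = evS C hp (expS (op (holDir U)
      (connMap hφ j) w c) 1) := by
  -- The map `Λ` need not be multiplicative; normal ordering is not. It intertwines the operators as
  -- soon as it is left linear over `U(𝔤)` and carries right multiplication by `s_i` to right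
  -- multiplication by `c_i`.
  rw [groupShift_ser hφ hp w hs, evS_mapLin_lL, mapLin_expS (fun x => lL_op hc
    (θ' := connMap hφ j) (fun i x => lL_mul_of hj _ _) x)]
  congr 2
  ext n
  rw [coeff_mapLin, coeff_one, coeff_one]
  split_ifs
  · rw [Algebra.TensorProduct.one_def]
    exact congrArg (fun x => (1 : Hol U) ⊗ₜ[ℂ] x) h1
  · simp

/-- Exponentials of covariant operators are compatible with pullbacks along affine maps. -/
theorem evS_pull {U' : Opens P'} (p₀ : P) (L : P' →L[ℂ] P) (h : ∀ q ∈ U', p₀ + L q ∈ U)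
    {θ : P →ₗ[ℂ] Hol U ⊗[ℂ] C} {θ' : P' →ₗ[ℂ] Hol U' ⊗[ℂ] C} {w : J → P'} {v : J → P} {c : J → C}
    (hv : ∀ j, v j = L (w j))
    (hθ : ∀ w, rT C (pull p₀ L h) (θ (L w)) = θ' w) {q : P'} (hq : q ∈ U')
    (F : (Hol U ⊗[ℂ] C)⟦X⟧) :
    evS C (h q hq) (expS (op (holDir U) θ v c) F) =
      evS C hq (expS (op (holDir U') θ' w c)
        (PowerSeries.map (rT C (pull p₀ L h)).toRingHom F)) := by
  obtain rfl : v = fun j => L (w j) := funext hv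
  rw [← map_expS (fun x => rT_op (fun j f => pull_der p₀ L h (w j) f) (fun j => hθ (w j)) x)]
  ext n
  rw [coeff_evS, coeff_evS, PowerSeries.coeff_map]
  exact (evT_rT (evp hq) (pull p₀ L h) _).symm

end Connection

end VertexIRF

namespace VertexIRF

set_option linter.unusedSectionVars false

/-! ### Factorisation of transports, covariantly constant sections, scalar Taylor expansions. -/

section Products

open TopologicalSpace PowerSeries

variable {P P' : Type*} [NormedAddCommGroup P] [NormedSpace ℂ P]
  [NormedAddCommGroup P'] [NormedSpace ℂ P'] {C C' J K : Type*}
  [Ring C] [Algebra ℂ C] [Ring C'] [Algebra ℂ C'] [Fintype J] [Fintype K]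
  {U : Opens P} {U' : Opens P'}

theorem evS_congr {p q : P} (h : p = q) (hp : p ∈ U) (hq : q ∈ U) (F : (Hol U ⊗[ℂ] C)⟦X⟧) :
    evS C hp F = evS C hq F := by
  subst h
  rfl

/-- The preimage of an open set under an affine map. -/
def affPre (U : Opens P) (p₀ : P) (L : P' →L[ℂ] P) : Opens P' :=
  ⟨{q | p₀ + L q ∈ U}, U.isOpen.preimage (continuous_const.add L.continuous)⟩

theorem mem_affPre {p₀ : P} {L : P' →L[ℂ] P} {q : P'} : q ∈ affPre U p₀ L ↔ p₀ + L q ∈ U := Iff.rfl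

/-- Restriction of a connection to an affine slice. -/
def pullConn (p₀ : P) (L : P' →L[ℂ] P) (h : ∀ q ∈ U', p₀ + L q ∈ U) (θ : P →ₗ[ℂ] Hol U ⊗[ℂ] C) :
    P' →ₗ[ℂ] Hol U' ⊗[ℂ] C :=
  (rT C (pull p₀ L h)).toLinearMap ∘ₗ θ ∘ₗ L.toLinearMap

theorem evS_pullConn (p₀ : P) (L : P' →L[ℂ] P) (h : ∀ q ∈ U', p₀ + L q ∈ U)
    (θ : P →ₗ[ℂ] Hol U ⊗[ℂ] C) (w : J → P') (c : J → C) {q : P'} (hq : q ∈ U')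
    (F : (Hol U ⊗[ℂ] C)⟦X⟧) :
    evS C (h q hq) (expS (op (holDir U) θ (fun j => L (w j)) c) F) =
      evS C hq (expS (op (holDir U') (pullConn p₀ L h θ) w c)
        (PowerSeries.map (rT C (pull p₀ L h)).toRingHom F)) :=
  evS_pull p₀ L h (fun _ => rfl) (fun _ => rfl) hq F

theorem evS_expS_map (f : C →ₐ[ℂ] C') {θ : P →ₗ[ℂ] Hol U ⊗[ℂ] C} {θ' : P →ₗ[ℂ] Hol U ⊗[ℂ] C'}
    {w : J → P} {c : J → C} {c' : J → C'} (hc : ∀ j, f (c j) = c' j)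
    (hθ : ∀ w, lT (Hol U) f (θ w) = θ' w) {p : P} (hp : p ∈ U) (F : (Hol U ⊗[ℂ] C)⟦X⟧) :
    PowerSeries.map f.toRingHom (evS C hp (expS (op (holDir U) θ w c) F)) =
      evS C' hp (expS (op (holDir U) θ' w c') (PowerSeries.map (lT (Hol U) f).toRingHom F)) := by
  rw [← map_expS (fun x => lT_op hc (fun j => hθ (w j)) x)]
  ext n
  rw [PowerSeries.coeff_map, coeff_evS, coeff_evS, PowerSeries.coeff_map]
  exact (evT_lT (evp hp) f _).symm

/-- A series of constant functions. -/
def constS (U : Opens P) (Y : C⟦X⟧) : (Hol U ⊗[ℂ] C)⟦X⟧ :=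
  PowerSeries.map (Algebra.TensorProduct.includeRight : C →ₐ[ℂ] Hol U ⊗[ℂ] C).toRingHom Y

theorem coeff_constS (Y : C⟦X⟧) (n : ℕ) : coeff n (constS U Y) = 1 ⊗ₜ coeff n Y :=
  PowerSeries.coeff_map _ _ _

theorem evS_constS {p : P} (hp : p ∈ U) (Y : C⟦X⟧) : evS C hp (constS U Y) = Y := by
  ext n
  rw [coeff_evS, coeff_constS, evT_tmul, map_one, one_smul]

theorem expS_op_zero_constS (w : J → P) (c : J → C) (Y : C⟦X⟧) :
    expS (op (holDir U) 0 w c) (constS U Y) = constS U Y := by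
  apply expS_of_forall_eq_zero
  intro n
  rw [coeff_constS, op_apply]
  refine Finset.sum_eq_zero fun j _ => ?_
  rw [LinearMap.zero_apply, zero_mul, add_zero, dT_one_tmul, zero_mul]

/-- The transport along a sum of directions is a product if the transport along the second family
of directions does not depend on the variable in the first family of directions. -/
theorem evS_expS_add_of_const {θ : P →ₗ[ℂ] Hol U ⊗[ℂ] C} (hθ : IsFlat (holDir U) θ)
    (L : P' →L[ℂ] P) {w : J → P'} {c : J → C} {v : K → P} {d : K → C}
    (hc : ∀ i j, Commute (c i) (c j)) (hcd : ∀ i j, Commute (c i) (d j)) {p : P} (hp : p ∈ U)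
    {Y : C⟦X⟧} (hY : ∀ t (ht : p + L t ∈ U), evS C ht (expS (op (holDir U) θ v d) 1) = Y)
    (hYc : ∀ n j, Commute (coeff n Y) (c j)) :
    evS C hp (expS (op (holDir U) θ (fun j => L (w j)) c + op (holDir U) θ v d) 1) =
      evS C hp (expS (op (holDir U) θ (fun j => L (w j)) c) 1) * Y := by
  have e : p = p + L 0 := by rw [map_zero, add_zero]
  have h : ∀ q ∈ affPre U p L, p + L q ∈ U := fun q hq => hq
  have h0 : (0 : P') ∈ affPre U p L := mem_affPre.mpr (e ▸ hp)
  -- The transport along `v` has the same value `Y` at each point of the slice `p + L t`. On the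
  -- slice it is therefore a constant series, on which the ordinary Taylor expansion along `w` acts
  -- trivially.
  have hK : PowerSeries.map (rT C (pull p L h)).toRingHom (expS (op (holDir U) θ v d) 1) =
      constS (affPre U p L) Y := by
    ext n
    apply ext_ev
    intro q hq
    rw [PowerSeries.coeff_map, coeff_constS, evT_tmul, map_one, one_smul]
    refine (evT_rT (evp hq) (pull p L h) _).trans ?_
    rw [evp_comp_pull, ← hY q (h q hq), coeff_evS]
  have h1 := expS_op_mul_zero (dd := holDir (affPre U p L)) (θ := pullConn p L h θ) (w := w) hc 1
    (q := constS (affPre U p L) Y) (fun n j => by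
        rw [coeff_constS]
        exact tmul_commute_tmul (hYc n j) 1 1)
  rw [one_mul, expS_op_zero_constS] at h1
  rw [expS_comp (op_commute hθ hcd), evS_congr e hp (h 0 h0), evS_congr e hp (h 0 h0),
    evS_pullConn p L h _ _ _ h0, evS_pullConn p L h _ _ _ h0, hK, map_one, h1, evS_mul, evS_constS]

theorem op_mul_left {θ : P →ₗ[ℂ] Hol U ⊗[ℂ] C} {w : J → P} {c : J → C} {V : Hol U ⊗[ℂ] C}
    (hV : ∀ j, dT (holDir U) C (w j) V = V * θ (w j) - θ (w j) * V) (x : Hol U ⊗[ℂ] C) :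
    V * op (holDir U) θ w c x = op (holDir U) θ w c (V * x) := by
  rw [op_apply, op_apply, Finset.mul_sum]
  refine Finset.sum_congr rfl fun j _ => ?_
  rw [dT_mul, hV, ← mul_assoc]
  congr 1
  simp only [sub_mul, mul_add, mul_assoc]
  abel

/-- A section that commutes with the covariant derivatives is intertwined by the transport with
its Taylor expansion. -/
theorem evS_expS_intertwine {θ : P →ₗ[ℂ] Hol U ⊗[ℂ] C} {w : J → P} {c : J → C}
    (hc : ∀ i j, Commute (c i) (c j)) {V : Hol U ⊗[ℂ] C}
    (hV : ∀ j, dT (holDir U) C (w j) V = V * θ (w j) - θ (w j) * V)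
    (hVc : ∀ j, Commute V (1 ⊗ₜ c j)) {p : P} (hp : p ∈ U) :
    PowerSeries.C (evT C (evp hp) V) * evS C hp (expS (op (holDir U) θ w c) 1) =
      evS C hp (expS (op (holDir U) θ w c) 1) *
        evS C hp (expS (op (holDir U) 0 w c) (PowerSeries.C V)) := by
  have h1 := expS_op_mul_zero (dd := holDir U) (θ := θ) (w := w) hc 1 (q := PowerSeries.C V)
    (fun n j => coeff_C_commute (hVc j) n)
  rw [one_mul] at h1
  have hm : ∀ F : (Hol U ⊗[ℂ] C)⟦X⟧, mapLin (LinearMap.mulLeft ℂ V) F = PowerSeries.C V * F := by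
    intro F
    ext n
    rw [coeff_mapLin, coeff_C_mul]
    rfl
  -- Left multiplication by a covariantly constant section commutes with the covariant operator. So
  -- `exp(ℏT) V` equals `V · exp(ℏT) 1` on the one hand and, by `h1`, the transport times the Taylor
  -- expansion of `V` on the other.
  have h2 := mapLin_expS (m := LinearMap.mulLeft ℂ V) (fun x => op_mul_left (c := c) hV x) 1
  rw [hm, hm, mul_one, h1] at h2
  rw [← evS_mul, ← h2, evS_mul]
  congr 1
  ext n
  rw [coeff_evS, coeff_C, coeff_C]
  split_ifs
  · rfl
  · rw [map_zero]

/-- Taylor expansion of a scalar function with commuting expansion variables. -/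
def taylor {p : P} (hp : p ∈ U) (w : J → P) (c : J → C) (t : Hol U ⊗[ℂ] C) : C⟦X⟧ :=
  evS C hp (expS (op (holDir U) 0 w c) (PowerSeries.C t))

theorem taylor_add {p : P} (hp : p ∈ U) (w : J → P) (c : J → C) (t t' : Hol U ⊗[ℂ] C) :
    taylor hp w c (t + t') = taylor hp w c t + taylor hp w c t' := by
  rw [taylor, map_add, expS_add_right, evS_add]
  rfl

theorem taylor_sum {ι : Type*} (s : Finset ι) {p : P} (hp : p ∈ U) (w : J → P) (c : J → C)
    (t : ι → Hol U ⊗[ℂ] C) :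
    taylor hp w c (∑ i ∈ s, t i) = ∑ i ∈ s, taylor hp w c (t i) :=
  map_sum (AddMonoidHom.mk' _ (taylor_add hp w c)) t s

theorem taylor_mul {p : P} (hp : p ∈ U) {w : J → P} {c : J → C}
    (hc : ∀ i j, Commute (c i) (c j)) (t : Hol U ⊗[ℂ] C) {t' : Hol U ⊗[ℂ] C}
    (ht : ∀ j, Commute t' (1 ⊗ₜ c j)) :
    taylor hp w c (t * t') = taylor hp w c t * taylor hp w c t' := by
  rw [taylor, map_mul, expS_op_mul_zero hc _ (fun n j => coeff_C_commute (ht j) n), evS_mul]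
  rfl

theorem taylor_one_tmul {p : P} (hp : p ∈ U) (w : J → P) (c : J → C) (u : C) :
    taylor hp w c (1 ⊗ₜ u) = PowerSeries.C u := by
  rw [taylor, expS_of_forall_eq_zero]
  · ext n
    rw [coeff_evS, coeff_C, coeff_C]
    split_ifs <;> simp
  · intro n
    rw [coeff_C]
    split_ifs <;> simp [op_apply]

theorem taylor_affine {p : P} (hp : p ∈ U) (w : J → P) (c : J → C) {f : Hol U} {a : J → ℂ}
    (hf : ∀ j, (holDir U).der (w j) f = algebraMap ℂ (Hol U) (a j)) :
    taylor hp w c (f ⊗ₜ 1) =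
      PowerSeries.C (algebraMap ℂ C (evp hp f)) + PowerSeries.X * PowerSeries.C (∑ j, a j • c j) := by
  have h1 : op (holDir U) 0 w c (f ⊗ₜ 1) = 1 ⊗ₜ ∑ j, a j • c j := by
    rw [op_apply, TensorProduct.tmul_sum]
    refine Finset.sum_congr rfl fun j _ => ?_
    rw [LinearMap.zero_apply, zero_mul, add_zero, dT_tmul, hf, Algebra.algebraMap_eq_smul_one,
      Algebra.TensorProduct.tmul_mul_tmul, mul_one, one_mul, TensorProduct.smul_tmul]
  have h2 : ∀ k : ℕ, divPow (op (holDir U) 0 w c) (k + 2) (f ⊗ₜ 1) = 0 := by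
    intro k
    rw [divPow, LinearMap.smul_apply, pow_succ, pow_succ, Module.End.mul_apply,
      Module.End.mul_apply, h1]
    have h3 : op (holDir U) 0 w c (1 ⊗ₜ ∑ j, a j • c j) = 0 := by simp [op_apply]
    rw [h3, map_zero, smul_zero]
  ext n
  rw [taylor, coeff_evS, coeff_expS_C, map_add, coeff_C]
  match n with
  | 0 => rw [divPow_zero, coeff_zero_X_mul, if_pos rfl, add_zero, Module.End.one_apply, evT_tmul,
      Algebra.algebraMap_eq_smul_one]
  | 1 => rw [coeff_succ_X_mul, coeff_C, if_pos rfl, if_neg one_ne_zero, zero_add, divPow,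
      LinearMap.smul_apply, pow_one, h1, Nat.factorial_one, Nat.cast_one, inv_one, one_smul,
      evT_tmul, map_one, one_smul]
  | k + 2 => rw [coeff_succ_X_mul, coeff_C, if_neg (Nat.succ_ne_zero _),
      if_neg (Nat.succ_ne_zero _), h2, map_zero, add_zero]

/-- The Taylor expansion of a function with values in a subalgebra that contains the expansion
variables has coefficients in the subalgebra. -/
theorem coeff_taylor_mem {p : P} (hp : p ∈ U) (w : J → P) {c : J → C} (B : Subalgebra ℂ C)
    (hc : ∀ j, c j ∈ B) {t : Hol U ⊗[ℂ] C} {t' : Hol U ⊗[ℂ] B} (ht : lT (Hol U) B.val t' = t)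
    (n : ℕ) : coeff n (taylor hp w c t) ∈ B := by
  have h := evS_expS_map B.val (θ := 0) (θ' := 0) (w := w) (c := fun j => (⟨c j, hc j⟩ : B))
    (c' := c) (fun j => rfl) (fun w => map_zero _) hp (PowerSeries.C t')
  rw [PowerSeries.map_C] at h
  have h2 : (lT (Hol U) B.val).toRingHom t' = t := ht
  rw [h2] at h
  rw [taylor, ← h, PowerSeries.coeff_map]
  exact Subtype.property _

/-- Multiplication by `ℏ` allows each `u_k` to be replaced by a scalar function `ζ_k` that expands
to `ℏ u_k`. An identity between sections linear in the `u_k` is thereby reduced to an identity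
between scalar functions. This serves both the realization of `f` and the zero weight. -/
theorem X_mul_taylor_sum {ι : Type*} [Fintype ι] {p : P} (hp : p ∈ U) {w : J → P} {c : J → C}
    (hc : ∀ i j, Commute (c i) (c j)) {u : ι → C} (hu : ∀ k j, Commute (u k) (c j))
    {m ζ : ι → Hol U} (hζ : ∀ k, taylor hp w c (ζ k ⊗ₜ 1) = PowerSeries.X * PowerSeries.C (u k)) :
    PowerSeries.X * taylor hp w c (∑ k, m k ⊗ₜ u k) =
      taylor hp w c ((∑ k, m k * ζ k) ⊗ₜ 1) := by
  rw [TensorProduct.sum_tmul, taylor_sum, taylor_sum, Finset.mul_sum]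
  refine Finset.sum_congr rfl fun k _ => ?_
  have e1 : m k ⊗ₜ[ℂ] u k = m k ⊗ₜ 1 * 1 ⊗ₜ u k := by simp
  have e2 : (m k * ζ k) ⊗ₜ[ℂ] (1 : C) = m k ⊗ₜ 1 * ζ k ⊗ₜ 1 := by simp
  rw [e1, e2, taylor_mul hp hc _ (fun j => tmul_commute_tmul (hu k j) 1 1),
    taylor_mul hp hc _ (fun j => tmul_commute_tmul (Commute.one_left _) _ _), hζ,
    taylor_one_tmul, ← mul_assoc, ← mul_assoc, (commute_X _).eq]

end Products

/-! ### Restriction of group connections to affine slices. -/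

section GroupConnections

open TopologicalSpace PowerSeries

variable {E : Type*} [NormedAddCommGroup E] [NormedSpace ℂ E] [CompleteSpace E]
  [FiniteDimensional ℂ E]
  {G : Type*} [TopologicalSpace G] [ChartedSpace E G] [Group G] [LieGroup 𝓘(ℂ, E) ω G]
  {P P' : Type*} [NormedAddCommGroup P] [NormedSpace ℂ P]
  [NormedAddCommGroup P'] [NormedSpace ℂ P'] {S C C' J K : Type*} [Ring S] [Algebra ℂ S]
  [Ring C] [Algebra ℂ C] [Ring C'] [Algebra ℂ C'] [Fintype J] [Fintype K]
  {U : Opens P} {U' : Opens P'} {φ : P → G} (hφ : ∀ p ∈ U, GHolAt E φ p)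

theorem connMap_congr {ψ : P → G} (hψ : ∀ p ∈ U, GHolAt E ψ p) {j j' : Env E G →ₐ[ℂ] C} {v w : P}
    (h : ∀ p ∈ U, j (iotaVec E G (logVec φ p v)) = j' (iotaVec E G (logVec ψ p w))) :
    connMap hφ j v = connMap hψ j' w := ext_ev fun p hp => by
  rw [evT_connMap, evT_connMap, h p hp]

theorem lT_connMap (f : C →ₐ[ℂ] C') (j : Env E G →ₐ[ℂ] C) (w : P) :
    lT (Hol U) f (connMap hφ j w) = connMap hφ (f.comp j) w := ext_ev fun p hp => by
  rw [evT_lT, evT_connMap, evT_connMap]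
  rfl

theorem connMap_add {j j₁ j₂ : Env E G →ₐ[ℂ] C}
    (h : ∀ y, j (iotaVec E G y) = j₁ (iotaVec E G y) + j₂ (iotaVec E G y)) :
    connMap hφ j = connMap hφ j₁ + connMap hφ j₂ := LinearMap.ext fun w => ext_ev fun p hp => by
  rw [LinearMap.add_apply, map_add, evT_connMap, evT_connMap, evT_connMap, h]

theorem connMap_eq_zero {j : Env E G →ₐ[ℂ] C} (h : ∀ y, j (iotaVec E G y) = 0) :
    connMap hφ j = 0 := LinearMap.ext fun w => ext_ev fun p hp => by
  rw [evT_connMap, h, LinearMap.zero_apply, map_zero]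

theorem rT_connMap (p₀ : P) (L : P' →L[ℂ] P) (h : ∀ q ∈ U', p₀ + L q ∈ U) {ψ : P' → G}
    (hψ : ∀ q, ψ q = φ (p₀ + L q)) (hψ' : ∀ q ∈ U', GHolAt E ψ q) (j : Env E G →ₐ[ℂ] C) (w : P') :
    rT C (pull p₀ L h) (connMap hφ j (L w)) = connMap hψ' j w := ext_ev fun q hq => by
  obtain rfl : ψ = fun q => φ (p₀ + L q) := funext hψ
  rw [evT_rT, evp_comp_pull, evT_connMap, evT_connMap]
  exact congrArg (fun y : E => j (iotaVec E G y)) (logDeriv_comp (E := E) (φ := φ)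
    (ι := fun q => p₀ + L q) (hφ _ (h q hq)) (L.hasFDerivAt.const_add p₀) w).symm

theorem GHolAt.comp_affine {p₀ : P} {L : P' →L[ℂ] P} {q : P'} (h : GHolAt E φ (p₀ + L q)) :
    GHolAt E (fun q => φ (p₀ + L q)) q :=
  GHolAt.comp (ι := fun q => p₀ + L q) h (contDiffAt_const.add L.contDiff.contDiffAt)

/-- Normally ordered Taylor expansions of the restriction of a group-valued function to an affine
slice. -/
theorem mapLin_groupShift_affine (p₀ : P) (L : P' →L[ℂ] P) {ψ : P' → G}
    (hψ : ∀ q, ψ q = φ (p₀ + L q)) {q : P'} (hq : p₀ + L q ∈ U) (w : J → P') {s : J → S}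
    (hs : ∀ i j, Commute (s i) (s j)) {Λ : Env E G ⊗[ℂ] S →ₗ[ℂ] C} {j : Env E G →ₐ[ℂ] C}
    {c : J → C} (h1 : Λ 1 = 1) (hj : ∀ a x, Λ (a ⊗ₜ 1 * x) = j a * Λ x)
    (hc : ∀ i x, Λ (x * 1 ⊗ₜ s i) = Λ x * c i) :
    mapLin Λ (groupShift ψ q w s).ser =
      evS C hq (expS (op (holDir U) (connMap hφ j) (fun i => L (w i)) c) 1) := by
  have h : ∀ q ∈ affPre U p₀ L, p₀ + L q ∈ U := fun q hq => hq
  have hψ' : ∀ q ∈ affPre U p₀ L, GHolAt E ψ q := fun q hq => by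
    obtain rfl : ψ = fun q => φ (p₀ + L q) := funext hψ
    exact (hφ _ hq).comp_affine
  rw [mapLin_groupShift hψ' (mem_affPre.mpr hq) w hs h1 hj hc]
  rw [evS_pull p₀ L h (fun _ => rfl) (rT_connMap hφ p₀ L h hψ hψ' j) (mem_affPre.mpr hq), map_one]

end GroupConnections

end VertexIRF

namespace VertexIRF

set_option linter.unusedSectionVars false

/-! ### Transports in several tensor factors, and inverses. -/

section Legs

open TopologicalSpace PowerSeries

variable {E : Type*} [NormedAddCommGroup E] [NormedSpace ℂ E] [CompleteSpace E]
  [FiniteDimensional ℂ E]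
  {G : Type*} [TopologicalSpace G] [ChartedSpace E G] [Group G] [LieGroup 𝓘(ℂ, E) ω G]
  {P P' : Type*} [NormedAddCommGroup P] [NormedSpace ℂ P]
  [NormedAddCommGroup P'] [NormedSpace ℂ P'] {C C' J K : Type*}
  [Ring C] [Algebra ℂ C] [Ring C'] [Algebra ℂ C'] [Fintype J] [Fintype K]
  {U : Opens P} {U' : Opens P'} {φ ψ : P → G} (hφ : ∀ p ∈ U, GHolAt E φ p)
  (hψ : ∀ p ∈ U, GHolAt E ψ p)

theorem commute_lT_of {j : C' →ₐ[ℂ] C} {x : Hol U ⊗[ℂ] C} (hx : ∀ a, Commute x (1 ⊗ₜ j a))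
    (t : Hol U ⊗[ℂ] C') : Commute x (lT (Hol U) j t) := by
  induction t with
  | zero => simp
  | add t t' ht ht' => rw [map_add]; exact ht.add_right ht'
  | tmul f a =>
    have h1 : lT (Hol U) j (f ⊗ₜ a) = f ⊗ₜ 1 * 1 ⊗ₜ j a := by simp
    have h2 : Commute x (f ⊗ₜ[ℂ] (1 : C)) :=
      (Algebra.commutes (R := Hol U) (A := Hol U ⊗[ℂ] C) f x).symm
    rw [h1]
    exact h2.mul_right (hx a)

/-- The stable class required by `expS_op_mul` is the centralizer of the image of `j₂`: the
connection in `j₁` and the coefficients both lie in it. -/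
theorem expS_op_connMap_add {j₁ j₂ : Env E G →ₐ[ℂ] C} (hj : ∀ a b, Commute (j₁ a) (j₂ b))
    {w : J → P} {c : J → C} (hc : ∀ i k, Commute (c i) (c k)) (hcj : ∀ i a, Commute (c i) (j₂ a))
    {p q : (Hol U ⊗[ℂ] C)⟦X⟧} (hp : ∀ n a, Commute (coeff n p) (1 ⊗ₜ j₂ a))
    (hq : ∀ n i, Commute (coeff n q) (1 ⊗ₜ c i)) :
    expS (op (holDir U) (connMap hφ j₁ + connMap hψ j₂) w c) (p * q) =
      expS (op (holDir U) (connMap hφ j₁) w c) p * expS (op (holDir U) (connMap hψ j₂) w c) q := by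
  refine expS_op_mul (Subalgebra.toSubmodule (Subalgebra.centralizer ℂ
    (Set.range fun a => (1 : Hol U) ⊗ₜ[ℂ] j₂ a))) ?_ ?_ ?_ hc ?_ hq
  · intro x hx
    have hx' : ∀ a, Commute x (1 ⊗ₜ j₂ a) := fun a => (hx _ ⟨a, rfl⟩).symm
    rintro _ ⟨a, rfl⟩
    exact (op_commute_coeff (hx' a) (fun i => hcj i a)
      fun i => connMap_commute hφ (fun b => hj b a) (w i)).symm.eq
  · intro x hx i
    exact commute_lT_of (fun a => (hx _ ⟨a, rfl⟩).symm) _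
  · intro i k
    exact connMap_commute hψ (fun a => (hcj k a).symm) (w i)
  · intro n
    rintro _ ⟨a, rfl⟩
    exact (hp n a).symm.eq

theorem coeff_one_commute {A : Type*} [Ring A] (n : ℕ) (a : A) : Commute (coeff n (1 : A⟦X⟧)) a := by
  rw [coeff_one]
  split_ifs
  · exact Commute.one_left a
  · exact Commute.zero_left a

/-- Transport for a sum of two commuting connections. -/
theorem evS_connMap_add {j₁ j₂ : Env E G →ₐ[ℂ] C} (hj : ∀ a b, Commute (j₁ a) (j₂ b))
    {w : J → P} {c : J → C} (hc : ∀ i k, Commute (c i) (c k)) (hcj : ∀ i a, Commute (c i) (j₂ a))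
    {p : P} (hp : p ∈ U) {q : (Hol U ⊗[ℂ] C)⟦X⟧} (hq : ∀ n i, Commute (coeff n q) (1 ⊗ₜ c i)) :
    evS C hp (expS (op (holDir U) (connMap hφ j₁ + connMap hψ j₂) w c) q) =
      evS C hp (expS (op (holDir U) (connMap hφ j₁) w c) 1) *
        evS C hp (expS (op (holDir U) (connMap hψ j₂) w c) q) := by
  have h := expS_op_connMap_add hφ hψ hj (w := w) hc hcj (p := 1)
    (fun n a => coeff_one_commute n _) hq
  rw [one_mul] at h
  rw [h, evS_mul]

/-- Transport for a connection, in terms of the trivial connection. -/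
theorem evS_expS_mul_zero {θ : P →ₗ[ℂ] Hol U ⊗[ℂ] C} {w : J → P} {c : J → C}
    (hc : ∀ i k, Commute (c i) (c k)) {p : P} (hp : p ∈ U) {q : (Hol U ⊗[ℂ] C)⟦X⟧}
    (hq : ∀ n i, Commute (coeff n q) (1 ⊗ₜ c i)) :
    evS C hp (expS (op (holDir U) θ w c) q) =
      evS C hp (expS (op (holDir U) θ w c) 1) * evS C hp (expS (op (holDir U) 0 w c) q) := by
  have h := expS_op_mul_zero (dd := holDir U) (θ := θ) (w := w) hc 1 hq
  rw [one_mul] at h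
  rw [h, evS_mul]

theorem evS_pull_one (p₀ : P) (L : P' →L[ℂ] P) (h : ∀ q ∈ U', p₀ + L q ∈ U)
    {θ : P →ₗ[ℂ] Hol U ⊗[ℂ] C} {θ' : P' →ₗ[ℂ] Hol U' ⊗[ℂ] C} {w : J → P'} {v : J → P} {c : J → C}
    (hv : ∀ j, v j = L (w j)) (hθ : ∀ w, rT C (pull p₀ L h) (θ (L w)) = θ' w)
    {q : P'} (hq : q ∈ U') {p : P} (hp : p ∈ U) (e : p = p₀ + L q) :
    evS C hp (expS (op (holDir U) θ v c) 1) = evS C hq (expS (op (holDir U') θ' w c) 1) := by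
  rw [evS_congr e hp (h q hq), evS_pull p₀ L h hv hθ hq, map_one]

/-- A connection only sees logarithmic derivatives. A left constant factor therefore drops out, and
a right constant factor is absorbed as an adjoint action in the change from `j` to `j'`. -/
theorem rT_connMap_of (p₀ : P) (L : P' →L[ℂ] P) (h : ∀ q ∈ U', p₀ + L q ∈ U) {χ : P' → G}
    (hχ : ∀ q ∈ U', GHolAt E χ q) {j j' : Env E G →ₐ[ℂ] C}
    (hlog : ∀ q ∈ U', ∀ w, j (iotaVec E G (logVec (fun q => φ (p₀ + L q)) q w)) =
      j' (iotaVec E G (logVec χ q w))) (w : P') :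
    rT C (pull p₀ L h) (connMap hφ j (L w)) = connMap hχ j' w := by
  rw [rT_connMap hφ p₀ L h (fun q => rfl) (fun q hq => (hφ _ (h q hq)).comp_affine)]
  exact connMap_congr _ _ fun q hq => hlog q hq w

theorem logVec_const_mul (γ : G) (φ : P → G) (q w : P) :
    logVec (E := E) (fun q => γ * φ q) q w = logVec (E := E) φ q w :=
  congrFun (congrFun (logDeriv_const_mul γ φ) q) w

theorem logVec_const (γ : G) (q w : P) : logVec (E := E) (fun _ => γ) q w = 0 :=
  logDeriv_const γ q w

theorem logVec_mul_const {q : P} (h : GHolAt E φ q) (γ : G) (w : P) :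
    logVec (E := E) (fun q => φ q * γ) q w = adVec E γ⁻¹ (logVec (E := E) φ q w) :=
  logDeriv_mul_const h γ w

theorem AdEnv_iotaVec (γ : G) (y : E) :
    AdEnv γ (iotaVec E G y) = iotaVec E G (adVec E γ y) := AdEnv_iota γ y

theorem GHolAt.comp_fst {p : P × P'} (h : GHolAt E φ p.1) : GHolAt E (fun z : P × P' => φ z.1) p :=
  GHolAt.comp (ι := Prod.fst) h contDiffAt_fst

theorem GHolAt.comp_snd {p : P' × P} (h : GHolAt E φ p.2) : GHolAt E (fun z : P' × P => φ z.2) p :=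
  GHolAt.comp (ι := Prod.snd) h contDiffAt_snd

theorem coeff_expS_commute {θ : P →ₗ[ℂ] Hol U ⊗[ℂ] C} {w : J → P} {c : J → C} {d : C}
    (hc : ∀ i, Commute (c i) d) (hθ : ∀ i, Commute (θ (w i)) (1 ⊗ₜ d))
    {q : (Hol U ⊗[ℂ] C)⟦X⟧} (hq : ∀ n, Commute (coeff n q) (1 ⊗ₜ d)) (n : ℕ) :
    Commute (coeff n (expS (op (holDir U) θ w c) q)) (1 ⊗ₜ d) := by
  refine (coeff_expS_mem (Subalgebra.toSubmodule (Subalgebra.centralizer ℂ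
    {(1 : Hol U) ⊗ₜ[ℂ] d})) ?_ ?_ n _ rfl).symm
  · rintro x hx _ rfl
    exact (op_commute_coeff (hx _ rfl).symm hc hθ).symm.eq
  · rintro n _ rfl
    exact (hq n).symm.eq

theorem commute_evS {p : P} (hp : p ∈ U) {d : C} {q : (Hol U ⊗[ℂ] C)⟦X⟧} {n : ℕ}
    (hq : Commute (coeff n q) (1 ⊗ₜ d)) : Commute (coeff n (evS C hp q)) d := by
  have h := hq.map (evT C (evp hp))
  rw [evT_tmul, map_one, one_smul] at h
  rwa [coeff_evS]

/-- The Taylor expansion of the inverse of a group-valued function. -/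
theorem evS_connMap_inv (hφi : ∀ p ∈ U, GHolAt E (fun q => (φ q)⁻¹) p) (j : Env E G →ₐ[ℂ] C)
    (w : J → P) {c : J → C}
    (hc : ∀ i k, Commute (c i) (c k)) (hjc : ∀ a i, Commute (j a) (c i)) {p : P} (hp : p ∈ U) :
    evS C hp (expS (op (holDir U) (connMap hφ (j.comp (AdEnv (φ p)))) w c) 1) *
      evS C hp (expS (op (holDir U) (connMap hφi j) w c) 1) = 1 := by
  let UU : Opens (P × P) := ⟨(U : Set P) ×ˢ (U : Set P), U.isOpen.prod U.isOpen⟩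
  -- The function `φ(z₁) φ(z₂)⁻¹` is constant on the diagonal, so its transport along the diagonal
  -- is `1`. By flatness this transport is also the product of those in the first and in the second
  -- variable.
  have hΦ : ∀ z ∈ UU, GHolAt E (fun z : P × P => φ z.1 * (φ z.2)⁻¹) z := fun z hz =>
    (hφ _ hz.1).comp_fst.mul (hφ _ hz.2).comp_snd.inv
  have hpp : (p, p) ∈ UU := ⟨hp, hp⟩
  have hY : ∀ t (ht : (p, p) + ContinuousLinearMap.inl ℂ P P t ∈ UU),
      evS C ht (expS (op (holDir UU) (connMap hΦ j) (fun i => ((0 : P), w i)) c) 1) =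
        evS C hp (expS (op (holDir U) (connMap hφi j) w c) 1) := by
    intro t ht
    have ht1 : p + t ∈ U := ht.1
    refine evS_pull_one (p + t, 0) (ContinuousLinearMap.inr ℂ P P) (fun q hq => ?_) (fun _ => rfl)
      (rT_connMap_of hΦ _ _ _ hφi fun q hq v => ?_) hp ht ?_
    · exact ⟨by simpa using ht1, by simpa using hq⟩
    · congr 2
      rw [← logVec_const_mul (φ (p + t)) (fun q => (φ q)⁻¹)]
      simp
    · simp
  have h := evS_expS_add_of_const (isFlat_connMap hΦ j) (ContinuousLinearMap.inl ℂ P P)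
    (w := w) hc hc hpp hY (fun n i => commute_evS hp
      (coeff_expS_commute (fun k => hc k i) (fun k => connMap_commute hφi (fun a => hjc a i) _)
        (fun n => coeff_one_commute n _) n))
  -- In the first variable the function is `φ(z₁) φ(p)⁻¹`, whose logarithmic derivative is that of
  -- `φ` conjugated by `φ(p)`. This is where `AdEnv (φ p)` comes from.
  have h1 : evS C hpp (expS (op (holDir UU) (connMap hΦ j)
      (fun i => ContinuousLinearMap.inl ℂ P P (w i)) c) 1) =
      evS C hp (expS (op (holDir U) (connMap hφ (j.comp (AdEnv (φ p)))) w c) 1) := by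
    refine evS_pull_one (0, p) (ContinuousLinearMap.inl ℂ P P) (fun q hq => ?_) (fun _ => rfl)
      (rT_connMap_of hΦ _ _ _ hφ fun q hq v => ?_) hp hpp ?_
    · exact ⟨by simpa using hq, by simpa using hp⟩
    · rw [AlgHom.comp_apply, AdEnv_iotaVec]
      congr 2
      have e : (fun q => φ ((0, p) + ContinuousLinearMap.inl ℂ P P q).1 *
        (φ ((0, p) + ContinuousLinearMap.inl ℂ P P q).2)⁻¹) = fun q => φ q * (φ p)⁻¹ := by
        funext q
        simp
      rw [e, logVec_mul_const (hφ q hq), inv_inv]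
    · simp
  rw [h1, ← op_add_dir] at h
  rw [← h]
  have h2 : ∀ q ∈ U, (0 : P × P) + (ContinuousLinearMap.id ℂ P).prod (ContinuousLinearMap.id ℂ P) q
      ∈ UU := fun q hq => by
    rw [zero_add]
    exact ⟨hq, hq⟩
  rw [evS_pull_one (θ' := 0) 0 ((ContinuousLinearMap.id ℂ P).prod (ContinuousLinearMap.id ℂ P)) h2
    (w := w) (fun i => by simp) (fun v => ?_) hp hpp (by simp)]
  · rw [expS_of_forall_eq_zero, evS_one]
    intro n
    rw [coeff_one]
    split_ifs
    · simp only [op_apply, dT_one, LinearMap.zero_apply, zero_mul, add_zero, Finset.sum_const_zero]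
    · rw [map_zero]
  · rw [rT_connMap_of hΦ 0 _ h2 (χ := fun _ => 1) (fun q _ => GHolAt.const 1 q) (j' := j)
      fun q hq v => ?_]
    · refine ext_ev fun q hq => ?_
      rw [evT_connMap, logVec_const, map_zero, map_zero, LinearMap.zero_apply, map_zero]
    · congr 3
      funext q
      simp

end Legs

end VertexIRF

namespace VertexIRF

set_option linter.unusedSectionVars false

/-! ### The dynamical twist equation. -/

section Twist

open TopologicalSpace PowerSeries

/-- The maps between the tensor powers of a coalgebra that enter the dynamical twist equation. -/
structure CoalgLegs (A A₂ A₃ : Type*) [Ring A] [Algebra ℂ A] [Ring A₂] [Algebra ℂ A₂] [Ring A₃]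
    [Algebra ℂ A₃] where
  /-- `a ↦ a ⊗ 1` -/
  i₁ : A →ₐ[ℂ] A₂
  /-- `a ↦ 1 ⊗ a` -/
  i₂ : A →ₐ[ℂ] A₂
  /-- the coproduct -/
  Δ : A →ₐ[ℂ] A₂
  /-- `Δ ⊗ id` -/
  D₁₂ : A₂ →ₐ[ℂ] A₃
  /-- `id ⊗ Δ` -/
  D₂₃ : A₂ →ₐ[ℂ] A₃
  /-- `c ↦ c ⊗ 1` -/
  k₁₂ : A₂ →ₐ[ℂ] A₃
  /-- `c ↦ 1 ⊗ c` -/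
  k₂₃ : A₂ →ₐ[ℂ] A₃
  i_comm : ∀ a b, Commute (i₁ a) (i₂ b)
  k_comm₁₂ : ∀ c a, Commute (k₁₂ c) (k₂₃ (i₂ a))
  k_comm₂₃ : ∀ a c, Commute (k₁₂ (i₁ a)) (k₂₃ c)
  k_i : ∀ a, k₁₂ (i₂ a) = k₂₃ (i₁ a)
  D₁₂_i₁ : ∀ a, D₁₂ (i₁ a) = k₁₂ (Δ a)
  D₁₂_i₂ : ∀ a, D₁₂ (i₂ a) = k₂₃ (i₂ a)
  D₂₃_i₁ : ∀ a, D₂₃ (i₁ a) = k₁₂ (i₁ a)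
  D₂₃_i₂ : ∀ a, D₂₃ (i₂ a) = k₂₃ (Δ a)
  coassoc : ∀ a, D₁₂ (Δ a) = D₂₃ (Δ a)

variable {E : Type*} [NormedAddCommGroup E] [NormedSpace ℂ E] [CompleteSpace E]
  [FiniteDimensional ℂ E]
  {G : Type*} [TopologicalSpace G] [ChartedSpace E G] [Group G] [LieGroup 𝓘(ℂ, E) ω G]
  {P : Type*} [NormedAddCommGroup P] [NormedSpace ℂ P] {A₂ A₃ J : Type*}
  [Ring A₂] [Algebra ℂ A₂] [Ring A₃] [Algebra ℂ A₃] [Fintype J]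
  (𝓛 : CoalgLegs (Env E G) A₂ A₃)
  {U : Opens P} {φ : P → G} (hφ : ∀ p ∈ U, GHolAt E φ p)
  (d₁ d₂ : J → P) (h : J → Env E G)

/-- The normally ordered Taylor expansion along the directions `d₁`, as a series of functions. -/
def serX : (Hol U ⊗[ℂ] Env E G)⟦X⟧ := expS (op (holDir U) (connMap (C := Env E G) hφ (AlgHom.id ℂ (Env E G))) d₁ h) 1

variable (i₁ i₂ : Env E G →ₐ[ℂ] A₂)

/-- The transport along the directions `d₁` and `d₂`, as a series of functions. -/
def serM : (Hol U ⊗[ℂ] A₂)⟦X⟧ :=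
  expS (op (holDir U) (connMap hφ i₁) d₁ (fun j => i₁ (h j)) +
    op (holDir U) (connMap hφ i₁) d₂ (fun j => i₂ (h j))) 1

variable {h} (hh : ∀ i j, Commute (h i) (h j))

theorem map_serX {C : Type*} [Ring C] [Algebra ℂ C] (f : Env E G →ₐ[ℂ] C) :
    PowerSeries.map (lT (Hol U) f).toRingHom (serX hφ d₁ h) =
      expS (op (holDir U) (connMap hφ f) d₁ (fun j => f (h j))) 1 := by
  rw [serX, map_expS (fun x => lT_op (θ' := connMap hφ f) (c' := fun j => f (h j)) (fun _ => rfl)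
    (fun j => by rw [lT_connMap, AlgHom.comp_id]) x), map_one]

theorem evS_map {C C' : Type*} [Ring C] [Algebra ℂ C] [Ring C'] [Algebra ℂ C'] (f : C →ₐ[ℂ] C')
    {p : P} (hp : p ∈ U) (F : (Hol U ⊗[ℂ] C)⟦X⟧) :
    evS C' hp (PowerSeries.map (lT (Hol U) f).toRingHom F) =
      PowerSeries.map f.toRingHom (evS C hp F) := by
  ext n
  rw [coeff_evS, PowerSeries.coeff_map, PowerSeries.coeff_map, coeff_evS]
  exact evT_lT (evp hp) f _

theorem map_map_lT {C C' C'' : Type*} [Ring C] [Algebra ℂ C] [Ring C'] [Algebra ℂ C'] [Ring C'']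
    [Algebra ℂ C''] {f : C →ₐ[ℂ] C'} {f' : C' →ₐ[ℂ] C''} {f'' : C →ₐ[ℂ] C''}
    (hf : ∀ c, f' (f c) = f'' c) (F : (Hol U ⊗[ℂ] C)⟦X⟧) :
    PowerSeries.map (lT (Hol U) f').toRingHom (PowerSeries.map (lT (Hol U) f).toRingHom F) =
      PowerSeries.map (lT (Hol U) f'').toRingHom F := by
  ext n
  simp only [PowerSeries.coeff_map]
  apply ext_ev
  intro p hp
  refine (evT_lT (evp hp) f' _).trans ?_
  refine Eq.trans ?_ (evT_lT (evp hp) f'' _).symm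
  rw [← hf]
  exact congrArg f' (evT_lT (evp hp) f _)

theorem coeff_map_lT_commute {C C' : Type*} [Ring C] [Algebra ℂ C] [Ring C'] [Algebra ℂ C']
    {f : C →ₐ[ℂ] C'} {c : C'} (hf : ∀ a, Commute (f a) c) (F : (Hol U ⊗[ℂ] C)⟦X⟧) (n : ℕ) :
    Commute (coeff n (PowerSeries.map (lT (Hol U) f).toRingHom F)) (1 ⊗ₜ c) := by
  rw [PowerSeries.coeff_map]
  exact lT_commute_tmul hf _

theorem commute_of_coeff {A : Type*} [Ring A] {p q : A⟦X⟧}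
    (h : ∀ n m, Commute (coeff n p) (coeff m q)) : Commute p q := by
  ext n
  rw [coeff_mul, coeff_mul, ← Finset.Nat.sum_antidiagonal_swap]
  exact Finset.sum_congr rfl fun m _ => (h _ _).eq

theorem coeff_expS_one_commute {C : Type*} [Ring C] [Algebra ℂ C]
    {T : Module.End ℂ (Hol U ⊗[ℂ] C)} {d : C}
    (hT : ∀ x, Commute x (1 ⊗ₜ d) → Commute (T x) (1 ⊗ₜ d)) (n : ℕ) :
    Commute (coeff n (expS T 1)) (1 ⊗ₜ d) := by
  refine (coeff_expS_mem (Subalgebra.toSubmodule (Subalgebra.centralizer ℂ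
    {(1 : Hol U) ⊗ₜ[ℂ] d})) ?_ ?_ n _ rfl).symm
  · rintro x hx _ rfl
    exact (hT x (hx _ rfl).symm).symm.eq
  · rintro n _ rfl
    exact (coeff_one_commute n _).symm.eq

include hh in
theorem serM_eq (hi : ∀ a b, Commute (i₁ a) (i₂ b)) :
    serM hφ d₁ d₂ h i₁ i₂ = expS (op (holDir U) (connMap hφ i₁) d₂ (fun j => i₂ (h j)))
      (PowerSeries.map (lT (Hol U) i₁).toRingHom (serX hφ d₁ h)) := by
  rw [map_serX, serM, add_comm,
    expS_comp (op_commute (isFlat_connMap hφ i₁) fun j k => (hi _ _).symm)]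

variable (hΔ : ∀ y, 𝓛.Δ (iotaVec E G y) = 𝓛.i₁ (iotaVec E G y) + 𝓛.i₂ (iotaVec E G y))
  (hΔh : ∀ j, 𝓛.Δ (h j) = 𝓛.i₁ (h j) + 𝓛.i₂ (h j))

include hh hΔ hΔh in
/-- The dynamical twist equation. -/
theorem twist_of_eq {p : P} (hp : p ∈ U) {𝒥 : (Hol U ⊗[ℂ] A₂)⟦X⟧}
    (h𝒥 : PowerSeries.map (lT (Hol U) 𝓛.Δ).toRingHom (serX hφ d₁ h) * 𝒥 =
      PowerSeries.map (lT (Hol U) 𝓛.i₂).toRingHom (serX hφ d₁ h) * serM hφ d₁ d₂ h 𝓛.i₁ 𝓛.i₂)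
    (hcomm : ∀ n j, Commute (coeff n (evS A₂ hp 𝒥)) (𝓛.Δ (h j)))
    (hX : IsUnit (evS (Env E G) hp (serX hφ d₁ h))) :
    PowerSeries.map 𝓛.D₁₂.toRingHom (evS A₂ hp 𝒥) *
        evS A₃ hp (expS (op (holDir U) 0 d₂ fun j => 𝓛.k₂₃ (𝓛.i₂ (h j)))
          (PowerSeries.map (lT (Hol U) 𝓛.k₁₂).toRingHom 𝒥)) =
      PowerSeries.map 𝓛.D₂₃.toRingHom (evS A₂ hp 𝒥) *
        PowerSeries.map 𝓛.k₂₃.toRingHom (evS A₂ hp 𝒥) := by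
  set X := evS (Env E G) hp (serX hφ d₁ h) with hXdef
  set M := evS A₂ hp (serM hφ d₁ d₂ h 𝓛.i₁ 𝓛.i₂) with hM
  set Jp := evS A₂ hp 𝒥 with hJp
  let c : J → A₃ := fun j => 𝓛.k₂₃ (𝓛.i₂ (h j))
  let l₁ : Env E G →ₐ[ℂ] A₃ := 𝓛.k₁₂.comp 𝓛.i₁
  let l₂ : Env E G →ₐ[ℂ] A₃ := 𝓛.k₂₃.comp 𝓛.i₁
  let l₃ : Env E G →ₐ[ℂ] A₃ := 𝓛.k₂₃.comp 𝓛.i₂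
  have hc : ∀ i j, Commute (c i) (c j) := fun i j => ((hh i j).map 𝓛.i₂).map 𝓛.k₂₃
  have hkc : ∀ a j, Commute (𝓛.k₁₂ a) (c j) := fun a j => 𝓛.k_comm₁₂ a (h j)
  have hl₂c : ∀ a j, Commute (l₂ a) (c j) := fun a j => (𝓛.i_comm a (h j)).map 𝓛.k₂₃
  have hl₁₂ : ∀ a b, Commute (l₁ a) (l₂ b) := fun a b => 𝓛.k_comm₂₃ a _
  -- `E0` is the ordinary shift by `h⁽³⁾` along `d₂`; `ζ₁` and `ζ₂` are the transports of `φ` in the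
  -- first and the second factor along the same shift.
  let E0 : (Hol U ⊗[ℂ] A₃)⟦X⟧ → A₃⟦X⟧ := fun F => evS A₃ hp (expS (op (holDir U) 0 d₂ c) F)
  let ζ₁ := evS A₃ hp (expS (op (holDir U) (connMap hφ l₁) d₂ c) 1)
  let ζ₂ := evS A₃ hp (expS (op (holDir U) (connMap hφ l₂) d₂ c) 1)
  have hE0 : ∀ (f f' : (Hol U ⊗[ℂ] A₂)⟦X⟧),
      E0 (PowerSeries.map (lT (Hol U) 𝓛.k₁₂).toRingHom (f * f')) =
        E0 (PowerSeries.map (lT (Hol U) 𝓛.k₁₂).toRingHom f) *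
          E0 (PowerSeries.map (lT (Hol U) 𝓛.k₁₂).toRingHom f') := fun f f' => by
    change evS A₃ hp _ = _
    rw [map_mul, expS_op_mul_zero hc _
      (fun n j => coeff_map_lT_commute (fun a => hkc a j) f' n), evS_mul]
  have hJX : PowerSeries.map 𝓛.Δ.toRingHom X * Jp = PowerSeries.map 𝓛.i₂.toRingHom X * M := by
    have := congrArg (evS A₂ hp) h𝒥
    rwa [evS_mul, evS_mul, evS_map, evS_map] at this
  have hmm : ∀ {f : Env E G →ₐ[ℂ] A₂} {f' : A₂ →ₐ[ℂ] A₃} {g : Env E G →ₐ[ℂ] A₂}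
      {g' : A₂ →ₐ[ℂ] A₃} (_ : ∀ a, f' (f a) = g' (g a)) (Y : (Env E G)⟦X⟧),
      PowerSeries.map f'.toRingHom (PowerSeries.map f.toRingHom Y) =
        PowerSeries.map g'.toRingHom (PowerSeries.map g.toRingHom Y) := by
    intro f f' g g' e Y
    ext n
    simp only [PowerSeries.coeff_map]
    exact e _
  -- the four factors
  have hDM : PowerSeries.map 𝓛.D₁₂.toRingHom M = ζ₁ * ζ₂ * E0 (PowerSeries.map
      (lT (Hol U) (𝓛.k₁₂.comp 𝓛.Δ)).toRingHom (serX hφ d₁ h)) := by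
    have e1 : connMap hφ (𝓛.D₁₂.comp 𝓛.i₁) = connMap hφ l₁ + connMap hφ l₂ :=
      connMap_add hφ fun y => by
        change 𝓛.D₁₂ (𝓛.i₁ _) = 𝓛.k₁₂ (𝓛.i₁ _) + 𝓛.k₂₃ (𝓛.i₁ _)
        rw [𝓛.D₁₂_i₁, hΔ, map_add, 𝓛.k_i]
    rw [hM, serM_eq hφ d₁ d₂ 𝓛.i₁ 𝓛.i₂ hh 𝓛.i_comm,
      evS_expS_map 𝓛.D₁₂ (c' := c) (fun j => 𝓛.D₁₂_i₂ (h j))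
        (θ' := connMap hφ l₁ + connMap hφ l₂) (fun w => by rw [lT_connMap, e1]),
      map_map_lT (f'' := 𝓛.k₁₂.comp 𝓛.Δ) (fun a => 𝓛.D₁₂_i₁ a), evS_expS_mul_zero hc hp
        (fun n j => coeff_map_lT_commute (f := 𝓛.k₁₂.comp 𝓛.Δ) (fun a => hkc (𝓛.Δ a) j) _ n),
      evS_connMap_add hφ hφ hl₁₂ hc (fun i a => (hl₂c a i).symm) hp
        (fun n j => coeff_one_commute n _)]
  -- The relation `Δ(X) 𝒥 = X² M` in the first two factors, shifted by `h⁽³⁾`.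
  have hE0J : E0 (PowerSeries.map (lT (Hol U) (𝓛.k₁₂.comp 𝓛.Δ)).toRingHom (serX hφ d₁ h)) *
      E0 (PowerSeries.map (lT (Hol U) 𝓛.k₁₂).toRingHom 𝒥) =
      E0 (PowerSeries.map (lT (Hol U) l₂).toRingHom (serX hφ d₁ h)) *
        E0 (PowerSeries.map (lT (Hol U) 𝓛.k₁₂).toRingHom (serM hφ d₁ d₂ h 𝓛.i₁ 𝓛.i₂)) := by
    rw [← map_map_lT (f := 𝓛.Δ) (f' := 𝓛.k₁₂) (fun _ => rfl), ← hE0, h𝒥, hE0,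
      map_map_lT (f'' := l₂) (fun a => 𝓛.k_i a)]
  have hkM : PowerSeries.map 𝓛.k₂₃.toRingHom M =
      evS A₃ hp (expS (op (holDir U) (connMap hφ l₂) d₂ c)
        (PowerSeries.map (lT (Hol U) l₂).toRingHom (serX hφ d₁ h))) := by
    rw [hM, serM_eq hφ d₁ d₂ 𝓛.i₁ 𝓛.i₂ hh 𝓛.i_comm,
      evS_expS_map 𝓛.k₂₃ (c' := c) (fun j => rfl) (θ' := connMap hφ l₂)
        (fun w => by rw [lT_connMap]), map_map_lT (f'' := l₂) (fun a => rfl)]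
  have hl₂X : ∀ n j, Commute (coeff n (PowerSeries.map (lT (Hol U) l₂).toRingHom (serX hφ d₁ h)))
      (1 ⊗ₜ c j) := fun n j => coeff_map_lT_commute (fun a => hl₂c a j) _ n
  have hkM' : PowerSeries.map 𝓛.k₂₃.toRingHom M =
      ζ₂ * E0 (PowerSeries.map (lT (Hol U) l₂).toRingHom (serX hφ d₁ h)) := by
    rw [hkM, evS_expS_mul_zero hc hp hl₂X]
  -- The two factors share the variables `h⁽³⁾`. Exponentiating the sum of the connections in the
  -- first and the second factor, and splitting it off in either order, gives the two products.
  have hζ : PowerSeries.map 𝓛.k₂₃.toRingHom M * ζ₁ = ζ₁ * PowerSeries.map 𝓛.k₂₃.toRingHom M := by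
    have e1 := expS_op_connMap_add hφ hφ hl₁₂ (w := d₂) hc (fun i a => (hl₂c a i).symm) (p := 1)
      (fun n a => coeff_one_commute n _) hl₂X
    have e2 := expS_op_connMap_add hφ hφ (fun a b => (hl₁₂ b a).symm) (w := d₂) hc
      (fun i a => (hkc _ i).symm) (p := PowerSeries.map (lT (Hol U) l₂).toRingHom (serX hφ d₁ h))
      (q := 1) (fun n a => coeff_map_lT_commute (fun b => (hl₁₂ a b).symm) _ n)
      (fun n j => coeff_one_commute n _)
    rw [one_mul] at e1
    rw [mul_one, add_comm] at e2
    have e3 := congrArg (evS A₃ hp) (e2.symm.trans e1)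
    rw [evS_mul, evS_mul, ← hkM] at e3
    exact e3
  have hDser : PowerSeries.map (lT (Hol U) 𝓛.D₂₃).toRingHom (serM hφ d₁ d₂ h 𝓛.i₁ 𝓛.i₂) =
      expS (op (holDir U) (connMap hφ l₁) d₁ (fun j => l₁ (h j)) +
        op (holDir U) (connMap hφ l₁) d₂ (fun j => l₂ (h j) + c j)) 1 := by
    rw [serM, map_expS (T' := op (holDir U) (connMap hφ l₁) d₁ (fun j => l₁ (h j)) +
        op (holDir U) (connMap hφ l₁) d₂ (fun j => l₂ (h j) + c j)) (fun x => ?_), map_one]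
    rw [LinearMap.add_apply, LinearMap.add_apply, map_add]
    refine congrArg₂ (· + ·) (lT_op (fun j => 𝓛.D₂₃_i₁ (h j)) (fun j => ?_) x)
      (lT_op (fun j => ?_) (fun j => ?_) x)
    · rw [lT_connMap]
      exact connMap_congr _ _ fun p _ => 𝓛.D₂₃_i₁ _
    · rw [𝓛.D₂₃_i₂, hΔh, map_add]
      rfl
    · rw [lT_connMap]
      exact connMap_congr _ _ fun p _ => 𝓛.D₂₃_i₁ _
  -- Applying `id ⊗ Δ` replaces `h⁽²⁾` by `h⁽²⁾ + h⁽³⁾`. Flatness lets the part with `h⁽³⁾` be split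
  -- off.
  have hD₂₃M : PowerSeries.map 𝓛.D₂₃.toRingHom M = ζ₁ * E0 (PowerSeries.map
      (lT (Hol U) 𝓛.k₁₂).toRingHom (serM hφ d₁ d₂ h 𝓛.i₁ 𝓛.i₂)) := by
    have e2 : PowerSeries.map (lT (Hol U) 𝓛.k₁₂).toRingHom (serM hφ d₁ d₂ h 𝓛.i₁ 𝓛.i₂) =
        expS (op (holDir U) (connMap hφ l₁) d₁ (fun j => l₁ (h j)) +
          op (holDir U) (connMap hφ l₁) d₂ (fun j => l₂ (h j))) 1 := by
      rw [serM, map_expS (T' := op (holDir U) (connMap hφ l₁) d₁ (fun j => l₁ (h j)) +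
          op (holDir U) (connMap hφ l₁) d₂ (fun j => l₂ (h j))) (fun x => ?_), map_one]
      rw [LinearMap.add_apply, LinearMap.add_apply, map_add]
      exact congrArg₂ (· + ·) (lT_op (fun j => rfl) (fun j => lT_connMap hφ _ _ _) x)
        (lT_op (fun j => 𝓛.k_i (h j)) (fun j => lT_connMap hφ _ _ _) x)
    have hf := isFlat_connMap hφ l₁
    have hT := (op_commute hf (w := d₂) (w' := d₁) (c := c) (c' := fun j => l₁ (h j))
      fun j k => (hkc _ j).symm).add_right
        (op_commute hf (w := d₂) (w' := d₂) (c' := fun j => l₂ (h j)) fun j k => (hl₂c _ j).symm)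
    rw [hM, ← evS_map, hDser, op_add_coeff, ← add_assoc, add_comm, expS_comp hT, ← e2,
      evS_expS_mul_zero hc hp (fun n j => coeff_map_lT_commute (fun a => hkc a j) _ n)]
  -- Here the zero weight of `𝒥` enters: in the second and third factors `D₂₃ M` involves only
  -- `Δ(h)`.
  have hcJ : Commute (PowerSeries.map 𝓛.D₂₃.toRingHom M) (PowerSeries.map 𝓛.k₂₃.toRingHom Jp) := by
    refine commute_of_coeff fun n m => ?_
    rw [hM, ← evS_map, hDser, PowerSeries.coeff_map]
    refine commute_evS hp (coeff_expS_one_commute (fun x hx => ?_) n)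
    have hl : ∀ a, Commute (l₁ a) (𝓛.k₂₃ (coeff m Jp)) := fun a => 𝓛.k_comm₂₃ a _
    rw [LinearMap.add_apply]
    refine (op_commute_coeff hx (fun i => hl _) fun i => connMap_commute hφ hl _).add_left
      (op_commute_coeff hx (fun i => ?_) fun i => connMap_commute hφ hl _)
    change Commute (𝓛.k₂₃ (𝓛.i₁ (h i)) + 𝓛.k₂₃ (𝓛.i₂ (h i))) _
    rw [← map_add, ← hΔh]
    exact (hcomm m i).symm.map 𝓛.k₂₃
  have hU : IsUnit (PowerSeries.map 𝓛.D₁₂.toRingHom (PowerSeries.map 𝓛.Δ.toRingHom X)) :=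
    (hX.map _).map _
  have hL : PowerSeries.map 𝓛.D₁₂.toRingHom (PowerSeries.map 𝓛.Δ.toRingHom X) *
      PowerSeries.map 𝓛.D₁₂.toRingHom Jp = PowerSeries.map 𝓛.k₂₃.toRingHom
        (PowerSeries.map 𝓛.i₂.toRingHom X) * PowerSeries.map 𝓛.D₁₂.toRingHom M := by
    rw [← map_mul, hJX, map_mul]
    congr 1
    exact hmm (fun a => 𝓛.D₁₂_i₂ a) X
  have hR : PowerSeries.map 𝓛.D₁₂.toRingHom (PowerSeries.map 𝓛.Δ.toRingHom X) *
      PowerSeries.map 𝓛.D₂₃.toRingHom Jp = PowerSeries.map 𝓛.k₂₃.toRingHom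
        (PowerSeries.map 𝓛.Δ.toRingHom X) * PowerSeries.map 𝓛.D₂₃.toRingHom M := by
    rw [hmm 𝓛.coassoc, ← map_mul, hJX, map_mul]
    congr 1
    exact hmm (fun a => 𝓛.D₂₃_i₂ a) X
  -- After multiplication by the unit `(Δ ⊗ id)Δ(X)` the left side becomes `X³ ζ₁ ζ₂ E0(l₂X)
  -- E0(k₁₂M)` and the right side `X³ (k₂₃M) ζ₁ E0(k₁₂M)`, where `X³ = k₂₃(i₂X)`. They agree because
  -- `k₂₃M = ζ₂ E0(l₂X)` commutes with `ζ₁`.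
  refine hU.mul_left_cancel ?_
  rw [← mul_assoc, hL, ← mul_assoc, hR, mul_assoc _ _ (PowerSeries.map 𝓛.k₂₃.toRingHom Jp), hcJ.eq,
    ← mul_assoc, ← map_mul, hJX, hDM, map_mul, hD₂₃M]
  change _ * _ * E0 (PowerSeries.map (lT (Hol U) 𝓛.k₁₂).toRingHom 𝒥) = _
  rw [mul_assoc, mul_assoc (ζ₁ * ζ₂), hE0J,
    mul_assoc (PowerSeries.map 𝓛.k₂₃.toRingHom (PowerSeries.map 𝓛.i₂.toRingHom X))
      (PowerSeries.map 𝓛.k₂₃.toRingHom M), ← mul_assoc (PowerSeries.map 𝓛.k₂₃.toRingHom M) ζ₁, hζ, hkM']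
  simp only [mul_assoc]

end Twist

end VertexIRF

namespace VertexIRF

set_option linter.unusedSectionVars false

/-! ### Taylor series of restrictions to affine slices. -/

section Affine

open TopologicalSpace PowerSeries

variable {P P' : Type*} [NormedAddCommGroup P] [NormedSpace ℂ P]
  [NormedAddCommGroup P'] [NormedSpace ℂ P'] {B S J : Type*} [Ring B] [Algebra ℂ B]
  [Ring S] [Algebra ℂ S] [Fintype J] {U : Opens P} {V : Opens P'}

theorem rT_lT {C C' O O' : Type*} [Ring C] [Algebra ℂ C] [Ring C'] [Algebra ℂ C'] [CommRing O]
    [Algebra ℂ O] [CommRing O'] [Algebra ℂ O'] (f : C →ₐ[ℂ] C') (ψ : O →ₐ[ℂ] O')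
    (t : O ⊗[ℂ] C) : rT C' ψ (lT O f t) = lT O' f (rT C ψ t) := by
  induction t with
  | zero => simp
  | tmul a c => simp
  | add x y hx hy => simp only [map_add, hx, hy]

theorem evS_affine {p₀ : P} {L : P' →L[ℂ] P} {ι : P' → P} (hι : ∀ q, ι q = p₀ + L q)
    (h : ∀ q ∈ V, p₀ + L q ∈ U) (F : (Hol U ⊗[ℂ] B)⟦X⟧) {q : P'} (hq : q ∈ V) (hq' : ι q ∈ U) :
    evS B hq' F = evS B hq (PowerSeries.map (rT B (pull p₀ L h)).toRingHom F) := by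
  obtain rfl : ι = fun q => p₀ + L q := funext hι
  ext n
  rw [coeff_evS, coeff_evS, PowerSeries.coeff_map]
  exact (evT_rT (evp hq) (pull p₀ L h) _).symm

/-- Taylor expansions of the restriction of a function to an affine slice. -/
theorem shiftSeries_affine {p₀ : P} {L : P' →L[ℂ] P} {ι : P' → P} (hι : ∀ q, ι q = p₀ + L q)
    (h : ∀ q ∈ V, ι q ∈ U) {F : P' → B⟦X⟧} {t : (Hol U ⊗[ℂ] B)⟦X⟧}
    (hF : ∀ q (hq : q ∈ V), F q = evS B (h q hq) t) {p : P'} (hp : p ∈ V) (w : J → P')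
    (s : J → S) :
    shiftSeries F p w s = evS (B ⊗[ℂ] S) (h p hp)
      (expS (op (holDir U) 0 (fun j => L (w j)) fun j => (1 : B) ⊗ₜ[ℂ] s j)
        (PowerSeries.map (lT (Hol U) Algebra.TensorProduct.includeLeft).toRingHom t)) := by
  have h' : ∀ q ∈ V, p₀ + L q ∈ U := fun q hq => hι q ▸ h q hq
  rw [shiftSeries_of_evS (U := V) (t := PowerSeries.map (rT B (pull p₀ L h')).toRingHom t)
    (fun q hq => by rw [hF q hq, evS_affine hι h' t hq]) hp]
  rw [evS_congr (hι p) (h p hp) (h' p hp), evS_pull p₀ L h' (θ' := 0) (w := w) (fun _ => rfl)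
    (fun w => by rw [LinearMap.zero_apply, map_zero]; rfl) hp]
  congr 2
  ext n
  simp only [PowerSeries.coeff_map]
  exact (rT_lT _ _ _).symm

theorem holSeriesOn_affine {p₀ : P} {L : P' →L[ℂ] P} {ι : P' → P} (hι : ∀ q, ι q = p₀ + L q)
    (h : ∀ q ∈ V, ι q ∈ U) {F : P' → B⟦X⟧} {t : (Hol U ⊗[ℂ] B)⟦X⟧}
    (hF : ∀ q (hq : q ∈ V), F q = evS B (h q hq) t) : HolSeriesOn F (V : Set P') := by
  have h' : ∀ q ∈ V, p₀ + L q ∈ U := fun q hq => hι q ▸ h q hq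
  exact holSeriesOn_of_evS (t := PowerSeries.map (rT B (pull p₀ L h')).toRingHom t)
    fun q hq => by rw [hF q hq, evS_affine hι h' t hq]

end Affine

/-! ### Series with constant term one. -/

section OnePlusSeries

open PowerSeries

variable {A B : Type*} [Ring A] [Ring B]

theorem OnePlus.ser_mul (u v : OnePlus A) : (u * v).ser = u.ser * v.ser := rfl

theorem OnePlus.ser_one : (1 : OnePlus A).ser = 1 := rfl

theorem OnePlus.ser_mul_inv (u : OnePlus A) : u.ser * (u⁻¹).ser = 1 := by
  rw [← OnePlus.ser_mul, mul_inv_cancel, OnePlus.ser_one]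

theorem OnePlus.ser_inv_mul (u : OnePlus A) : (u⁻¹).ser * u.ser = 1 := by
  rw [← OnePlus.ser_mul, inv_mul_cancel, OnePlus.ser_one]

theorem OnePlus.ser_map (f : A →+* B) (u : OnePlus A) :
    (OnePlus.map f u).ser = PowerSeries.map f u.ser := rfl

theorem OnePlus.isUnit_ser (u : OnePlus A) : IsUnit u.ser := (u : (A⟦X⟧)ˣ).isUnit

theorem OnePlus.ser_inv_eq {u : OnePlus A} {p : A⟦X⟧} (h : u.ser * p = 1) : (u⁻¹).ser = p := by
  rw [← mul_one (u⁻¹).ser, ← h, ← mul_assoc, OnePlus.ser_inv_mul, one_mul]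

end OnePlusSeries

/-! ### The tensor powers of the enveloping algebra. -/

section EnvLegs

variable {E : Type*} [NormedAddCommGroup E] [NormedSpace ℂ E] [CompleteSpace E]
  [FiniteDimensional ℂ E]
  {G : Type*} [TopologicalSpace G] [ChartedSpace E G] [Group G] [LieGroup 𝓘(ℂ, E) ω G]

open Algebra.TensorProduct

attribute [local instance 100] LieRing.ofAssociativeRing

theorem env_hom_ext {C : Type*} [Ring C] [Algebra ℂ C] {f f' : Env E G →ₐ[ℂ] C}
    (h : ∀ y, f (iotaVec E G y) = f' (iotaVec E G y)) : f = f' := by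
  apply UniversalEnvelopingAlgebra.hom_ext
  ext y
  exact h y

theorem comul_iotaVec (y : E) : comul (LieAlg E G) (iotaVec E G y) =
    iotaVec E G y ⊗ₜ[ℂ] 1 + 1 ⊗ₜ[ℂ] iotaVec E G y := comul_iota (LieAlg E G) y

theorem counit_iotaVec (y : E) : counit (LieAlg E G) (iotaVec E G y) = 0 :=
  UniversalEnvelopingAlgebra.lift_ι_apply ℂ (0 : LieAlg E G →ₗ⁅ℂ⁆ ℂ) y

variable (E G) in
/-- The tensor powers of the Hopf algebra `U(𝔤)`. -/
def envLegs : CoalgLegs (Env E G) (Env E G ⊗[ℂ] Env E G) ((Env E G ⊗[ℂ] Env E G) ⊗[ℂ] Env E G) where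
  i₁ := includeLeft
  i₂ := includeRight
  Δ := comul (LieAlg E G)
  D₁₂ := Algebra.TensorProduct.map (comul (LieAlg E G)) (AlgHom.id ℂ (Env E G))
  D₂₃ := (Algebra.TensorProduct.assoc ℂ ℂ ℂ (Env E G) (Env E G) (Env E G)).symm.toAlgHom.comp
    (Algebra.TensorProduct.map (AlgHom.id ℂ (Env E G)) (comul (LieAlg E G)))
  k₁₂ := includeLeft
  k₂₃ := (Algebra.TensorProduct.assoc ℂ ℂ ℂ (Env E G) (Env E G) (Env E G)).symm.toAlgHom.comp
    (Algebra.TensorProduct.includeRight (A := Env E G))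
  i_comm a b := by simp [Commute, SemiconjBy]
  k_comm₁₂ c a := by simp [Commute, SemiconjBy, ← Algebra.TensorProduct.one_def]
  k_comm₂₃ a c := by
    induction c with
    | zero => simp
    | add x y hx hy => rw [map_add]; exact hx.add_right hy
    | tmul x y => simp [Commute, SemiconjBy]
  k_i a := by simp
  D₁₂_i₁ a := by simp
  D₁₂_i₂ a := by simp [Algebra.TensorProduct.one_def]
  D₂₃_i₁ a := by simp [Algebra.TensorProduct.one_def]
  D₂₃_i₂ a := by simp
  coassoc a := by
    refine DFunLike.congr_fun (env_hom_ext (f := (Algebra.TensorProduct.map (comul (LieAlg E G))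
      (AlgHom.id ℂ (Env E G))).comp (comul (LieAlg E G))) (f' := ((Algebra.TensorProduct.assoc
        ℂ ℂ ℂ (Env E G) (Env E G) (Env E G)).symm.toAlgHom.comp (Algebra.TensorProduct.map
          (AlgHom.id ℂ (Env E G)) (comul (LieAlg E G)))).comp (comul (LieAlg E G)))
        fun y => ?_) a
    simp [comul_iotaVec, TensorProduct.add_tmul, TensorProduct.tmul_add,
      Algebra.TensorProduct.one_def, add_assoc]

theorem iotaVec_commute {u v : E} (h : lieBr E G u v = 0) :
    Commute (iotaVec E G u) (iotaVec E G v) := by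
  have h1 := iotaVec_lieBr (E := E) (G := G) u v
  rw [h, map_zero] at h1
  exact (sub_eq_zero.mp h1.symm)

variable {a : LieSubalgebra ℂ (LieAlg E G)} {r : ℕ} (b : Module.Basis (Fin r) ℂ a)

theorem hvec_commute [IsLieAbelian a] (i k : Fin r) : Commute (hvec b i) (hvec b k) :=
  iotaVec_commute (E := E) (G := G) (u := (b i : LieAlg E G)) (v := (b k : LieAlg E G))
    (congrArg (Subtype.val : a → LieAlg E G) (trivial_lie_zero a a (b i) (b k)))

theorem comul_hvec (i : Fin r) :
    comul (LieAlg E G) (hvec b i) = hvec b i ⊗ₜ[ℂ] 1 + 1 ⊗ₜ[ℂ] hvec b i :=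
  comul_iota (LieAlg E G) _

theorem counit_hvec (i : Fin r) : counit (LieAlg E G) (hvec b i) = 0 :=
  counit_iotaVec (E := E) (G := G) (b i : LieAlg E G)

variable {A : Type*} [Ring A] [Algebra ℂ A]

theorem mul'_tmul_one_mul (u : A) (x : A ⊗[ℂ] A) :
    LinearMap.mul' ℂ A (u ⊗ₜ 1 * x) = u * LinearMap.mul' ℂ A x := by
  induction x with
  | zero => simp
  | tmul x y => simp [mul_assoc]
  | add x y hx hy => rw [mul_add, map_add, hx, hy, map_add, mul_add]

theorem mul'_mul_one_tmul (u : A) (x : A ⊗[ℂ] A) :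
    LinearMap.mul' ℂ A (x * 1 ⊗ₜ u) = LinearMap.mul' ℂ A x * u := by
  induction x with
  | zero => simp
  | tmul x y => simp [mul_assoc]
  | add x y hx hy => rw [add_mul, map_add, hx, hy, map_add, add_mul]

end EnvLegs

/-! ### The transform of the trivial twist in the semidirect product. -/

section Transform

open TopologicalSpace PowerSeries

variable {E : Type*} [NormedAddCommGroup E] [NormedSpace ℂ E] [CompleteSpace E]
  {G : Type*} [TopologicalSpace G] [ChartedSpace E G] [Group G] [LieGroup 𝓘(ℂ, E) ω G]
  {a : LieSubalgebra ℂ (LieAlg E G)} {r : ℕ} (b : Module.Basis (Fin r) ℂ a)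
  (g : (Fin r → ℂ) → (Fin r → ℂ) → G)

/-- The series `X` in `x⁻¹ = γ⁻¹ X`. -/
def normX (lam : Fin r → ℂ) : OnePlus (Env E G) :=
  OnePlus.mk (normalOrder (groupShift (fun μ => (g lam μ)⁻¹) lam
    (fun i => -dualVec i) (hvec b)).ser) (constantCoeff_normalOrder _)

theorem quasiGrouplike_eq (lam : Fin r → ℂ) :
    quasiGrouplike b g lam = ⟨(normX b g lam)⁻¹, g lam lam⟩ := by
  have h : quasiGrouplike b g lam = SemidirectProduct.inl (normX b g lam)⁻¹ *
      SemidirectProduct.inr (g lam lam) := by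
    rw [quasiGrouplike, inverseElement, mul_inv_rev, ← map_inv, ← map_inv, inv_inv]
    rfl
  rw [h, SemidirectProduct.mk_eq_inl_mul_inr]

/-- The Taylor expansion of the diagonal part of `x`. -/
def diagShift (lam : Fin r → ℂ) : OnePlus (Env E G ⊗[ℂ] Env E G) :=
  groupShift (fun q => g q q) lam (fun i => -dualVec i) (hvec b)

/-- The Taylor expansion of the series part of `x`. -/
def seriesShift (lam : Fin r → ℂ) : OnePlus (Env E G ⊗[ℂ] Env E G) :=
  OnePlus.mk (shiftSeries (fun q => ((normX b g q)⁻¹).ser) lam (fun i => -dualVec i) (hvec b))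
        (constantCoeff_shiftSeries _ _ _ _)

variable (E G) in
/-- The map `x ↦ x²` on `1 + ℏ U(𝔤)[[ℏ]]`. -/
def legTwo : OnePlus (Env E G) →* OnePlus (Env E G ⊗[ℂ] Env E G) :=
  OnePlus.map (Algebra.TensorProduct.includeRight :
    Env E G →ₐ[ℂ] Env E G ⊗[ℂ] Env E G).toRingHom

variable (E G) in
/-- The coproduct on `1 + ℏ U(𝔤)[[ℏ]]`. -/
def legDelta : OnePlus (Env E G) →* OnePlus (Env E G ⊗[ℂ] Env E G) :=
  OnePlus.map (comul (LieAlg E G)).toRingHom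

theorem delta_quasiGrouplike (lam : Fin r → ℂ) : delta (quasiGrouplike b g lam) =
    SemidirectProduct.inl (legDelta E G (normX b g lam))⁻¹ *
      SemidirectProduct.inr (g lam lam, g lam lam) := by
  rw [quasiGrouplike_eq, delta, SemidirectProduct.mk_eq_inl_mul_inr, map_inv]
  rfl

theorem slotTwo_quasiGrouplike (lam : Fin r → ℂ) : slotTwo (quasiGrouplike b g lam) =
    SemidirectProduct.inl (legTwo E G (normX b g lam))⁻¹ *
      SemidirectProduct.inr (1, g lam lam) := by
  rw [quasiGrouplike_eq, slotTwo, SemidirectProduct.mk_eq_inl_mul_inr, map_inv]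
  rfl

theorem slotOneShift_quasiGrouplike (lam : Fin r → ℂ) :
    slotOneShift b (quasiGrouplike b g) lam =
      SemidirectProduct.inl (seriesShift b g lam) * SemidirectProduct.inr (g lam lam, 1) *
        SemidirectProduct.inl (diagShift b g lam) := by
  have e : quasiGrouplike b g = fun q => ⟨(normX b g q)⁻¹, g q q⟩ :=
    funext (quasiGrouplike_eq b g)
  rw [slotOneShift]
  simp only [e]
  rfl

theorem actHat_legTwo (γ : G) (u : OnePlus (Env E G)) :
    actHat (act₂ E G) (γ, 1) (legTwo E G u) = legTwo E G u := by
  apply OnePlus.ext_ser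
  ext n
  change Algebra.TensorProduct.congr (act E G γ) (act E G 1) (1 ⊗ₜ coeff n u.ser) =
    1 ⊗ₜ coeff n u.ser
  simp

/-- The element `k₂` meets its inverse and disappears. What remains of the group part is `k`, which
is moved past `Y`, on which it acts trivially, and past `S⁻¹`, until it meets `k⁻¹`. -/
theorem inl_mul_inr_calc {N K : Type*} [Group N] [Group K] {ψ : K →* MulAut N} {A Y S T : N}
    {kk k₂ k : K} (hk : kk = k * k₂) (hY : ψ k Y = Y) :
    (SemidirectProduct.inl A⁻¹ * SemidirectProduct.inr kk : N ⋊[ψ] K) *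
        (SemidirectProduct.inl Y⁻¹ * SemidirectProduct.inr k₂)⁻¹ *
        (SemidirectProduct.inl T * SemidirectProduct.inr k * SemidirectProduct.inl S)⁻¹ =
      SemidirectProduct.inl (A⁻¹ * Y * (ψ k S)⁻¹ * T⁻¹) := by
  subst hk
  apply SemidirectProduct.ext
  · simp [hY, mul_assoc]
  · simp

theorem transformGrp_eq (lam : Fin r → ℂ) :
    transformGrp b (quasiGrouplike b g) lam = SemidirectProduct.inl
      ((legDelta E G (normX b g lam))⁻¹ * legTwo E G (normX b g lam) *
        (actHat (act₂ E G) (g lam lam, 1) (diagShift b g lam))⁻¹ * (seriesShift b g lam)⁻¹) := by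
  rw [transformGrp, delta_quasiGrouplike, slotTwo_quasiGrouplike, slotOneShift_quasiGrouplike]
  exact inl_mul_inr_calc (by rw [Prod.mk_mul_mk, mul_one, one_mul]) (actHat_legTwo _ _)

end Transform

end VertexIRF

namespace VertexIRF

set_option linter.unusedSectionVars false

/-! ### The transform as a series of holomorphic functions of two variables. -/

section TransformSeries

open TopologicalSpace PowerSeries Algebra.TensorProduct

theorem OnePlus.mk_mul_inv {A : Type*} [Ring A] (p : A⟦X⟧) (hp : constantCoeff p = 1) :
    p * ((OnePlus.mk p hp)⁻¹).ser = 1 := (OnePlus.mk p hp).ser_mul_inv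

theorem OnePlus.mk_inv_mul {A : Type*} [Ring A] (p : A⟦X⟧) (hp : constantCoeff p = 1) :
    ((OnePlus.mk p hp)⁻¹).ser * p = 1 := (OnePlus.mk p hp).ser_inv_mul

theorem expS_one_of_zero {P C J : Type*} [NormedAddCommGroup P] [NormedSpace ℂ P] [Ring C]
    [Algebra ℂ C] [Fintype J] {U : Opens P} (w : J → P) (c : J → C) :
    expS (op (holDir U) 0 w c) 1 = 1 := by
  have h := expS_op_zero_constS (U := U) w c (1 : C⟦X⟧)
  rwa [constS, map_one] at h

variable {E : Type*} [NormedAddCommGroup E] [NormedSpace ℂ E] [CompleteSpace E]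
  [FiniteDimensional ℂ E]
  {G : Type*} [TopologicalSpace G] [ChartedSpace E G] [Group G] [LieGroup 𝓘(ℂ, E) ω G]
  {a : LieSubalgebra ℂ (LieAlg E G)} [IsLieAbelian a] {r : ℕ} (b : Module.Basis (Fin r) ℂ a)
  {g : (Fin r → ℂ) → (Fin r → ℂ) → G} {U : Opens ((Fin r → ℂ) × (Fin r → ℂ))}
  (hφ : ∀ z ∈ U, GHolAt E (fun z : (Fin r → ℂ) × (Fin r → ℂ) => (g z.1 z.2)⁻¹) z)

/-- The directions of differentiation in the second argument. -/
def dirSnd (r : ℕ) (i : Fin r) : (Fin r → ℂ) × (Fin r → ℂ) := (0, -dualVec i)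

/-- The diagonal directions. -/
def dirDiag (r : ℕ) (i : Fin r) : (Fin r → ℂ) × (Fin r → ℂ) := (-dualVec i, -dualVec i)

/-- The diagonal embedding. -/
def diagL (r : ℕ) : (Fin r → ℂ) →L[ℂ] (Fin r → ℂ) × (Fin r → ℂ) :=
  (ContinuousLinearMap.id ℂ _).prod (ContinuousLinearMap.id ℂ _)

theorem constantCoeff_serX : constantCoeff (serX hφ (dirSnd r) (hvec b)) = 1 := by
  rw [serX, constantCoeff_expS, map_one]

/-- The inverse of `serX`. -/
def invX : (Hol U ⊗[ℂ] Env E G)⟦X⟧ :=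
  ((OnePlus.mk (serX hφ (dirSnd r) (hvec b)) (constantCoeff_serX b hφ))⁻¹).ser

theorem serX_mul_invX : serX hφ (dirSnd r) (hvec b) * invX b hφ = 1 :=
  OnePlus.mk_mul_inv _ _

theorem invX_mul_serX : invX b hφ * serX hφ (dirSnd r) (hvec b) = 1 :=
  OnePlus.mk_inv_mul _ _

/-- For fixed `p` only the second argument of `g` is expanded, so the series is a transport on the
slice through `(p, p)`. Viewing it inside the two-variable transport lets `p` vary holomorphically,
which the later shift by `h⁽²⁾` requires. -/
theorem normX_ser {p : Fin r → ℂ} (hp : (p, p) ∈ U) :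
    (normX b g p).ser = evS (Env E G) hp (serX hφ (dirSnd r) (hvec b)) := by
  have e : (p, p) = (p, 0) + ContinuousLinearMap.inr ℂ (Fin r → ℂ) (Fin r → ℂ) p := by simp
  rw [evS_congr e hp (e ▸ hp)]
  exact mapLin_groupShift_affine hφ (p, 0) (ContinuousLinearMap.inr ℂ _ _)
    (ψ := fun μ => (g p μ)⁻¹) (fun q => by simp) (e ▸ hp) (fun i => -dualVec i)
    (hvec_commute b) (j := AlgHom.id ℂ _) (by simp [Algebra.TensorProduct.one_def])
    mul'_tmul_one_mul (fun i => mul'_mul_one_tmul _)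

theorem normX_inv_ser {p : Fin r → ℂ} (hp : (p, p) ∈ U) :
    ((normX b g p)⁻¹).ser = evS (Env E G) hp (invX b hφ) := by
  apply OnePlus.ser_inv_eq
  rw [normX_ser b hφ hp, ← evS_mul, serX_mul_invX, evS_one]

variable {D : Opens (Fin r → ℂ)} (hD : ∀ p ∈ D, (p, p) ∈ U)
include hφ hD in
theorem gholAt_diag_inv : ∀ q ∈ D, GHolAt E (fun q => (g q q)⁻¹) q := fun q hq =>
  (hφ (q, q) (hD q hq)).comp (ι := fun q : Fin r → ℂ => (q, q)) (contDiffAt_id.prodMk contDiffAt_id)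

include hφ hD in
theorem gholAt_diag : ∀ q ∈ D, GHolAt E (fun q => g q q) q := fun q hq => by
  simpa using (gholAt_diag_inv hφ hD q hq).inv

include hD in
theorem diagL_mem {q : Fin r → ℂ} (hq : q ∈ D) : 0 + diagL r q ∈ U := by
  rw [zero_add]
  exact hD q hq

theorem tmul_hvec_commute {A : Type*} [Ring A] [Algebra ℂ A] (i k : Fin r) :
    Commute ((1 : A) ⊗ₜ[ℂ] hvec b i) (1 ⊗ₜ hvec b k) := one_tmul_commute (hvec_commute b i k)

/-- The shifted group part of `x` is the transport of `q ↦ g(q,q)`. Conjugation by `g(p,p)` makes it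
inverse to the transport of `g(q,q)⁻¹` (`evS_connMap_inv`), which is the two-variable transport
along the diagonal. -/
theorem actHat_diagShift_inv_ser {p : Fin r → ℂ} (hp : p ∈ D) :
    ((actHat (act₂ E G) (g p p, 1) (diagShift b g p))⁻¹).ser =
      evS (Env E G ⊗[ℂ] Env E G) (hD p hp) (expS (op (holDir U) (connMap hφ includeLeft)
        (dirDiag r) (fun i => 1 ⊗ₜ hvec b i)) 1) := by
  apply OnePlus.ser_inv_eq
  have h1 : (actHat (act₂ E G) (g p p, 1) (diagShift b g p)).ser =
      evS (Env E G ⊗[ℂ] Env E G) hp (expS (op (holDir D) (connMap (gholAt_diag hφ hD)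
        ((includeLeft : Env E G →ₐ[ℂ] Env E G ⊗[ℂ] Env E G).comp (AdEnv (g p p))))
        (fun i => -dualVec i) (fun i => 1 ⊗ₜ hvec b i)) 1) := by
    have h0 : (actHat (act₂ E G) (g p p, 1) (diagShift b g p)).ser =
        mapLin (act₂ E G (g p p, 1)).toLinearMap (groupShift (E := E) (fun q => g q q) p
          (fun i => -dualVec i) (hvec b)).ser := PowerSeries.ext fun n => by
      rw [coeff_mapLin]
      rfl
    rw [h0]
    refine mapLin_groupShift (gholAt_diag hφ hD) hp (fun i => -dualVec i) (hvec_commute b)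
      (Λ := (act₂ E G (g p p, 1)).toLinearMap) (map_one (act₂ E G (g p p, 1))) ?_ ?_
    · intro u x
      change act₂ E G (g p p, 1) (_ * _) = _ * act₂ E G (g p p, 1) x
      rw [map_mul]
      congr 1
      change (act E G (g p p) u) ⊗ₜ (act E G 1 1) = (AdEnv (g p p) u) ⊗ₜ[ℂ] (1 : Env E G)
      rw [map_one]
      rfl
    · intro i x
      change act₂ E G (g p p, 1) (_ * _) = act₂ E G (g p p, 1) x * _
      rw [map_mul]
      congr 1
      change (act E G (g p p) 1) ⊗ₜ (act E G 1 (hvec b i)) = _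
      rw [map_one, map_one]
      rfl
  have h2 := evS_pull_one (θ := connMap hφ (includeLeft : Env E G →ₐ[ℂ] Env E G ⊗[ℂ] Env E G))
    (θ' := connMap (gholAt_diag_inv hφ hD) includeLeft) (c := fun i => 1 ⊗ₜ hvec b i)
    (v := dirDiag r) (w := fun i => -dualVec i) 0 (diagL r)
    (fun q hq => diagL_mem hD hq) (fun i => rfl)
    (fun w => rT_connMap hφ 0 (diagL r) _ (fun q => by simp [diagL]) (gholAt_diag_inv hφ hD) _ w)
    hp (hD p hp) (by simp [diagL])
  rw [h1, h2]
  exact evS_connMap_inv (gholAt_diag hφ hD) (gholAt_diag_inv hφ hD) includeLeft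
    (fun i => -dualVec i) (tmul_hvec_commute b) (fun u i => includeLeft_commute_tmul u _) hp

/-- The ordinary shift by `h⁽²⁾` is multiplicative on series with coefficients in the first factor,
so the inverse of a shift is the shift of the inverse. -/
theorem seriesShift_inv_ser {p : Fin r → ℂ} (hp : p ∈ D) :
    ((seriesShift b g p)⁻¹).ser =
      evS (Env E G ⊗[ℂ] Env E G) (hD p hp) (expS (op (holDir U) 0
        (dirDiag r) (fun i => 1 ⊗ₜ hvec b i)) (PowerSeries.map (lT (Hol U)
          (includeLeft : Env E G →ₐ[ℂ] Env E G ⊗[ℂ] Env E G)).toRingHom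
            (serX hφ (dirSnd r) (hvec b)))) := by
  apply OnePlus.ser_inv_eq
  have h1 : (seriesShift b g p).ser = evS (Env E G ⊗[ℂ] Env E G) (hD p hp)
      (expS (op (holDir U) 0 (dirDiag r) (fun i => 1 ⊗ₜ hvec b i)) (PowerSeries.map (lT (Hol U)
          (includeLeft : Env E G →ₐ[ℂ] Env E G ⊗[ℂ] Env E G)).toRingHom (invX b hφ))) :=
    shiftSeries_affine (p₀ := 0) (L := diagL r) (ι := fun q => (q, q)) (fun q => by simp [diagL])
      hD (fun q hq => normX_inv_ser b hφ (hD q hq)) hp _ _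
  rw [h1, ← evS_mul, ← expS_op_mul_zero (tmul_hvec_commute b), ← map_mul, invX_mul_serX, map_one,
    expS_one_of_zero, evS_one]
  exact fun n j => coeff_map_lT_commute (fun u => includeLeft_commute_tmul u _) _ n

/-- The series `M` with `Δ(X) J = (1 ⊗ X) M`. -/
abbrev normM : (Hol U ⊗[ℂ] (Env E G ⊗[ℂ] Env E G))⟦X⟧ :=
  serM hφ (dirSnd r) (dirDiag r) (hvec b) includeLeft includeRight

/-- The transform of `1 ⊗ 1` as a series of holomorphic functions of two variables. -/
def serJ : (Hol U ⊗[ℂ] (Env E G ⊗[ℂ] Env E G))⟦X⟧ :=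
  PowerSeries.map (lT (Hol U) (comul (LieAlg E G))).toRingHom (invX b hφ) *
    PowerSeries.map (lT (Hol U) (includeRight : Env E G →ₐ[ℂ] Env E G ⊗[ℂ] Env E G)).toRingHom
      (serX hφ (dirSnd r) (hvec b)) * normM b hφ

theorem map_comul_mul_serJ :
    PowerSeries.map (lT (Hol U) (comul (LieAlg E G))).toRingHom (serX hφ (dirSnd r) (hvec b)) *
      serJ b hφ =
    PowerSeries.map (lT (Hol U) (includeRight : Env E G →ₐ[ℂ] Env E G ⊗[ℂ] Env E G)).toRingHom
      (serX hφ (dirSnd r) (hvec b)) * normM b hφ := by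
  rw [serJ, mul_assoc, ← mul_assoc, ← map_mul, serX_mul_invX, map_one, one_mul]

/-- Splitting off the diagonal directions exhibits `M` as the product of exactly the two inverse
factors that occur in the transform of `1 ⊗ 1`. -/
theorem evS_normM {p : (Fin r → ℂ) × (Fin r → ℂ)} (hp : p ∈ U) :
    evS _ hp (normM b hφ) = evS (Env E G ⊗[ℂ] Env E G) hp (expS (op (holDir U)
        (connMap hφ includeLeft) (dirDiag r) (fun i => 1 ⊗ₜ hvec b i)) 1) *
      evS (Env E G ⊗[ℂ] Env E G) hp (expS (op (holDir U) 0
        (dirDiag r) (fun i => 1 ⊗ₜ hvec b i)) (PowerSeries.map (lT (Hol U)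
          (includeLeft : Env E G →ₐ[ℂ] Env E G ⊗[ℂ] Env E G)).toRingHom
            (serX hφ (dirSnd r) (hvec b)))) := by
  rw [normM, serM_eq hφ _ _ _ _ (hvec_commute b) (fun u v => includeLeft_commute_tmul u v)]
  exact evS_expS_mul_zero (tmul_hvec_commute b) hp
    fun n j => coeff_map_lT_commute (fun u => includeLeft_commute_tmul u _) _ n

theorem transform_eq_evS {p : Fin r → ℂ} (hp : p ∈ D) :
    transform b (quasiGrouplike b g) p = evS _ (hD p hp) (serJ b hφ) := by
  rw [transform, transformGrp_eq, SemidirectProduct.left_inl, OnePlus.ser_mul, OnePlus.ser_mul,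
    OnePlus.ser_mul, actHat_diagShift_inv_ser b hφ hD hp, seriesShift_inv_ser b hφ hD hp,
    mul_assoc, ← evS_normM, ← map_inv, legDelta, legTwo, OnePlus.ser_map, OnePlus.ser_map,
    normX_ser b hφ (hD p hp), normX_inv_ser b hφ (hD p hp), serJ, evS_mul, evS_mul, evS_map,
    evS_map]

end TransformSeries

end VertexIRF

namespace VertexIRF

set_option linter.unusedSectionVars false

/-! ### Automorphisms of power series that preserve a subalgebra. -/

section Normalizes

open PowerSeries

theorem exists_eq_C_add_X_mul {A : Type*} [Ring A] (p : A⟦X⟧) :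
    p = C (constantCoeff p) + X * PowerSeries.mk fun n => coeff (n + 1) p := by
  ext n
  cases n with
  | zero => simp
  | succ n => simp [coeff_succ_X_mul]

/-- An automorphism of `A[[ℏ]]` that preserves `B[[ℏ]]` on constants and is onto `B` modulo `ℏ`
restricts to an automorphism of `B[[ℏ]]`. -/
theorem image_series_eq {A : Type*} [Ring A] [Algebra ℂ A] (B : Subalgebra ℂ A)
    (c c' : A⟦X⟧ →+ A⟦X⟧) (hc : ∀ p, c (c' p) = p) (hc' : ∀ p, c' (c p) = p)
    (hX : ∀ p, c (X * p) = X * c p) (hX' : ∀ p, c' (X * p) = X * c' p)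
    (hB : ∀ u ∈ B, ∀ n, coeff n (c (C u)) ∈ B)
    (hB' : ∀ v ∈ B, ∃ u ∈ B, constantCoeff (c (C u)) = v) :
    c '' {p | ∀ n, coeff n p ∈ B} = {p | ∀ n, coeff n p ∈ B} := by
  have h1 : ∀ n, ∀ p : A⟦X⟧, (∀ n, coeff n p ∈ B) → coeff n (c p) ∈ B := by
    intro n
    induction n with
    | zero =>
      intro p hp
      rw [exists_eq_C_add_X_mul p, map_add, hX, map_add, coeff_zero_X_mul, add_zero]
      exact hB _ (by simpa using hp 0) _
    | succ n ih =>
      intro p hp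
      rw [exists_eq_C_add_X_mul p, map_add, hX, map_add, coeff_succ_X_mul]
      exact B.add_mem (hB _ (by simpa using hp 0) _) (ih _ fun n => by simpa using hp (n + 1))
  have h2 : ∀ n, ∀ p : A⟦X⟧, (∀ n, coeff n p ∈ B) → coeff n (c' p) ∈ B := by
    -- Surjectivity modulo `ℏ` provides a constant `u` that matches the constant term of `p`. The
    -- remainder is divisible by `ℏ`, and the quotient again has coefficients in `B`, so that `c' p`
    -- is found degree by degree.
    have key : ∀ p : A⟦X⟧, (∀ n, coeff n p ∈ B) → ∃ u ∈ B, ∃ q : A⟦X⟧, (∀ n, coeff n q ∈ B) ∧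
        c' p = C u + X * c' q := by
      intro p hp
      obtain ⟨u, hu, hu'⟩ := hB' (constantCoeff p) (by simpa using hp 0)
      have h := exists_eq_C_add_X_mul (p - c (C u))
      rw [map_sub, hu', sub_self, map_zero, zero_add] at h
      refine ⟨u, hu, PowerSeries.mk fun n => coeff (n + 1) (p - c (C u)), fun n => ?_, ?_⟩
      · rw [coeff_mk, map_sub]
        exact B.sub_mem (hp _) (hB u hu _)
      · rw [← hX', ← h, map_sub, hc', add_sub_cancel]
    intro n
    induction n with
    | zero =>
      intro p hp
      obtain ⟨u, hu, q, hq, e⟩ := key p hp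
      rw [e, map_add, coeff_zero_X_mul, add_zero]
      simpa using hu
    | succ n ih =>
      intro p hp
      obtain ⟨u, hu, q, hq, e⟩ := key p hp
      rw [e, map_add, coeff_succ_X_mul, coeff_C, if_neg n.succ_ne_zero, zero_add]
      exact ih q hq
  apply Set.Subset.antisymm
  · rintro _ ⟨p, hp, rfl⟩ n
    exact h1 n p hp
  · intro p hp
    exact ⟨c' p, fun n => h2 n p hp, hc p⟩

end Normalizes

/-! ### Coordinates of the adjoint sections. -/

section AdCoord

open TopologicalSpace PowerSeries

variable {E : Type*} [NormedAddCommGroup E] [NormedSpace ℂ E] [CompleteSpace E]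
  [FiniteDimensional ℂ E]
  {G : Type*} [TopologicalSpace G] [ChartedSpace E G] [Group G] [LieGroup 𝓘(ℂ, E) ω G]
  {P : Type*} [NormedAddCommGroup P] [NormedSpace ℂ P] {U : Opens P} {φ : P → G}
  (hφ : ∀ p ∈ U, GHolAt E φ p)
  {a : LieSubalgebra ℂ (LieAlg E G)} {r : ℕ} (b : Module.Basis (Fin r) ℂ a)

/-- An extension of the coordinate functions of `𝔞` to `𝔤`. -/
theorem exists_extend_coord : ∃ l : Fin r → E →ₗ[ℂ] ℂ, ∀ i (y : a), l i (y : LieAlg E G) = b.repr y i := by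
  choose l hl using fun i => LinearMap.exists_extend (p := a.toSubmodule) (b.coord i)
  exact ⟨l, fun i y => LinearMap.congr_fun (hl i) y⟩

/-- A chosen extension of the coordinate functions of `𝔞` to `𝔤`. -/
def extCoord : Fin r → E →ₗ[ℂ] ℂ := (exists_extend_coord b).choose

theorem extCoord_apply (i : Fin r) (y : a) : extCoord b i (y : LieAlg E G) = b.repr y i :=
  (exists_extend_coord b).choose_spec i y

/-- The coordinates of `Ad_{φ⁻¹} y`. -/
def adCoord (y : E) (k : Fin r) : Hol U :=
  toHol U (fun p => extCoord b k (adVec E (φ p)⁻¹ y))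
    fun p hp => analyticAt_coord (analyticAt_adVec_inv (hφ p hp) y) _

theorem iotaVec_eq_sum (y : a) : iotaVec E G (y : LieAlg E G) = ∑ k, b.repr y k • hvec b k := by
  conv_lhs => rw [← b.sum_repr y]
  rw [AddSubmonoidClass.coe_finsetSum]
  exact (map_sum (iota (LieAlg E G)) _ _).trans
    (Finset.sum_congr rfl fun k _ => map_smul (iota (LieAlg E G)) _ _)

theorem adSec_eq_sum {y : E} (h : ∀ p ∈ U, (adVec E (φ p)⁻¹ y : LieAlg E G) ∈ a) :
    adSec hφ y = ∑ k, adCoord hφ b y k ⊗ₜ hvec b k := ext_ev fun p hp => by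
  rw [evT_adSec, map_sum, iotaVec_eq_sum b ⟨_, h p hp⟩]
  refine Finset.sum_congr rfl fun k _ => ?_
  rw [evT_tmul, adCoord, evp_toHol, ← extCoord_apply]

theorem dT_adSec_connMap_id (y : E) (w : P) : dT (holDir U) _ w (adSec hφ y) =
    adSec hφ y * connMap hφ (AlgHom.id ℂ (Env E G)) w -
      connMap hφ (AlgHom.id ℂ (Env E G)) w * adSec hφ y := by
  rw [dT_adSec, connMap_apply]
  simp

end AdCoord

/-! ### Elements of the group that normalize the subalgebra. -/

section AdSubalgebra

variable {E : Type*} [NormedAddCommGroup E] [NormedSpace ℂ E] [CompleteSpace E]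
  [FiniteDimensional ℂ E]
  {G : Type*} [TopologicalSpace G] [ChartedSpace E G] [Group G] [LieGroup 𝓘(ℂ, E) ω G]
  {a : LieSubalgebra ℂ (LieAlg E G)}

theorem adVec_mul (γ γ' : G) (y : E) : adVec E (γ * γ') y = adVec E γ (adVec E γ' y) :=
  AdLin_mul γ γ' y

theorem adVec_one (y : E) : adVec E (1 : G) y = y := AdLin_one y

theorem adVec_inv_adVec (γ : G) (y : E) : adVec E γ⁻¹ (adVec E γ y) = y := by
  rw [← adVec_mul, inv_mul_cancel, adVec_one]

theorem adVec_adVec_inv (γ : G) (y : E) : adVec E γ (adVec E γ⁻¹ y) = y := by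
  rw [← adVec_mul, mul_inv_cancel, adVec_one]

/-- An element of `G` that maps `𝔞` to `𝔞` normalizes `𝔞`. -/
theorem adVec_inv_mem {γ : G} (h : ∀ y : E, (y : LieAlg E G) ∈ a → (adVec E γ y : LieAlg E G) ∈ a)
    {y : E} (hy : (y : LieAlg E G) ∈ a) : (adVec E γ⁻¹ y : LieAlg E G) ∈ a := by
  let S : Submodule ℂ E := a.toSubmodule
  let A : E →ₗ[ℂ] E := (AdLin E γ : LieAlg E G →L[ℂ] LieAlg E G).toLinearMap
  let A' : S →ₗ[ℂ] S := A.restrict (p := S) (q := S) h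
  -- The restriction of `Ad_γ` to `𝔞` is injective, hence onto by finite dimensionality. So each
  -- element of `𝔞` has its preimage in `𝔞`.
  have hinj : Function.Injective A' := by
    intro u v huv
    apply Subtype.ext
    have h1 : adVec E γ (u : E) = adVec E γ (v : E) := congrArg Subtype.val huv
    rw [← adVec_inv_adVec γ (u : E), h1, adVec_inv_adVec]
  obtain ⟨z, hz⟩ := (LinearMap.injective_iff_surjective.mp hinj) ⟨y, hy⟩
  have h2 : adVec E γ (z : E) = y := congrArg Subtype.val hz
  rw [← h2, adVec_inv_adVec]
  exact z.2

end AdSubalgebra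

end VertexIRF

namespace VertexIRF

set_option linter.unusedSectionVars false

/-! ### Conjugation by `x` and the function `f`. -/

section Realization

open TopologicalSpace PowerSeries Algebra.TensorProduct

variable {E : Type*} [NormedAddCommGroup E] [NormedSpace ℂ E] [CompleteSpace E]
  [FiniteDimensional ℂ E]
  {G : Type*} [TopologicalSpace G] [ChartedSpace E G] [Group G] [LieGroup 𝓘(ℂ, E) ω G]
  {a : LieSubalgebra ℂ (LieAlg E G)} [IsLieAbelian a] {r : ℕ} (b : Module.Basis (Fin r) ℂ a)
  {g : (Fin r → ℂ) → (Fin r → ℂ) → G} {U : Opens ((Fin r → ℂ) × (Fin r → ℂ))}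
  (hφ : ∀ z ∈ U, GHolAt E (fun z : (Fin r → ℂ) × (Fin r → ℂ) => (g z.1 z.2)⁻¹) z)

/-- The basis vectors of `𝔞`, as elements of the model space of `G`. -/
def yvec (i : Fin r) : E := ((b i : a) : LieAlg E G)

theorem yvec_mem (i : Fin r) : ((yvec b i : E) : LieAlg E G) ∈ a := (b i).2

/-- The pairing of `𝔞*` with `𝔞`, in coordinates. -/
def pairing (t : Fin r → ℂ) (y : E) : ℂ := ∑ k, extCoord b k y * t k

theorem pairing_basis (t : Fin r → ℂ) (i : Fin r) : pairing b t (yvec b i) = t i := by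
  have h : ∀ k, extCoord b k (yvec b i) = b.repr (b i) k := fun k => extCoord_apply b k (b i)
  simp [pairing, h, Finsupp.single_apply]

theorem pairing_add (t t' : Fin r → ℂ) (y : E) :
    pairing b (t + t') y = pairing b t y + pairing b t' y := by
  simp [pairing, mul_add, Finset.sum_add_distrib]

theorem pairing_coe (t : Fin r → ℂ) (y : a) : pairing b t (y : LieAlg E G) = b.constr ℂ t y := by
  simp [pairing, extCoord_apply, Module.Basis.constr_apply_fintype]

/-- The function `g` intertwines `λ - μ` and `f(λ) - f(μ)`. -/
structure Intertwines (g : (Fin r → ℂ) → (Fin r → ℂ) → G) (f : (Fin r → ℂ) → (Fin r → ℂ))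
    (U : Opens ((Fin r → ℂ) × (Fin r → ℂ))) : Prop where
  mem : ∀ z ∈ U, ∀ y : E, (y : LieAlg E G) ∈ a → (adVec E (g z.1 z.2) y : LieAlg E G) ∈ a
  pairing_eq : ∀ z ∈ U, ∀ y : E, (y : LieAlg E G) ∈ a →
    pairing b (z.1 - z.2) (adVec E (g z.1 z.2) y) = pairing b (f z.1 - f z.2) y

variable {f : (Fin r → ℂ) → (Fin r → ℂ)} (hI : Intertwines b g f U)

/-- The Taylor expansion of `Ad_g y` in the second argument. -/
abbrev adTaylor {p : (Fin r → ℂ) × (Fin r → ℂ)} (hp : p ∈ U) (i : Fin r) : (Env E G)⟦X⟧ :=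
  taylor hp (dirSnd r) (hvec b) (adSec hφ (yvec b i))

include hI in
theorem adSec_basis_eq_sum (i : Fin r) : adSec hφ (yvec b i) =
    ∑ k, adCoord hφ b (yvec b i) k ⊗ₜ hvec b k :=
  adSec_eq_sum hφ b (y := yvec b i) fun z hz => by
    rw [inv_inv]
    exact hI.mem z hz _ (yvec_mem b i)

-- With `φ = g⁻¹` the covariantly constant section is `Ad_g y_i`. Its values lie in the abelian
-- algebra `𝔞`, so it commutes with the expansion variables and `evS_expS_intertwine` applies.
include hI in
theorem hvec_mul_serX {p : (Fin r → ℂ) × (Fin r → ℂ)} (hp : p ∈ U) (i : Fin r) :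
    PowerSeries.C (AdEnv (g p.1 p.2) (hvec b i)) * evS _ hp (serX hφ (dirSnd r) (hvec b)) =
      evS _ hp (serX hφ (dirSnd r) (hvec b)) * adTaylor b hφ hp i := by
  have h := evS_expS_intertwine (θ := connMap hφ (AlgHom.id ℂ (Env E G))) (w := dirSnd r)
    (c := hvec b) (hvec_commute b) (V := adSec hφ (yvec b i))
    (fun j => dT_adSec_connMap_id hφ (yvec b i) _) (fun j => by
      rw [adSec_basis_eq_sum b hφ hI]
      exact Commute.sum_left _ _ _ fun k _ => tmul_commute_tmul (hvec_commute b k j) _ _) hp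
  rw [evT_adSec, inv_inv, ← AdEnv_iotaVec] at h
  exact h

/-- The coordinate functions of the difference of the two arguments. -/
def diffCoord (U : Opens ((Fin r → ℂ) × (Fin r → ℂ))) (k : Fin r) : Hol U :=
  toHol U (fun z => z.1 k - z.2 k) fun z _ => by
    have h1 : AnalyticAt ℂ (fun z : (Fin r → ℂ) × (Fin r → ℂ) => z.1 k) z :=
      ((ContinuousLinearMap.proj (R := ℂ) k).comp (ContinuousLinearMap.fst ℂ (Fin r → ℂ) (Fin r → ℂ))).analyticAt z
    have h2 : AnalyticAt ℂ (fun z : (Fin r → ℂ) × (Fin r → ℂ) => z.2 k) z :=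
      ((ContinuousLinearMap.proj (R := ℂ) k).comp (ContinuousLinearMap.snd ℂ (Fin r → ℂ) (Fin r → ℂ))).analyticAt z
    exact h1.sub h2

theorem taylor_toHol_affine {P J C : Type*} [NormedAddCommGroup P] [NormedSpace ℂ P] [Fintype J]
    [Ring C] [Algebra ℂ C] {V : Opens P} {F : P → ℂ} {hF : ∀ p ∈ V, AnalyticAt ℂ F p} {p : P}
    (hp : p ∈ V) (w : J → P) (c : J → C) {L : P →L[ℂ] ℂ} {F₀ : ℂ} (h : ∀ q, F q = F₀ + L q) :
    taylor hp w c (toHol V F hF ⊗ₜ 1) =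
      PowerSeries.C (algebraMap ℂ C (F p)) + PowerSeries.X * PowerSeries.C (∑ j, L (w j) • c j) := by
  rw [taylor_affine hp w c (a := fun j => L (w j)), evp_toHol]
  intro j
  apply Subtype.ext
  funext q
  refine (evp_der_toHol q.2 (w j) F hF).trans ?_
  obtain rfl : F = fun q => F₀ + L q := funext h
  rw [fderiv_const_add, L.fderiv]
  rfl

theorem taylor_diffCoord {C : Type*} [Ring C] [Algebra ℂ C] {p : Fin r → ℂ} (hp : (p, p) ∈ U)
    (c : Fin r → C) (k : Fin r) :
    taylor hp (dirSnd r) c (diffCoord U k ⊗ₜ 1) = PowerSeries.X * PowerSeries.C (c k) := by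
  rw [diffCoord, taylor_toHol_affine hp (dirSnd r) c (F₀ := 0)
    (L := (ContinuousLinearMap.proj (R := ℂ) k).comp (ContinuousLinearMap.fst ℂ (Fin r → ℂ) (Fin r → ℂ)) -
      (ContinuousLinearMap.proj (R := ℂ) k).comp (ContinuousLinearMap.snd ℂ (Fin r → ℂ) (Fin r → ℂ)))
    (fun q => by simp)]
  simp [dirSnd, dualVec, Pi.single_apply]

variable {D : Opens (Fin r → ℂ)} (hD : ∀ p ∈ D, (p, p) ∈ U)
  (hUD : ∀ z ∈ U, z.1 ∈ D ∧ z.2 ∈ D) (hf : AnalyticOnNhd ℂ f D)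

include hf in
theorem analyticAt_apply (i : Fin r) : ∀ p ∈ D, AnalyticAt ℂ (fun q => f q i) p := fun p hp =>
  ((ContinuousLinearMap.proj (R := ℂ) (φ := fun _ : Fin r => ℂ) i).analyticAt (f p)).comp (hf p hp)

/-- The components of `f`. -/
def compHol (i : Fin r) : Hol D := toHol D (fun q => f q i) (analyticAt_apply hf i)

theorem mapLin_shift_comp (i : Fin r) {p : Fin r → ℂ} (hp : p ∈ D) (w : Fin r → Fin r → ℂ) :
    mapLin (TensorProduct.lid ℂ (Env E G)).toLinearMap (shift (fun q => f q i) p w (hvec b)) =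
      taylor hp w (hvec b) (compHol hf i ⊗ₜ 1) := by
  have h1 := shift_of_evT (F := fun q => f q i) (t := compHol hf i ⊗ₜ[ℂ] (1 : ℂ))
    (fun q hq => by rw [evT_tmul, compHol, evp_toHol]; simp) hp w (hvec b)
  rw [h1]
  have h2 := evS_expS_map (θ := 0) (θ' := 0) (Algebra.TensorProduct.lid ℂ (Env E G)).toAlgHom
    (c := fun j => 1 ⊗ₜ hvec b j) (c' := hvec b) (w := w) (fun j => by simp) (fun w => by simp) hp
    (PowerSeries.C (lT (Hol D) (includeLeft : ℂ →ₐ[ℂ] ℂ ⊗[ℂ] Env E G) (compHol hf i ⊗ₜ[ℂ] (1 : ℂ))))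
  rw [← mapLin_algHom] at h2
  refine h2.trans ?_
  rw [taylor]
  congr 2
  simp

theorem taylor_pull {P P' J C : Type*} [NormedAddCommGroup P] [NormedSpace ℂ P]
    [NormedAddCommGroup P'] [NormedSpace ℂ P'] [Fintype J] [Ring C] [Algebra ℂ C] {V : Opens P}
    {V' : Opens P'} (p₀ : P) (L : P' →L[ℂ] P) (h : ∀ q ∈ V', p₀ + L q ∈ V) {w : J → P'} {v : J → P}
    (c : J → C) (hv : ∀ j, v j = L (w j)) (t : Hol V ⊗[ℂ] C) {q : P'} (hq : q ∈ V') {p : P}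
    (hp : p ∈ V) (e : p = p₀ + L q) :
    taylor hq w c (rT C (pull p₀ L h) t) = taylor hp v c t := by
  subst e
  refine (((evS_pull p₀ L h (θ := 0) (θ' := 0) (c := c) hv (fun w => ?_) hq _)).trans ?_).symm
  · rw [LinearMap.zero_apply, map_zero]
    rfl
  · rw [taylor, PowerSeries.map_C]
    rfl

theorem taylor_sub {P J C : Type*} [NormedAddCommGroup P] [NormedSpace ℂ P] [Fintype J]
    [Ring C] [Algebra ℂ C] {V : Opens P} {p : P} (hp : p ∈ V) (w : J → P) (c : J → C)
    (t t' : Hol V ⊗[ℂ] C) : taylor hp w c (t - t') = taylor hp w c t - taylor hp w c t' := by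
  rw [eq_sub_iff_add_eq, ← taylor_add, sub_add_cancel]

/-- The relation between `g` and `f`, evaluated on a basis vector, as an identity of holomorphic
functions; this form can be Taylor expanded. -/
theorem adCoord_sum (hI : Intertwines b g f U) (i : Fin r)
    (h1 : ∀ q ∈ U, 0 + ContinuousLinearMap.fst ℂ (Fin r → ℂ) (Fin r → ℂ) q ∈ D)
    (h2 : ∀ q ∈ U, 0 + ContinuousLinearMap.snd ℂ (Fin r → ℂ) (Fin r → ℂ) q ∈ D) :
    ∑ k, adCoord hφ b (yvec b i) k * diffCoord U k =
      pull 0 (ContinuousLinearMap.fst ℂ (Fin r → ℂ) (Fin r → ℂ)) h1 (compHol hf i) -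
        pull 0 (ContinuousLinearMap.snd ℂ (Fin r → ℂ) (Fin r → ℂ)) h2 (compHol hf i) := by
  have key : ∀ z (hz : z ∈ U), evp hz (∑ k, adCoord hφ b (yvec b i) k * diffCoord U k) =
      f z.1 i - f z.2 i := by
    intro z hz
    have e2 := hI.pairing_eq z hz _ (yvec_mem b i)
    rw [pairing_basis] at e2
    rw [map_sum]
    refine Eq.trans ?_ e2
    rw [pairing]
    refine Finset.sum_congr rfl fun k _ => ?_
    rw [map_mul, adCoord, diffCoord, evp_toHol, evp_toHol, inv_inv]
    rfl
  apply Subtype.ext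
  funext z
  refine (key z z.2).trans ?_
  change _ = (compHol hf i).1 ⟨_, h1 z z.2⟩ - (compHol hf i).1 ⟨_, h2 z z.2⟩
  change _ = f (0 + z.1.1) i - f (0 + z.1.2) i
  rw [zero_add, zero_add]

-- The function `λ_k - μ_k` expands to `ℏ h_k` in `μ`, so `ℏ` times the expansion of `Ad_g y_i` is
-- that of `f_i(λ) - f_i(μ)`. Only `μ` is shifted, and the first term stays constant.
include hUD hf in
theorem X_mul_adTaylor {p : Fin r → ℂ} (hp : p ∈ D) (hI : Intertwines b g f U) (i : Fin r) :
    PowerSeries.X * adTaylor b hφ (hD p hp) i = PowerSeries.C (algebraMap ℂ (Env E G) (f p i)) -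
        mapLin (TensorProduct.lid ℂ (Env E G)).toLinearMap
          (shift (fun q => f q i) p (fun j => -dualVec j) (hvec b)) := by
  have h1 : ∀ q ∈ U, 0 + ContinuousLinearMap.fst ℂ (Fin r → ℂ) (Fin r → ℂ) q ∈ D := fun q hq => by
    rw [zero_add]; exact (hUD q hq).1
  have h2 : ∀ q ∈ U, 0 + ContinuousLinearMap.snd ℂ (Fin r → ℂ) (Fin r → ℂ) q ∈ D := fun q hq => by
    rw [zero_add]; exact (hUD q hq).2
  rw [adTaylor, adSec_basis_eq_sum b hφ hI, X_mul_taylor_sum (hD p hp) (hvec_commute b)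
    (hvec_commute b) (fun k => taylor_diffCoord (hD p hp) _ k),
    adCoord_sum b hφ hf hI i h1 h2, mapLin_shift_comp b hf i hp, TensorProduct.sub_tmul, taylor_sub]
  congr 1
  · rw [taylor_affine (hD p hp) (dirSnd r) (hvec b) (a := 0)]
    · have e : evp (hD p hp) (pull 0 (ContinuousLinearMap.fst ℂ (Fin r → ℂ) (Fin r → ℂ)) h1 (compHol hf i)) =
          evp (h1 _ (hD p hp)) (compHol hf i) := rfl
      rw [e, compHol, evp_toHol]
      simp
    · intro j
      rw [← pull_der]
      simp [dirSnd]
  · exact taylor_pull 0 (ContinuousLinearMap.snd ℂ (Fin r → ℂ) (Fin r → ℂ)) h2 (hvec b) (w := dirSnd r)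
      (fun j => rfl) (compHol hf i ⊗ₜ 1) (hD p hp) hp (by simp)

end Realization

end VertexIRF

namespace VertexIRF

set_option linter.unusedSectionVars false

/-! ### Conjugation in the extended group. -/

section Conjugation

open PowerSeries

variable {Γ A : Type*} [Group Γ] [Ring A] [Algebra ℂ A] {ρ : Γ →* (A ≃ₐ[ℂ] A)}

/-- Conjugation as a homomorphism. -/
def conjHom (x : Ext ρ) : A⟦X⟧ →+ A⟦X⟧ where
  toFun := conj x
  map_zero' := by simp [conj]
  map_add' p q := by simp only [conj, map_add, mul_add, add_mul]

theorem conjHom_apply (x : Ext ρ) (p : A⟦X⟧) : conjHom x p = conj x p := rfl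

theorem conj_mul (x : Ext ρ) (p q : A⟦X⟧) : conj x (p * q) = conj x p * conj x q := by
  have h := OnePlus.ser_inv_mul x.left
  simp only [conj, map_mul]
  calc _ = x.left.ser * PowerSeries.map (ρ x.right : A →+* A) p * 1 *
        PowerSeries.map (ρ x.right : A →+* A) q * (x.left⁻¹).ser := by simp only [mul_assoc, one_mul]
    _ = _ := by rw [← h]; simp only [mul_assoc]

theorem conj_conj (x y : Ext ρ) (p : A⟦X⟧) : conj x (conj y p) = conj (x * y) p := by
  have h1 : (x * y).left.ser = x.left.ser * PowerSeries.map (ρ x.right : A →+* A) y.left.ser := rfl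
  have h2 : ((x * y).left⁻¹).ser =
      PowerSeries.map (ρ x.right : A →+* A) (y.left⁻¹).ser * (x.left⁻¹).ser := by
    rw [SemidirectProduct.mul_left, mul_inv_rev, ← map_inv]
    rfl
  have h3 : PowerSeries.map (ρ (x * y).right : A →+* A) p =
      PowerSeries.map (ρ x.right : A →+* A) (PowerSeries.map (ρ y.right : A →+* A) p) := by
    ext n
    simp only [PowerSeries.coeff_map, SemidirectProduct.mul_right, map_mul]
    rfl
  rw [conj, conj, conj, h1, h2, h3, map_mul, map_mul]
  simp only [mul_assoc]

theorem conj_one (p : A⟦X⟧) : conj (1 : Ext ρ) p = p := by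
  ext n
  simp [conj, OnePlus.ser_one]

theorem conj_X_mul (x : Ext ρ) (p : A⟦X⟧) :
    conj x (PowerSeries.X * p) = PowerSeries.X * conj x p := by
  rw [conj_mul]
  congr 1
  rw [conj, PowerSeries.map_X, (PowerSeries.commute_X x.left.ser).eq, mul_assoc,
    OnePlus.ser_mul_inv, mul_one]

theorem conj_C_algebraMap (x : Ext ρ) (t : ℂ) :
    conj x (PowerSeries.C (algebraMap ℂ A t)) = PowerSeries.C (algebraMap ℂ A t) := by
  have h : Commute (PowerSeries.C (algebraMap ℂ A t)) x.left.ser := by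
    apply commute_of_coeff
    intro n m
    exact coeff_C_commute (Algebra.commutes t _) n
  rw [conj, PowerSeries.map_C]
  have h2 : (ρ x.right : A →+* A) (algebraMap ℂ A t) = algebraMap ℂ A t :=
    (ρ x.right).commutes t
  rw [h2, ← h.eq, mul_assoc, OnePlus.ser_mul_inv, mul_one]

theorem constantCoeff_conj_C (x : Ext ρ) (u : A) :
    constantCoeff (conj x (PowerSeries.C u)) = ρ x.right u := by
  rw [conj, map_mul, map_mul, OnePlus.constantCoeff_ser, OnePlus.constantCoeff_ser,
    PowerSeries.map_C, constantCoeff_C, one_mul, mul_one]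
  rfl

/-- Conjugation preserves `B[[ℏ]]` on the algebra generated by `s` if it does so on `s`. -/
theorem coeff_conj_C_mem (x : Ext ρ) (B : Subalgebra ℂ A) {s : Set A}
    (hs : ∀ u ∈ s, ∀ n, coeff n (conj x (PowerSeries.C u)) ∈ B) {u : A}
    (hu : u ∈ Algebra.adjoin ℂ s) : ∀ n, coeff n (conj x (PowerSeries.C u)) ∈ B := by
  induction hu using Algebra.adjoin_induction with
  | mem u hu => exact hs u hu
  | algebraMap t =>
    intro n
    rw [conj_C_algebraMap, coeff_C]
    split_ifs
    · exact B.algebraMap_mem t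
    · exact B.zero_mem
  | add u v _ _ hu hv =>
    intro n
    rw [map_add, ← conjHom_apply, map_add, map_add]
    exact B.add_mem (hu n) (hv n)
  | mul u v _ _ hu hv =>
    intro n
    rw [map_mul, conj_mul, coeff_mul]
    exact B.sum_mem fun m _ => B.mul_mem (hu _) (hv _)

end Conjugation

/-! ### Realization of `f`, holomorphy and counit of `x`. -/

section Properties

open TopologicalSpace PowerSeries Algebra.TensorProduct

variable {E : Type*} [NormedAddCommGroup E] [NormedSpace ℂ E] [CompleteSpace E]
  [FiniteDimensional ℂ E]
  {G : Type*} [TopologicalSpace G] [ChartedSpace E G] [Group G] [LieGroup 𝓘(ℂ, E) ω G]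
  {a : LieSubalgebra ℂ (LieAlg E G)} [IsLieAbelian a] {r : ℕ} (b : Module.Basis (Fin r) ℂ a)
  {g : (Fin r → ℂ) → (Fin r → ℂ) → G} {U : Opens ((Fin r → ℂ) × (Fin r → ℂ))}
  (hφ : ∀ z ∈ U, GHolAt E (fun z : (Fin r → ℂ) × (Fin r → ℂ) => (g z.1 z.2)⁻¹) z)
  {f : (Fin r → ℂ) → (Fin r → ℂ)}
  {D : Opens (Fin r → ℂ)} (hD : ∀ p ∈ D, (p, p) ∈ U)
  (hUD : ∀ z ∈ U, z.1 ∈ D ∧ z.2 ∈ D) (hf : AnalyticOnNhd ℂ f D) (hI : Intertwines b g f U)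

include hI in
theorem conj_quasiGrouplike_hvec {p : Fin r → ℂ} (hp : p ∈ D) (i : Fin r) :
    conj (quasiGrouplike b g p) (PowerSeries.C (hvec b i)) = adTaylor b hφ (hD p hp) i := by
  have h := hvec_mul_serX b hφ hI (hD p hp) i
  rw [← normX_ser b hφ (hD p hp)] at h
  rw [conj, quasiGrouplike_eq]
  change (normX b g p)⁻¹.ser * PowerSeries.map _ (PowerSeries.C (hvec b i)) *
    ((normX b g p)⁻¹⁻¹).ser = _
  rw [PowerSeries.map_C, inv_inv, mul_assoc]
  refine (congrArg _ h).trans ?_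
  rw [← mul_assoc, OnePlus.ser_inv_mul, one_mul]

variable (a) in
/-- The subalgebra `U(𝔞)` of `U(𝔤)`. -/
abbrev envSub : Subalgebra ℂ (Env E G) :=
  Algebra.adjoin ℂ ((fun y => iota (LieAlg E G) y) '' (a : Set (LieAlg E G)))

theorem hvec_mem_envSub (i : Fin r) : hvec b i ∈ envSub a :=
  Algebra.subset_adjoin ⟨_, (b i).2, rfl⟩

include hI in
theorem coeff_adTaylor_mem {p : (Fin r → ℂ) × (Fin r → ℂ)} (hp : p ∈ U) (i : Fin r) (n : ℕ) :
    coeff n (adTaylor b hφ hp i) ∈ envSub a := by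
  refine coeff_taylor_mem hp (dirSnd r) (envSub a) (hvec_mem_envSub b)
    (t' := ∑ k, adCoord hφ b (yvec b i) k ⊗ₜ ⟨hvec b k, hvec_mem_envSub b k⟩) ?_ n
  rw [adSec_basis_eq_sum b hφ hI, map_sum]
  rfl

include hφ hI hD in
theorem coeff_conj_mem {p : Fin r → ℂ} (hp : p ∈ D) {u : Env E G} (hu : u ∈ envSub a) (n : ℕ) :
    coeff n (conj (quasiGrouplike b g p) (PowerSeries.C u)) ∈ envSub a := by
  refine coeff_conj_C_mem _ (envSub a) ?_ hu n
  rintro _ ⟨y, hy, rfl⟩ n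
  have e : iota (LieAlg E G) y = ∑ k, b.repr ⟨y, hy⟩ k • hvec b k := iotaVec_eq_sum b ⟨y, hy⟩
  simp only [e]
  rw [map_sum, ← conjHom_apply, map_sum, map_sum]
  refine Subalgebra.sum_mem _ fun k _ => ?_
  have e2 : PowerSeries.C (b.repr ⟨y, hy⟩ k • hvec b k) =
      PowerSeries.C (algebraMap ℂ (Env E G) (b.repr ⟨y, hy⟩ k)) * PowerSeries.C (hvec b k) := by
    rw [← map_mul, Algebra.smul_def]
  rw [e2, conjHom_apply, conj_mul, conj_C_algebraMap, coeff_C_mul,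
    conj_quasiGrouplike_hvec b hφ hD hI hp]
  exact Subalgebra.mul_mem _ (Subalgebra.algebraMap_mem _ _) (coeff_adTaylor_mem b hφ hI _ _ _)

theorem AdEnv_mem_envSub {γ : G}
    (h : ∀ y : E, (y : LieAlg E G) ∈ a → (adVec E γ y : LieAlg E G) ∈ a) {u : Env E G}
    (hu : u ∈ envSub a) : AdEnv γ u ∈ envSub a := by
  induction hu using Algebra.adjoin_induction with
  | mem u hu =>
    obtain ⟨y, hy, rfl⟩ := hu
    exact Algebra.subset_adjoin ⟨AdLin E γ y, h y hy, (AdEnv_iota γ y).symm⟩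
  | algebraMap t => rw [AlgHom.commutes]; exact Subalgebra.algebraMap_mem _ _
  | add u v _ _ hu hv => rw [map_add]; exact Subalgebra.add_mem _ hu hv
  | mul u v _ _ hu hv => rw [map_mul]; exact Subalgebra.mul_mem _ hu hv

include hφ hI hD in
theorem conj_image {p : Fin r → ℂ} (hp : p ∈ D) :
    conj (quasiGrouplike b g p) '' seriesOver a = seriesOver a := by
  set x := quasiGrouplike b g p with hx
  refine image_series_eq (envSub a) (conjHom x) (conjHom x⁻¹) (fun q => ?_) (fun q => ?_)
    (conj_X_mul x) (conj_X_mul x⁻¹) (fun u hu n => coeff_conj_mem b hφ hD hI hp hu n)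
    fun v hv => ?_
  · rw [conjHom_apply, conjHom_apply, conj_conj, mul_inv_cancel, conj_one]
  · rw [conjHom_apply, conjHom_apply, conj_conj, inv_mul_cancel, conj_one]
  -- Modulo `ℏ`, conjugation by `x` is `Ad_{g(p,p)}`, which dictates the preimage.
  · refine ⟨AdEnv (g p p)⁻¹ v, AdEnv_mem_envSub (fun y hy => ?_) hv, ?_⟩
    · exact adVec_inv_mem (hI.mem _ (hD p hp)) hy
    · rw [conjHom_apply, constantCoeff_conj_C]
      have hr : x.right = g p p := by rw [hx, quasiGrouplike_eq]
      rw [hr]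
      change AdEnv (g p p) (AdEnv (g p p)⁻¹ v) = v
      rw [← AlgHom.comp_apply, ← AdEnv_mul, mul_inv_cancel, AdEnv_one, AlgHom.id_apply]

include hφ hI hD hUD hf in
theorem realizes : Realizes b (quasiGrouplike b g) f D where
  normalizes p hp := conj_image b hφ hD hI hp
  conj_eq p hp i := by
    rw [conj_quasiGrouplike_hvec b hφ hD hI hp, X_mul_adTaylor b hφ hD hUD hf hp hI]

/-! #### Counits -/

theorem map_serX_eq_one {C : Type*} [Ring C] [Algebra ℂ C] (e : Env E G →ₐ[ℂ] C) (hε : ∀ y, e (iotaVec E G y) = 0) :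
    PowerSeries.map (lT (Hol U) e).toRingHom (serX hφ (dirSnd r) (hvec b)) = 1 := by
  rw [map_serX, connMap_eq_zero hφ hε, expS_one_of_zero]

include hφ hD in
theorem counit_left_series {p : Fin r → ℂ} (hp : p ∈ D) :
    PowerSeries.map (counit (LieAlg E G)).toRingHom (quasiGrouplike b g p).left.ser = 1 := by
  have h1 : (quasiGrouplike b g p).left = (normX b g p)⁻¹ := by rw [quasiGrouplike_eq]
  have h2 : PowerSeries.map (counit (LieAlg E G)).toRingHom (normX b g p).ser = 1 := by
    rw [normX_ser b hφ (hD p hp), ← evS_map, map_serX_eq_one b hφ _ counit_iotaVec, evS_one]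
  have h3 := congrArg (PowerSeries.map (counit (LieAlg E G)).toRingHom) (normX b g p).ser_inv_mul
  rw [map_mul, h2, mul_one, map_one] at h3
  rw [h1, h3]

include hφ hD in
theorem holSeriesOn_left : HolSeriesOn (fun p => (quasiGrouplike b g p).left.ser) D := by
  refine holSeriesOn_affine (p₀ := 0) (L := diagL r) (ι := fun q => (q, q))
    (fun q => by simp [diagL]) hD (t := invX b hφ) fun q hq => ?_
  rw [quasiGrouplike_eq, ← normX_inv_ser b hφ (hD q hq)]

include hφ hD in
theorem holSeriesOn_transform : HolSeriesOn (transform b (quasiGrouplike b g)) D :=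
  holSeriesOn_affine (p₀ := 0) (L := diagL r) (ι := fun q => (q, q))
    (fun q => by simp [diagL]) hD fun _ hq => transform_eq_evS b hφ hD hq

/-- `ε ⊗ id` -/
abbrev epsLeft (E G : Type*) [NormedAddCommGroup E] [NormedSpace ℂ E] [CompleteSpace E]
    [TopologicalSpace G] [ChartedSpace E G] [Group G] [LieGroup 𝓘(ℂ, E) ω G] :
    Env E G ⊗[ℂ] Env E G →ₐ[ℂ] Env E G :=
  (Algebra.TensorProduct.lid ℂ (Env E G)).toAlgHom.comp
    (Algebra.TensorProduct.map (counit (LieAlg E G)) (AlgHom.id ℂ (Env E G)))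

/-- `id ⊗ ε` -/
abbrev epsRight (E G : Type*) [NormedAddCommGroup E] [NormedSpace ℂ E] [CompleteSpace E]
    [TopologicalSpace G] [ChartedSpace E G] [Group G] [LieGroup 𝓘(ℂ, E) ω G] :
    Env E G ⊗[ℂ] Env E G →ₐ[ℂ] Env E G :=
  (Algebra.TensorProduct.rid ℂ ℂ (Env E G)).toAlgHom.comp
    (Algebra.TensorProduct.map (AlgHom.id ℂ (Env E G)) (counit (LieAlg E G)))

theorem epsLeft_tmul (u v : Env E G) :
    epsLeft E G (u ⊗ₜ v) = counit (LieAlg E G) u • v := by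
  simp [epsLeft]

theorem epsRight_tmul (u v : Env E G) :
    epsRight E G (u ⊗ₜ v) = counit (LieAlg E G) v • u := by
  simp [epsRight]

theorem epsLeft_comul (u : Env E G) : epsLeft E G (comul (LieAlg E G) u) = u := by
  refine DFunLike.congr_fun (f := (epsLeft E G).comp (comul (LieAlg E G))) (g := AlgHom.id ℂ _)
    (env_hom_ext fun y => ?_) u
  rw [AlgHom.comp_apply, comul_iotaVec, map_add, epsLeft_tmul, epsLeft_tmul, counit_iotaVec]
  simp

theorem epsRight_comul (u : Env E G) : epsRight E G (comul (LieAlg E G) u) = u := by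
  refine DFunLike.congr_fun (f := (epsRight E G).comp (comul (LieAlg E G))) (g := AlgHom.id ℂ _)
    (env_hom_ext fun y => ?_) u
  rw [AlgHom.comp_apply, comul_iotaVec, map_add, epsRight_tmul, epsRight_tmul, counit_iotaVec]
  simp

theorem map_lT_id {C : Type*} [Ring C] [Algebra ℂ C] {e : C →ₐ[ℂ] C} (h : ∀ c, e c = c)
    (F : (Hol U ⊗[ℂ] C)⟦X⟧) : PowerSeries.map (lT (Hol U) e).toRingHom F = F := by
  obtain rfl : e = AlgHom.id ℂ C := AlgHom.ext h
  ext n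
  simp

end Properties

end VertexIRF

namespace VertexIRF

set_option linter.unusedSectionVars false

/-! ### Counits and twist equation for the transform. -/

section TwistProperties

open TopologicalSpace PowerSeries Algebra.TensorProduct

variable {E : Type*} [NormedAddCommGroup E] [NormedSpace ℂ E] [CompleteSpace E]
  [FiniteDimensional ℂ E]
  {G : Type*} [TopologicalSpace G] [ChartedSpace E G] [Group G] [LieGroup 𝓘(ℂ, E) ω G]
  {a : LieSubalgebra ℂ (LieAlg E G)} [IsLieAbelian a] {r : ℕ} (b : Module.Basis (Fin r) ℂ a)
  {g : (Fin r → ℂ) → (Fin r → ℂ) → G} {U : Opens ((Fin r → ℂ) × (Fin r → ℂ))}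
  (hφ : ∀ z ∈ U, GHolAt E (fun z : (Fin r → ℂ) × (Fin r → ℂ) => (g z.1 z.2)⁻¹) z)
  {D : Opens (Fin r → ℂ)} (hD : ∀ p ∈ D, (p, p) ∈ U)

/-- The two counit identities are treated together: `e` is `ε ⊗ id` or `id ⊗ ε`, and `e ∘ Δ = id` is
all that is needed to reduce the factor `Δ(X)⁻¹` to `X⁻¹`. -/
theorem map_evS_serJ (e : Env E G ⊗[ℂ] Env E G →ₐ[ℂ] Env E G)
    (he : ∀ u, e (comul (LieAlg E G) u) = u) {p : (Fin r → ℂ) × (Fin r → ℂ)} (hp : p ∈ U) :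
    PowerSeries.map e.toRingHom (evS _ hp (serJ b hφ)) = evS _ hp (invX b hφ) *
      evS _ hp (PowerSeries.map (lT (Hol U) (e.comp includeRight)).toRingHom
        (serX hφ (dirSnd r) (hvec b))) *
      (evS _ hp (expS (op (holDir U) (connMap hφ (e.comp includeLeft)) (dirDiag r)
        (fun i => e (1 ⊗ₜ hvec b i))) 1) *
      evS _ hp (expS (op (holDir U) 0 (dirDiag r) (fun i => e (1 ⊗ₜ hvec b i)))
        (PowerSeries.map (lT (Hol U) (e.comp includeLeft)).toRingHom
          (serX hφ (dirSnd r) (hvec b))))) := by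
  rw [serJ, evS_mul, evS_mul, evS_normM, map_mul, map_mul, map_mul]
  congr 1
  · congr 1
    · rw [← evS_map, map_map_lT (f'' := AlgHom.id ℂ _) he, map_lT_id fun _ => rfl]
    · rw [← evS_map, map_map_lT (f'' := e.comp includeRight) fun _ => rfl]
  · congr 1
    · rw [evS_expS_map e (θ' := connMap hφ (e.comp includeLeft))
        (c' := fun i => e (1 ⊗ₜ hvec b i)) (fun _ => rfl) (fun w => lT_connMap hφ e _ w), map_one]
    · rw [evS_expS_map e (θ := 0) (θ' := 0) (c' := fun i => e (1 ⊗ₜ hvec b i)) (fun _ => rfl)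
        (fun w => by simp), map_map_lT (f'' := e.comp includeLeft) fun _ => rfl]

theorem evS_invX_mul_serX {p : (Fin r → ℂ) × (Fin r → ℂ)} (hp : p ∈ U) :
    evS _ hp (invX b hφ) * evS _ hp (serX hφ (dirSnd r) (hvec b)) = 1 := by
  rw [← evS_mul, invX_mul_serX, evS_one]

include hφ hD in
theorem transform_counit_left {p : Fin r → ℂ} (hp : p ∈ D) :
    PowerSeries.map (epsLeft E G).toRingHom (transform b (quasiGrouplike b g) p) = 1 := by
  have h1 : ∀ y, ((epsLeft E G).comp includeLeft) (iotaVec E G y) = 0 := fun y => by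
    rw [AlgHom.comp_apply, includeLeft_apply, epsLeft_tmul, counit_iotaVec, zero_smul]
  have h2 : ∀ u, ((epsLeft E G).comp includeRight) u = u := fun u => by
    rw [AlgHom.comp_apply, includeRight_apply, epsLeft_tmul, map_one, one_smul]
  rw [transform_eq_evS b hφ hD hp, map_evS_serJ b hφ _ epsLeft_comul, map_lT_id h2,
    connMap_eq_zero hφ h1, map_serX_eq_one b hφ _ h1, expS_one_of_zero, evS_one, mul_one, mul_one,
    evS_invX_mul_serX]

include hφ hD in
theorem transform_counit_right {p : Fin r → ℂ} (hp : p ∈ D) :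
    PowerSeries.map (epsRight E G).toRingHom (transform b (quasiGrouplike b g) p) = 1 := by
  have h1 : ∀ y, ((epsRight E G).comp includeRight) (iotaVec E G y) = 0 := fun y => by
    rw [AlgHom.comp_apply, includeRight_apply, epsRight_tmul, counit_iotaVec, zero_smul]
  have h2 : ∀ u, ((epsRight E G).comp includeLeft) u = u := fun u => by
    rw [AlgHom.comp_apply, includeLeft_apply, epsRight_tmul, map_one, one_smul]
  -- The counit kills `h⁽²⁾`, so both exponentials along the diagonal act as the identity. The
  -- surviving `X` cancels `X⁻¹`.
  have h3 : ∀ i, epsRight E G (1 ⊗ₜ hvec b i) = 0 := fun i => by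
    rw [epsRight_tmul, counit_hvec, zero_smul]
  have h4 : ∀ (θ : (Fin r → ℂ) × (Fin r → ℂ) →ₗ[ℂ] Hol U ⊗[ℂ] Env E G) (F : (Hol U ⊗[ℂ] Env E G)⟦X⟧),
      expS (op (holDir U) θ (dirDiag r) (fun i => epsRight E G (1 ⊗ₜ hvec b i))) F = F :=
    fun θ F => expS_of_forall_eq_zero fun n => by simp [op_apply, h3]
  rw [transform_eq_evS b hφ hD hp, map_evS_serJ b hφ _ epsRight_comul, map_serX_eq_one b hφ _ h1,
    map_lT_id h2, h4, h4, evS_one, mul_one, one_mul, evS_invX_mul_serX]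

include hφ hD in
theorem transform_twist {p : Fin r → ℂ} (hp : p ∈ D)
    (hcomm : ∀ n i, Commute (coeff n (transform b (quasiGrouplike b g) p))
      (comul (LieAlg E G) (hvec b i))) :
    PowerSeries.map (envLegs E G).D₁₂.toRingHom (transform b (quasiGrouplike b g) p) *
      shiftSeries (transform b (quasiGrouplike b g)) p (fun i => -dualVec i) (hvec b) =
    PowerSeries.map (envLegs E G).D₂₃.toRingHom (transform b (quasiGrouplike b g) p) *
      PowerSeries.map (envLegs E G).k₂₃.toRingHom (transform b (quasiGrouplike b g) p) := by
  rw [transform_eq_evS b hφ hD hp] at hcomm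
  have h := twist_of_eq (envLegs E G) hφ (dirSnd r) (dirDiag r) (hvec_commute b)
    (fun y => comul_iotaVec y) (fun i => comul_hvec b i) (hD p hp) (map_comul_mul_serJ b hφ)
    hcomm (by rw [← normX_ser b hφ (hD p hp)]; exact OnePlus.isUnit_ser _)
  rw [transform_eq_evS b hφ hD hp, ← h]
  congr 1
  have h2 := shiftSeries_affine (p₀ := 0) (L := diagL r) (ι := fun q => (q, q))
    (fun q => by simp [diagL]) hD (fun _ hq => transform_eq_evS b hφ hD hq) hp
    (fun i => -dualVec i) (hvec b)
  refine h2.trans ?_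
  have h3 : ∀ i, (envLegs E G).k₂₃ ((envLegs E G).i₂ (hvec b i)) = 1 ⊗ₜ hvec b i := fun i => by
    simp [envLegs, Algebra.TensorProduct.one_def]
  simp only [h3]
  rfl

theorem mem_coe_a_eq_sum (y : LieAlg E G) (hy : y ∈ a) :
    comul (LieAlg E G) (iota (LieAlg E G) y) =
      ∑ k, b.repr ⟨y, hy⟩ k • comul (LieAlg E G) (hvec b k) := by
  have e : iota (LieAlg E G) y = ∑ k, b.repr ⟨y, hy⟩ k • hvec b k := iotaVec_eq_sum b ⟨y, hy⟩
  rw [e, map_sum]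
  simp only [map_smul]

theorem zeroWeightOn_of_commute {J : (Fin r → ℂ) → (Env E G ⊗[ℂ] Env E G)⟦X⟧}
    {D : Set (Fin r → ℂ)}
    (h : ∀ p ∈ D, ∀ n i, Commute (coeff n (J p)) (comul (LieAlg E G) (hvec b i))) :
    ZeroWeightOn a J D := by
  intro p hp y hy
  ext n
  rw [coeff_C_mul, coeff_mul_C, mem_coe_a_eq_sum b y hy]
  exact (Commute.sum_left _ _ _ fun k _ => ((h p hp n k).symm.smul_left _)).eq

end TwistProperties

end VertexIRF

namespace VertexIRF

set_option linter.unusedSectionVars false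

/-! ### Normally ordered expressions in two factors and their weight. -/

section NormalOrdering

open TopologicalSpace PowerSeries Algebra.TensorProduct

theorem lL_mul'_mul {O A : Type*} [CommRing O] [Algebra ℂ O] [Ring A] [Algebra ℂ A] (t : O ⊗[ℂ] A)
    (x : O ⊗[ℂ] (A ⊗[ℂ] A)) :
    lL O (LinearMap.mul' ℂ A) (lT O (includeLeft : A →ₐ[ℂ] A ⊗[ℂ] A) t * x) =
      t * lL O (LinearMap.mul' ℂ A) x := by
  induction t with
  | zero => simp
  | add t t' ht ht' => simp only [map_add, add_mul, ht, ht']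
  | tmul f u =>
    induction x with
    | zero => simp
    | add x x' hx hx' => simp only [map_add, mul_add, hx, hx']
    | tmul f' v =>
      simp only [Algebra.TensorProduct.map_tmul, AlgHom.id_apply, includeLeft_apply,
        tmul_mul_tmul, LinearMap.lTensor_tmul, mul'_tmul_one_mul]

variable {E : Type*} [NormedAddCommGroup E] [NormedSpace ℂ E] [CompleteSpace E]
  [FiniteDimensional ℂ E]
  {G : Type*} [TopologicalSpace G] [ChartedSpace E G] [Group G] [LieGroup 𝓘(ℂ, E) ω G]
  {a : LieSubalgebra ℂ (LieAlg E G)} [IsLieAbelian a] {r : ℕ} (b : Module.Basis (Fin r) ℂ a)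

/-- The coordinate directions of `𝔞* × 𝔞*`. -/
abbrev dirs₂ (r : ℕ) : Fin r ⊕ Fin r → (Fin r → ℂ) × (Fin r → ℂ) :=
  Sum.elim (fun i => (dualVec i, 0)) (fun i => (0, dualVec i))

/-- The elements `h^{(1)}` and `h^{(2)}`. -/
abbrev coef₂ : Fin r ⊕ Fin r → Env E G ⊗[ℂ] Env E G :=
  Sum.elim (fun i => hvec b i ⊗ₜ[ℂ] 1) (fun i => 1 ⊗ₜ[ℂ] hvec b i)

theorem coef₂_commute (i j : Fin r ⊕ Fin r) : Commute (coef₂ b i) (coef₂ b j) := by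
  rcases i with i | i <;> rcases j with j | j <;>
    simp [Commute, SemiconjBy, (hvec_commute b i j).eq]

variable {V : Opens ((Fin r → ℂ) × (Fin r → ℂ))} {φ₁ φ₂ : (Fin r → ℂ) × (Fin r → ℂ) → G}
  (h₁ : ∀ z ∈ V, GHolAt E φ₁ z) (h₂ : ∀ z ∈ V, GHolAt E φ₂ z) (h0 : 0 ∈ V)

/-- The connection of the pair `(φ₁, φ₂)` in `G × G`. -/
abbrev pairConn {P : Type*} [NormedAddCommGroup P] [NormedSpace ℂ P] {V : Opens P} {φ₁ φ₂ : P → G}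
    (h₁ : ∀ z ∈ V, GHolAt E φ₁ z) (h₂ : ∀ z ∈ V, GHolAt E φ₂ z) :
    P →ₗ[ℂ] Hol V ⊗[ℂ] (Env E G ⊗[ℂ] Env E G) :=
  connMap h₁ includeLeft + connMap h₂ includeRight

include h0 in
theorem map_twoShift {C : Type*} [Ring C] [Algebra ℂ C]
    (f : Env E G ⊗[ℂ] (Env E G ⊗[ℂ] Env E G) →ₐ[ℂ] C) {c : Fin r ⊕ Fin r → C}
    (hc : ∀ j, f (1 ⊗ₜ coef₂ b j) = c j) :
    PowerSeries.map f.toRingHom (twoShift b φ₁).ser =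
      evS C h0 (expS (op (holDir V) (connMap h₁ (f.comp includeLeft)) (dirs₂ r) c) 1) := by
  rw [twoShift, groupShift_ser h₁ h0 _ (coef₂_commute b)]
  exact (evS_expS_map f hc (fun w => lT_connMap h₁ _ _ w) h0 1).trans (by rw [map_one])

/-- The two components take values in commuting tensor factors, so the product of their expansions
is the transport of one connection for the pair in `G × G`. Normal ordering is left linear and
multiplies the expansion variables on the right, so it carries this transport to the one in `U(𝔤) ⊗
U(𝔤)`. -/
theorem normalOrdered₂_eq : normalOrdered₂ b φ₁ φ₂ =
    evS _ h0 (expS (op (holDir V) (pairConn h₁ h₂) (dirs₂ r) (coef₂ b)) 1) := by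
  set f₁ := Algebra.TensorProduct.map (includeLeft : Env E G →ₐ[ℂ] Env E G ⊗[ℂ] Env E G)
        (AlgHom.id ℂ (Env E G ⊗[ℂ] Env E G)) with hf₁
  set f₂ := Algebra.TensorProduct.map (includeRight : Env E G →ₐ[ℂ] Env E G ⊗[ℂ] Env E G)
        (AlgHom.id ℂ (Env E G ⊗[ℂ] Env E G)) with hf₂
  have e₁ := map_twoShift b h₁ h0 f₁ (c := fun j => 1 ⊗ₜ coef₂ b j)
    (fun j => by rw [hf₁, Algebra.TensorProduct.map_tmul, map_one]; rfl)
  have e₂ := map_twoShift b h₂ h0 f₂ (c := fun j => 1 ⊗ₜ coef₂ b j)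
    (fun j => by rw [hf₂, Algebra.TensorProduct.map_tmul, map_one]; rfl)
  have e₃ := evS_connMap_add h₁ h₂ (j₁ := f₁.comp includeLeft) (j₂ := f₂.comp includeLeft)
    (w := dirs₂ r) (c := fun j => 1 ⊗ₜ coef₂ b j) (fun u v => by
      simp [hf₁, hf₂, Commute, SemiconjBy]) (fun i k => one_tmul_commute (coef₂_commute b i k))
    (fun i u => by simp [hf₂, Commute, SemiconjBy]) h0 (q := 1)
    (fun n i => coeff_one_commute _ _)
  rw [normalOrdered₂, normalOrder, ← hf₁, ← hf₂, e₁, e₂, ← e₃, evS_mapLin_lL,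
    mapLin_expS (T' := op (holDir V) (pairConn h₁ h₂) (dirs₂ r) (coef₂ b))]
  · congr 2
    ext n
    rw [coeff_mapLin, coeff_one, coeff_one]
    split_ifs
    · rw [Algebra.TensorProduct.one_def, LinearMap.lTensor_tmul, Algebra.TensorProduct.one_def,
        LinearMap.mul'_apply, mul_one]
      rfl
    · rw [map_zero]
  · refine lL_op (fun j x => mul'_mul_one_tmul _ _) fun j x => ?_
    have h : ∀ w, connMap h₁ (f₁.comp includeLeft) w + connMap h₂ (f₂.comp includeLeft) w =
        lT (Hol V) (includeLeft : _ →ₐ[ℂ] (Env E G ⊗[ℂ] Env E G) ⊗[ℂ] (Env E G ⊗[ℂ] Env E G))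
          (pairConn h₁ h₂ w) := by
      intro w
      rw [pairConn, LinearMap.add_apply, map_add, lT_connMap, lT_connMap]
      congr 1
    rw [LinearMap.add_apply, h, lL_mul'_mul]

variable (m₁ : ∀ z ∈ V, ∀ y : E, (y : LieAlg E G) ∈ a → (adVec E (φ₁ z)⁻¹ y : LieAlg E G) ∈ a)
  (m₂ : ∀ z ∈ V, ∀ y : E, (y : LieAlg E G) ∈ a → (adVec E (φ₂ z)⁻¹ y : LieAlg E G) ∈ a)
  (hp : ∀ z ∈ V, ∀ y : E, (y : LieAlg E G) ∈ a → pairing b z.1 (adVec E (φ₁ z)⁻¹ y) +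
    pairing b z.2 (adVec E (φ₂ z)⁻¹ y) = pairing b (z.1 + z.2) y)
  (e₁ : φ₁ 0 = 1) (e₂ : φ₂ 0 = 1)

theorem analyticAt_fst_apply (k : Fin r) (z : (Fin r → ℂ) × (Fin r → ℂ)) :
    AnalyticAt ℂ (fun z : (Fin r → ℂ) × (Fin r → ℂ) => z.1 k) z :=
  ((ContinuousLinearMap.proj (R := ℂ) k).comp (ContinuousLinearMap.fst ℂ _ _)).analyticAt z

theorem analyticAt_snd_apply (k : Fin r) (z : (Fin r → ℂ) × (Fin r → ℂ)) :
    AnalyticAt ℂ (fun z : (Fin r → ℂ) × (Fin r → ℂ) => z.2 k) z :=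
  ((ContinuousLinearMap.proj (R := ℂ) k).comp (ContinuousLinearMap.snd ℂ _ _)).analyticAt z

/-- The linear coordinate functions on `𝔞* × 𝔞*`. -/
def coordHol₂ (V : Opens ((Fin r → ℂ) × (Fin r → ℂ))) : Fin r ⊕ Fin r → Hol V :=
  Sum.elim
    (fun k => toHol V (fun z => z.1 k) fun z _ => analyticAt_fst_apply k z)
    (fun k => toHol V (fun z => z.2 k) fun z _ => analyticAt_snd_apply k z)

theorem taylor_coordHol₂ {C : Type*} [Ring C] [Algebra ℂ C] (c : Fin r ⊕ Fin r → C)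
    (k : Fin r ⊕ Fin r) : taylor h0 (dirs₂ r) c (coordHol₂ V k ⊗ₜ 1) =
      PowerSeries.X * PowerSeries.C (c k) := by
  rcases k with k | k
  · refine (taylor_toHol_affine (hF := fun z _ => analyticAt_fst_apply k z) h0 (dirs₂ r) c (F₀ := 0)
      (L := (ContinuousLinearMap.proj (R := ℂ) k).comp (ContinuousLinearMap.fst ℂ _ _))
      (fun q => by simp)).trans ?_
    simp [dualVec, Pi.single_apply]
  · refine (taylor_toHol_affine (hF := fun z _ => analyticAt_snd_apply k z) h0 (dirs₂ r) c (F₀ := 0)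
      (L := (ContinuousLinearMap.proj (R := ℂ) k).comp (ContinuousLinearMap.snd ℂ _ _))
      (fun q => by simp)).trans ?_
    simp [dualVec, Pi.single_apply]

/-- The element `Ad_{φ₁⁻¹} y ⊗ 1 + 1 ⊗ Ad_{φ₂⁻¹} y`. -/
def pairSec (y : E) : Hol V ⊗[ℂ] (Env E G ⊗[ℂ] Env E G) :=
  lT (Hol V) includeLeft (adSec h₁ y) + lT (Hol V) includeRight (adSec h₂ y)

theorem dT_pairSec (y : E) (w : (Fin r → ℂ) × (Fin r → ℂ)) :
    dT (holDir V) _ w (pairSec h₁ h₂ y) =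
      pairSec h₁ h₂ y * pairConn h₁ h₂ w - pairConn h₁ h₂ w * pairSec h₁ h₂ y := by
  have c₁ : ∀ s t, Commute (lT (Hol V) (includeLeft : Env E G →ₐ[ℂ] Env E G ⊗[ℂ] Env E G) s)
      (lT (Hol V) (includeRight : Env E G →ₐ[ℂ] Env E G ⊗[ℂ] Env E G) t) := fun s t =>
    lT_commute (fun u v => includeLeft_commute_tmul u v) s t
  rw [pairSec, map_add, ← lT_dT, ← lT_dT, dT_adSec, dT_adSec, map_sub, map_sub, map_mul, map_mul,
    map_mul, map_mul, pairConn, LinearMap.add_apply, connMap_apply, connMap_apply]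
  simp only [add_mul, mul_add]
  rw [(c₁ (adSec h₁ y) (conn V φ₂ h₂ w)).eq, (c₁ (conn V φ₁ h₁ w) (adSec h₂ y)).eq]
  abel

include m₁ m₂ in
theorem pairSec_eq_sum {y : E} (hy : (y : LieAlg E G) ∈ a) : pairSec h₁ h₂ y =
    ∑ k, Sum.elim (adCoord h₁ b y) (adCoord h₂ b y) k ⊗ₜ coef₂ b k := by
  rw [pairSec, adSec_eq_sum h₁ b fun z hz => m₁ z hz y hy,
    adSec_eq_sum h₂ b fun z hz => m₂ z hz y hy, map_sum, map_sum, Fintype.sum_sum_type]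
  simp

include hp in
theorem adCoord₂_sum {y : E} (hy : (y : LieAlg E G) ∈ a) :
    ∑ k, Sum.elim (adCoord h₁ b y) (adCoord h₂ b y) k * coordHol₂ V k =
      ∑ k, extCoord b k y • (coordHol₂ V (Sum.inl k) + coordHol₂ V (Sum.inr k)) := by
  have key : ∀ z (hz : z ∈ V),
      evp hz (∑ k, Sum.elim (adCoord h₁ b y) (adCoord h₂ b y) k * coordHol₂ V k) =
      evp hz (∑ k, extCoord b k y • (coordHol₂ V (Sum.inl k) + coordHol₂ V (Sum.inr k))) := by
    intro z hz
    have h := hp z hz y hy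
    rw [map_sum, map_sum, Fintype.sum_sum_type]
    simp only [map_mul, map_smul, map_add]
    exact h
  apply Subtype.ext
  funext z
  exact key z z.2

include h₁ h₂ h0 m₁ m₂ hp e₁ e₂ in
/-- The normally ordered element has zero weight. -/
theorem coeff_normalOrdered₂_commute (n : ℕ) (i : Fin r) :
    Commute (coeff n (normalOrdered₂ b φ₁ φ₂)) (comul (LieAlg E G) (hvec b i)) := by
  have hY := pairSec_eq_sum b h₁ h₂ m₁ m₂ (yvec_mem b i)
  have h := evS_expS_intertwine (θ := pairConn h₁ h₂) (w := dirs₂ r) (c := coef₂ b)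
    (coef₂_commute b) (V := pairSec h₁ h₂ (yvec b i)) (fun j => dT_pairSec h₁ h₂ _ _) (fun j => by
      rw [hY]
      exact Commute.sum_left _ _ _ fun k _ => tmul_commute_tmul (coef₂_commute b k j) _ _) h0
  rw [← normalOrdered₂_eq b h₁ h₂ h0] at h
  -- At the origin both components equal `1`, so the section starts at `Δ(y_i)`.
  have h3 : evT _ (evp h0) (pairSec h₁ h₂ (yvec b i)) = comul (LieAlg E G) (hvec b i) := by
    rw [pairSec, map_add, evT_lT, evT_lT, evT_adSec, evT_adSec, e₁, e₂, inv_one, adVec_one,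
      comul_hvec]
    rfl
  have h4 : taylor h0 (dirs₂ r) (coef₂ b) (pairSec h₁ h₂ (yvec b i)) =
      PowerSeries.C (comul (LieAlg E G) (hvec b i)) := by
    -- By `hp`, the coordinates of the section paired with `(z₁, z₂)` give the linear function `(z₁
    -- + z₂)(y_i)`, which expands to `ℏ Δ(y_i)`. After cancelling `ℏ`, the section expands to the
    -- constant `Δ(y_i)`, and the intertwining relation becomes commutation.
    have hX : PowerSeries.X * taylor h0 (dirs₂ r) (coef₂ b) (pairSec h₁ h₂ (yvec b i)) =
        PowerSeries.X * PowerSeries.C (comul (LieAlg E G) (hvec b i)) := by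
      rw [hY, X_mul_taylor_sum h0 (coef₂_commute b) (coef₂_commute b)
        (fun k => taylor_coordHol₂ h0 _ k), adCoord₂_sum b h₁ h₂ hp (yvec_mem b i)]
      have h5 : ∀ k, extCoord b k (yvec b i) = if k = i then 1 else 0 := fun k => by
        refine (extCoord_apply b k (b i)).trans ?_
        rw [b.repr_self, Finsupp.single_apply]
        simp only [eq_comm]
      simp only [h5, ite_smul, one_smul, zero_smul, Finset.sum_ite_eq', Finset.mem_univ, if_true,
        TensorProduct.add_tmul]
      rw [taylor_add, taylor_coordHol₂, taylor_coordHol₂, ← mul_add, ← map_add, comul_hvec]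
      rfl
    ext n
    have := congrArg (coeff (n + 1)) hX
    rwa [coeff_succ_X_mul, coeff_succ_X_mul] at this
  rw [h3] at h
  have h6 := h.trans (congrArg _ h4)
  have h7 := congrArg (coeff n) h6
  rw [coeff_C_mul, coeff_mul_C] at h7
  exact h7.symm

end NormalOrdering

end VertexIRF

namespace VertexIRF

set_option linter.unusedSectionVars false

/-! ### Factorisation of the transport of a pair into `X²` and `M`. -/

section Factorization

open TopologicalSpace PowerSeries Algebra.TensorProduct

variable {E : Type*} [NormedAddCommGroup E] [NormedSpace ℂ E] [CompleteSpace E]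
  [FiniteDimensional ℂ E]
  {G : Type*} [TopologicalSpace G] [ChartedSpace E G] [Group G] [LieGroup 𝓘(ℂ, E) ω G]
  {a : LieSubalgebra ℂ (LieAlg E G)} [IsLieAbelian a] {r : ℕ} (b : Module.Basis (Fin r) ℂ a)
  {g : (Fin r → ℂ) → (Fin r → ℂ) → G} {U : Opens ((Fin r → ℂ) × (Fin r → ℂ))}
  (hφ : ∀ z ∈ U, GHolAt E (fun z : (Fin r → ℂ) × (Fin r → ℂ) => (g z.1 z.2)⁻¹) z)

theorem isFlat_pairConn {P : Type*} [NormedAddCommGroup P] [NormedSpace ℂ P] {V : Opens P}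
    {φ₁ φ₂ : P → G} (h₁ : ∀ z ∈ V, GHolAt E φ₁ z) (h₂ : ∀ z ∈ V, GHolAt E φ₂ z) :
    IsFlat (holDir V) (pairConn h₁ h₂) :=
  (isFlat_connMap h₁ _).add (isFlat_connMap h₂ _) fun _ _ =>
    lT_commute (fun u v => includeLeft_commute_tmul u v) _ _

/-- `z ↦ (0, -z₂)` -/
def mapSnd (r : ℕ) : (Fin r → ℂ) × (Fin r → ℂ) →L[ℂ] (Fin r → ℂ) × (Fin r → ℂ) :=
  (0 : (Fin r → ℂ) × (Fin r → ℂ) →L[ℂ] (Fin r → ℂ)).prod (-ContinuousLinearMap.snd ℂ _ _)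

/-- `z ↦ (-z₂, -(z₁ + z₂))` -/
def mapDiag (r : ℕ) : (Fin r → ℂ) × (Fin r → ℂ) →L[ℂ] (Fin r → ℂ) × (Fin r → ℂ) :=
  (-ContinuousLinearMap.snd ℂ (Fin r → ℂ) (Fin r → ℂ)).prod
    (-(ContinuousLinearMap.fst ℂ _ _ + ContinuousLinearMap.snd ℂ _ _))

theorem add_mapSnd (p : Fin r → ℂ) (z : (Fin r → ℂ) × (Fin r → ℂ)) :
    (p, p) + mapSnd r z = (p, p - z.2) := by
  simp [mapSnd, sub_eq_add_neg]

theorem add_mapDiag (p : Fin r → ℂ) (z : (Fin r → ℂ) × (Fin r → ℂ)) :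
    (p, p) + mapDiag r z = (p - z.2, p - (z.1 + z.2)) := by
  simp only [mapDiag, ContinuousLinearMap.prod_apply, Prod.mk_add_mk, sub_eq_add_neg]
  rfl

variable {V : Opens ((Fin r → ℂ) × (Fin r → ℂ))} {p : Fin r → ℂ}
  (hα : ∀ z ∈ V, GHolAt E (fun z : (Fin r → ℂ) × (Fin r → ℂ) => (g (p - z.2) (p - (z.1 + z.2)))⁻¹) z)
  (hβ : ∀ z ∈ V, GHolAt E (fun z : (Fin r → ℂ) × (Fin r → ℂ) => (g p (p - z.2))⁻¹) z)
  (hp : (p, p) ∈ U) (h0 : 0 ∈ V) (hV₁ : ∀ z ∈ V, (p - z.2, p - (z.1 + z.2)) ∈ U)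
  (hV₂ : ∀ z ∈ V, (p, p - z.2) ∈ U)

include hV₁ in
theorem add_mapDiag_mem : ∀ z ∈ V, (p, p) + mapDiag r z ∈ U := fun z hz => by
  rw [add_mapDiag]
  exact hV₁ z hz

include hV₂ in
theorem add_mapSnd_mem : ∀ z ∈ V, (p, p) + mapSnd r z ∈ U := fun z hz => by
  rw [add_mapSnd]
  exact hV₂ z hz

theorem rT_connMap_mapDiag {C : Type*} [Ring C] [Algebra ℂ C] (j : Env E G →ₐ[ℂ] C)
    (w : (Fin r → ℂ) × (Fin r → ℂ)) : rT C (pull (p, p) (mapDiag r) (add_mapDiag_mem hV₁))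
      (connMap hφ j (mapDiag r w)) = connMap hα j w :=
  rT_connMap hφ (p, p) (mapDiag r) _ (fun z => by rw [add_mapDiag]) hα j w

theorem rT_connMap_mapSnd {C : Type*} [Ring C] [Algebra ℂ C] (j : Env E G →ₐ[ℂ] C)
    (w : (Fin r → ℂ) × (Fin r → ℂ)) : rT C (pull (p, p) (mapSnd r) (add_mapSnd_mem hV₂))
      (connMap hφ j (mapSnd r w)) = connMap hβ j w :=
  rT_connMap hφ (p, p) (mapSnd r) _ (fun z => by rw [add_mapSnd]) hβ j w

include hφ hV₂ in
theorem connMap_fst_eq_zero {C : Type*} [Ring C] [Algebra ℂ C] (j : Env E G →ₐ[ℂ] C)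
    (v : Fin r → ℂ) : connMap hβ j (v, 0) = 0 := by
  have h : mapSnd r (v, 0) = 0 := by simp [mapSnd]
  rw [← rT_connMap_mapSnd hφ hβ hV₂, h, map_zero, map_zero]

include hV₁ hV₂ in
/-- Integrating first along the directions of the first factor. -/
theorem evS_pairConn_eq :
    evS _ h0 (expS (op (holDir V) (pairConn hα hβ) (dirs₂ r) (coef₂ b)) 1) =
      evS _ hp (PowerSeries.map (lT (Hol U)
        (includeRight : Env E G →ₐ[ℂ] Env E G ⊗[ℂ] Env E G)).toRingHom
          (serX hφ (dirSnd r) (hvec b)) * normM b hφ) := by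
  set T₁ := op (holDir V) (connMap hα (includeLeft : Env E G →ₐ[ℂ] Env E G ⊗[ℂ] Env E G))
    (fun i : Fin r => (dualVec i, 0)) (fun i => hvec b i ⊗ₜ[ℂ] 1) with hT₁
  set T₂ := op (holDir V) (connMap hα (includeLeft : Env E G →ₐ[ℂ] Env E G ⊗[ℂ] Env E G))
    (fun i : Fin r => (0, dualVec i)) (fun i => 1 ⊗ₜ[ℂ] hvec b i) with hT₂
  have hlr : ∀ u v : Env E G, Commute
      ((includeRight : Env E G →ₐ[ℂ] Env E G ⊗[ℂ] Env E G) u) (includeLeft v) := fun u v =>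
    (includeLeft_commute_tmul v u).symm
  have h12 : ∀ i j, Commute (hvec b i ⊗ₜ[ℂ] (1 : Env E G)) (1 ⊗ₜ[ℂ] hvec b j) := fun i j =>
    includeLeft_commute_tmul _ _
  -- The second component does not depend on `z₁`, so in these directions only the first component
  -- contributes.
  have hκ₁ : op (holDir V) (pairConn hα hβ) (fun i : Fin r => (dualVec i, 0))
      (fun i => hvec b i ⊗ₜ[ℂ] 1) = T₁ := LinearMap.ext fun x => by
    simp only [hT₁, op_apply, pairConn, LinearMap.add_apply, connMap_fst_eq_zero hφ hβ hV₂,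
      add_zero]
  have hs : op (holDir V) (pairConn hα hβ) (dirs₂ r) (coef₂ b) =
      op (holDir V) (connMap hβ includeRight + connMap hα includeLeft)
        (fun i : Fin r => (0, dualVec i)) (fun i => 1 ⊗ₜ[ℂ] hvec b i) + T₁ := by
    rw [dirs₂, coef₂, op_sumElim, hκ₁, add_comm, pairConn, add_comm (connMap hα _)]
  have hcomm : Commute (op (holDir V) (connMap hβ includeRight + connMap hα includeLeft)
        (fun i : Fin r => (0, dualVec i)) (fun i => 1 ⊗ₜ[ℂ] hvec b i)) T₁ := by
    rw [← hκ₁, pairConn, add_comm (connMap hβ _)]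
    exact op_commute (isFlat_pairConn hα hβ) fun i j => (h12 j i).symm
  have hcomm' : Commute T₂ T₁ := op_commute (isFlat_connMap hα _) fun i j => (h12 j i).symm
  -- The `z₁` directions are integrated innermost. Along `z₂` the two connections are then
  -- separated: the second component yields `X²`, and the first, recombined with the `z₁`
  -- directions, yields `M`.
  rw [hs, expS_comp hcomm, evS_connMap_add hβ hα hlr (tmul_hvec_commute b)
    (fun i u => hlr _ _) h0 (q := expS T₁ 1), ← hT₂, ← expS_comp hcomm', evS_mul]
  · congr 1
    · rw [map_serX]
      exact (evS_pull_one (p, p) (mapSnd r) (add_mapSnd_mem hV₂) (v := dirSnd r)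
        (w := fun i => (0, dualVec i)) (fun i => by simp [mapSnd, dirSnd])
        (rT_connMap_mapSnd hφ hβ hV₂ _) h0 hp (by simp)).symm
    · rw [normM, serM, hT₁, hT₂, ← op_sumElim, add_comm, ← op_sumElim]
      refine (evS_pull_one (p, p) (mapDiag r) (add_mapDiag_mem hV₁)
        (v := Sum.elim (dirDiag r) (dirSnd r))
        (w := Sum.elim (fun i => (0, dualVec i)) (fun i => (dualVec i, 0))) (fun i => ?_)
        (rT_connMap_mapDiag hφ hα hV₁ _) h0 hp (by simp)).symm
      rcases i with i | i <;> simp [mapDiag, dirSnd, dirDiag]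
  · intro n i
    exact coeff_expS_commute (fun j => h12 j i)
      (fun j => connMap_commute hα (fun u => (hlr _ u).symm) _) (fun m => coeff_one_commute _ _) n

end Factorization

end VertexIRF

namespace VertexIRF

set_option linter.unusedSectionVars false

/-! ### The normal form of the twist and its zero weight. -/

section NormalForm

open TopologicalSpace PowerSeries Algebra.TensorProduct

variable {E : Type*} [NormedAddCommGroup E] [NormedSpace ℂ E] [CompleteSpace E]
  [FiniteDimensional ℂ E]
  {G : Type*} [TopologicalSpace G] [ChartedSpace E G] [Group G] [LieGroup 𝓘(ℂ, E) ω G]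
  {a : LieSubalgebra ℂ (LieAlg E G)} [IsLieAbelian a] {r : ℕ} (b : Module.Basis (Fin r) ℂ a)
  (g : (Fin r → ℂ) → (Fin r → ℂ) → G) {U : Opens ((Fin r → ℂ) × (Fin r → ℂ))}
  (hφ : ∀ z ∈ U, GHolAt E (fun z : (Fin r → ℂ) × (Fin r → ℂ) => (g z.1 z.2)⁻¹) z)
  (p : Fin r → ℂ)

/-- The first component of the normally ordered expression for `J`. -/
def compA (z : (Fin r → ℂ) × (Fin r → ℂ)) : G :=
  g p (p - (z.1 + z.2)) * (g (p - z.2) (p - (z.1 + z.2)))⁻¹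

/-- The second component of the normally ordered expression for `J`. -/
def compB (z : (Fin r → ℂ) × (Fin r → ℂ)) : G :=
  g p (p - (z.1 + z.2)) * (g p (p - z.2))⁻¹

/-- `z ↦ (0, -(z₁ + z₂))` -/
def mapSum (r : ℕ) : (Fin r → ℂ) × (Fin r → ℂ) →L[ℂ] (Fin r → ℂ) × (Fin r → ℂ) :=
  (0 : (Fin r → ℂ) × (Fin r → ℂ) →L[ℂ] (Fin r → ℂ)).prod
    (-(ContinuousLinearMap.fst ℂ _ _ + ContinuousLinearMap.snd ℂ _ _))

theorem add_mapSum (p : Fin r → ℂ) (z : (Fin r → ℂ) × (Fin r → ℂ)) :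
    (p, p) + mapSum r z = (p, p - (z.1 + z.2)) := by
  simp only [mapSum, ContinuousLinearMap.prod_apply, Prod.mk_add_mk, sub_eq_add_neg]
  simp

variable (U) in
/-- The domain of the normally ordered expression for `J`. -/
def normDom : Opens ((Fin r → ℂ) × (Fin r → ℂ)) :=
  affPre U (p, p) (mapSum r) ⊓ affPre U (p, p) (mapDiag r) ⊓ affPre U (p, p) (mapSnd r)

variable {p}

theorem mem_normDom {z : (Fin r → ℂ) × (Fin r → ℂ)} : z ∈ normDom U p ↔
    (p, p - (z.1 + z.2)) ∈ U ∧ (p - z.2, p - (z.1 + z.2)) ∈ U ∧ (p, p - z.2) ∈ U := by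
  rw [← add_mapSum, ← add_mapDiag, ← add_mapSnd, ← mem_affPre, ← mem_affPre, ← mem_affPre]
  exact and_assoc

theorem zero_mem_normDom (hp : (p, p) ∈ U) : 0 ∈ normDom U p := by
  rw [mem_normDom]
  simpa using hp

variable {g}

include hφ in
theorem gholAt_sum {z : (Fin r → ℂ) × (Fin r → ℂ)} (hz : z ∈ normDom U p) :
    GHolAt E (fun z : (Fin r → ℂ) × (Fin r → ℂ) => (g p (p - (z.1 + z.2)))⁻¹) z := by
  have h := GHolAt.comp_affine (p₀ := (p, p)) (L := mapSum r) (q := z)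
    (hφ _ (by rw [add_mapSum]; exact (mem_normDom.mp hz).1))
  simpa only [add_mapSum] using h

include hφ in
theorem gholAt_diagonal {z : (Fin r → ℂ) × (Fin r → ℂ)} (hz : (p - z.2, p - (z.1 + z.2)) ∈ U) :
    GHolAt E (fun z : (Fin r → ℂ) × (Fin r → ℂ) => (g (p - z.2) (p - (z.1 + z.2)))⁻¹) z := by
  have h := GHolAt.comp_affine (p₀ := (p, p)) (L := mapDiag r) (q := z)
    (hφ _ (by rw [add_mapDiag]; exact hz))
  simpa only [add_mapDiag] using h

include hφ in
theorem gholAt_snd {z : (Fin r → ℂ) × (Fin r → ℂ)} (hz : (p, p - z.2) ∈ U) :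
    GHolAt E (fun z : (Fin r → ℂ) × (Fin r → ℂ) => (g p (p - z.2))⁻¹) z := by
  have h := GHolAt.comp_affine (p₀ := (p, p)) (L := mapSnd r) (q := z)
    (hφ _ (by rw [add_mapSnd]; exact hz))
  simpa only [add_mapSnd] using h

include hφ in
theorem gholAt_compA : ∀ z ∈ normDom U p, GHolAt E (compA g p) z := fun z hz => by
  have h := (gholAt_sum hφ hz).inv.mul (gholAt_diagonal hφ (mem_normDom.mp hz).2.1)
  simp only [inv_inv] at h
  exact h

include hφ in
theorem gholAt_compB : ∀ z ∈ normDom U p, GHolAt E (compB g p) z := fun z hz => by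
  have h := (gholAt_sum hφ hz).inv.mul (gholAt_snd hφ (mem_normDom.mp hz).2.2)
  simp only [inv_inv] at h
  exact h

theorem compA_zero : compA g p 0 = 1 := by simp [compA]

theorem compB_zero : compB g p 0 = 1 := by simp [compB]

variable {f : (Fin r → ℂ) → (Fin r → ℂ)} (hI : Intertwines b g f U)

include hI in
theorem Intertwines.inv_mem {z : (Fin r → ℂ) × (Fin r → ℂ)} (hz : z ∈ U) {y : E}
    (hy : (y : LieAlg E G) ∈ a) : (adVec E (g z.1 z.2)⁻¹ y : LieAlg E G) ∈ a :=
  adVec_inv_mem (hI.mem z hz) hy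

include hI in
theorem compA_inv_mem : ∀ z ∈ normDom U p, ∀ y : E, (y : LieAlg E G) ∈ a →
    (adVec E (compA g p z)⁻¹ y : LieAlg E G) ∈ a := fun z hz y hy => by
  rw [compA, mul_inv_rev, inv_inv, adVec_mul]
  exact hI.mem _ (mem_normDom.mp hz).2.1 _ (hI.inv_mem b (mem_normDom.mp hz).1 hy)

include hI in
theorem compB_inv_mem : ∀ z ∈ normDom U p, ∀ y : E, (y : LieAlg E G) ∈ a →
    (adVec E (compB g p z)⁻¹ y : LieAlg E G) ∈ a := fun z hz y hy => by
  rw [compB, mul_inv_rev, inv_inv, adVec_mul]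
  exact hI.mem _ (mem_normDom.mp hz).2.2 _ (hI.inv_mem b (mem_normDom.mp hz).1 hy)

-- Put `y' = Ad_{g(p, p-z₁-z₂)}⁻¹ y`. The relation between `g` and `f` turns the two summands into
-- `(f(p-z₂) - f(p-z₁-z₂))(y')` and `(f(p) - f(p-z₂))(y')`, and the right side into `(f(p) -
-- f(p-z₁-z₂))(y')`. The sum telescopes.
include hI in
theorem pairing_comp : ∀ z ∈ normDom U p, ∀ y : E, (y : LieAlg E G) ∈ a →
    pairing b z.1 (adVec E (compA g p z)⁻¹ y) + pairing b z.2 (adVec E (compB g p z)⁻¹ y) =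
      pairing b (z.1 + z.2) y := fun z hz y hy => by
  obtain ⟨z1, z2, z3⟩ := mem_normDom.mp hz
  have hy' := hI.inv_mem b z1 hy
  have h1 := hI.pairing_eq _ z1 _ hy'
  have h2 := hI.pairing_eq _ z2 _ hy'
  have h3 := hI.pairing_eq _ z3 _ hy'
  simp only [adVec_adVec_inv] at h1
  have e1 : p - (p - (z.1 + z.2)) = z.1 + z.2 := by abel
  have e2 : p - z.2 - (p - (z.1 + z.2)) = z.1 := by abel
  have e3 : p - (p - z.2) = z.2 := by abel
  simp only [e1] at h1
  simp only [e2] at h2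
  simp only [e3] at h3
  rw [compA, compB, mul_inv_rev, mul_inv_rev, inv_inv, inv_inv, adVec_mul, adVec_mul, h1, h2, h3,
    ← pairing_add]
  congr 1
  abel

include hφ hI in
theorem coeff_normalForm_commute (hp : (p, p) ∈ U) (n : ℕ) (i : Fin r) :
    Commute (coeff n (normalOrdered₂ b (compA g p) (compB g p)))
      (comul (LieAlg E G) (hvec b i)) :=
  coeff_normalOrdered₂_commute b (gholAt_compA hφ) (gholAt_compB hφ) (zero_mem_normDom hp)
    (compA_inv_mem b hI) (compB_inv_mem b hI) (pairing_comp b hI) compA_zero compB_zero n i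

/-! #### The coproduct of `X` times the normally ordered expression -/

/-- `t ↦ (0, -t)` -/
def mapNeg (r : ℕ) : (Fin r → ℂ) →L[ℂ] (Fin r → ℂ) × (Fin r → ℂ) :=
  (0 : (Fin r → ℂ) →L[ℂ] (Fin r → ℂ)).prod (-ContinuousLinearMap.id ℂ _)

theorem add_mapNeg (p : Fin r → ℂ) (t : Fin r → ℂ) : (p, p) + mapNeg r t = (p, p - t) := by
  simp [mapNeg, sub_eq_add_neg]

variable (U p) in
/-- The domain of the functions on `𝔞* × (𝔞* × 𝔞*)`. -/
def extDom : Opens ((Fin r → ℂ) × ((Fin r → ℂ) × (Fin r → ℂ))) :=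
  affPre U (p, p) ((mapNeg r).comp (ContinuousLinearMap.fst ℂ _ _)) ⊓
    affPre (normDom U p) 0 (ContinuousLinearMap.snd ℂ _ _)

theorem mem_extDom {q : (Fin r → ℂ) × ((Fin r → ℂ) × (Fin r → ℂ))} :
    q ∈ extDom U p ↔ (p, p - q.1) ∈ U ∧ q.2 ∈ normDom U p := by
  rw [← add_mapNeg, ← zero_add q.2]
  rfl

include hφ in
theorem gholAt_neg {t : Fin r → ℂ} (ht : (p, p - t) ∈ U) :
    GHolAt E (fun t : Fin r → ℂ => (g p (p - t))⁻¹) t := by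
  have h := GHolAt.comp_affine (p₀ := (p, p)) (L := mapNeg r) (q := t)
    (hφ _ (by rw [add_mapNeg]; exact ht))
  simpa only [add_mapNeg] using h

include hφ in
theorem gholAt_ext {c : (Fin r → ℂ) × (Fin r → ℂ) → G}
    (hc : ∀ z ∈ normDom U p, GHolAt E c z) : ∀ q ∈ extDom U p,
    GHolAt E (fun q : (Fin r → ℂ) × ((Fin r → ℂ) × (Fin r → ℂ)) =>
      (g p (p - q.1))⁻¹ * c q.2) q := fun _ hq =>
  (GHolAt.comp_fst (φ := fun t => (g p (p - t))⁻¹) (gholAt_neg hφ (mem_extDom.mp hq).1)).mul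
    (GHolAt.comp_snd (φ := c) (hc _ (mem_extDom.mp hq).2))

/-- The connection on `extDom`. -/
abbrev extConn : (Fin r → ℂ) × ((Fin r → ℂ) × (Fin r → ℂ)) →ₗ[ℂ]
    Hol (extDom U p) ⊗[ℂ] (Env E G ⊗[ℂ] Env E G) :=
  pairConn (gholAt_ext hφ (gholAt_compA hφ)) (gholAt_ext hφ (gholAt_compB hφ))

theorem rT_pairConn {P P' : Type*} [NormedAddCommGroup P] [NormedSpace ℂ P]
    [NormedAddCommGroup P'] [NormedSpace ℂ P'] {V : Opens P} {V' : Opens P'} {φ₁ φ₂ : P → G}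
    {χ₁ χ₂ : P' → G} {h₁ : ∀ z ∈ V, GHolAt E φ₁ z} {h₂ : ∀ z ∈ V, GHolAt E φ₂ z}
    {k₁ : ∀ z ∈ V', GHolAt E χ₁ z} {k₂ : ∀ z ∈ V', GHolAt E χ₂ z} {p₀ : P} {L : P' →L[ℂ] P}
    (h : ∀ q ∈ V', p₀ + L q ∈ V)
    (e₁ : ∀ q ∈ V', ∀ w, logVec (E := E) (fun q => φ₁ (p₀ + L q)) q w = logVec (E := E) χ₁ q w)
    (e₂ : ∀ q ∈ V', ∀ w, logVec (E := E) (fun q => φ₂ (p₀ + L q)) q w = logVec (E := E) χ₂ q w)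
    (w : P') : rT _ (pull p₀ L h) (pairConn h₁ h₂ (L w)) = pairConn k₁ k₂ w := by
  rw [LinearMap.add_apply, map_add, LinearMap.add_apply,
    rT_connMap_of h₁ p₀ L h k₁ (fun q hq w => congrArg _ (congrArg _ (e₁ q hq w))),
    rT_connMap_of h₂ p₀ L h k₂ (fun q hq w => congrArg _ (congrArg _ (e₂ q hq w)))]

theorem logVec_ext (c : (Fin r → ℂ) × (Fin r → ℂ) → G) (t : Fin r → ℂ)
    (z w : (Fin r → ℂ) × (Fin r → ℂ)) :
    logVec (E := E) (fun z => (g p (p - ((t, (0 : (Fin r → ℂ) × (Fin r → ℂ))) +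
      ContinuousLinearMap.inr ℂ (Fin r → ℂ) ((Fin r → ℂ) × (Fin r → ℂ)) z).1))⁻¹ *
        c ((t, (0 : (Fin r → ℂ) × (Fin r → ℂ))) +
          ContinuousLinearMap.inr ℂ (Fin r → ℂ) ((Fin r → ℂ) × (Fin r → ℂ)) z).2) z w =
      logVec (E := E) c z w := by
  rw [← logVec_const_mul (g p (p - t))⁻¹ c]
  simp

theorem logVec_ext_fst {c : (Fin r → ℂ) × (Fin r → ℂ) → G} (hc : c 0 = 1) (t w : Fin r → ℂ) :
    logVec (E := E) (fun t => (g p (p - ((0 : (Fin r → ℂ) × ((Fin r → ℂ) × (Fin r → ℂ))) +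
      ContinuousLinearMap.inl ℂ (Fin r → ℂ) ((Fin r → ℂ) × (Fin r → ℂ)) t).1))⁻¹ *
        c ((0 : (Fin r → ℂ) × ((Fin r → ℂ) × (Fin r → ℂ))) +
          ContinuousLinearMap.inl ℂ (Fin r → ℂ) ((Fin r → ℂ) × (Fin r → ℂ)) t).2) t w =
      logVec (E := E) (fun t => (g p (p - t))⁻¹) t w := by
  simp [hc]

theorem add_inr_mem {t : Fin r → ℂ} (ht : (p, p - t) ∈ U) : ∀ z ∈ normDom U p, (t, 0) +
    ContinuousLinearMap.inr ℂ (Fin r → ℂ) ((Fin r → ℂ) × (Fin r → ℂ)) z ∈ extDom U p := by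
  intro z hz
  rw [mem_extDom]
  simpa using ⟨ht, hz⟩

/-- For fixed `t` the factor `g(p, p-t)⁻¹` is a left constant, which the logarithmic derivative does
not see. This gives the independence of `t` that `evS_expS_add_of_const` asks for. -/
theorem evS_extConn_const {t : Fin r → ℂ}
    (ht : 0 + ContinuousLinearMap.inl ℂ (Fin r → ℂ) ((Fin r → ℂ) × (Fin r → ℂ)) t ∈ extDom U p)
    (hp : (p, p) ∈ U) :
    evS _ ht (expS (op (holDir (extDom U p)) (extConn hφ) (fun k => (0, dirs₂ r k)) (coef₂ b)) 1) =
      normalOrdered₂ b (compA g p) (compB g p) := by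
  have ht' : (p, p - t) ∈ U := by simpa using (mem_extDom.mp ht).1
  rw [normalOrdered₂_eq b (gholAt_compA hφ) (gholAt_compB hφ) (zero_mem_normDom hp)]
  have e : 0 + ContinuousLinearMap.inl ℂ (Fin r → ℂ) ((Fin r → ℂ) × (Fin r → ℂ)) t =
      (t, 0) + ContinuousLinearMap.inr ℂ (Fin r → ℂ) ((Fin r → ℂ) × (Fin r → ℂ)) 0 := by simp
  have ev : ∀ k, ((0 : Fin r → ℂ), dirs₂ r k) =
      ContinuousLinearMap.inr ℂ (Fin r → ℂ) ((Fin r → ℂ) × (Fin r → ℂ)) (dirs₂ r k) := fun k => rfl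
  have eθ := rT_pairConn (h₁ := gholAt_ext hφ (gholAt_compA hφ)) (h₂ := gholAt_ext hφ (gholAt_compB hφ))
    (k₁ := gholAt_compA hφ) (k₂ := gholAt_compB hφ) (add_inr_mem ht')
    (fun q _ w => logVec_ext (compA g p) t q w) (fun q _ w => logVec_ext (compB g p) t q w)
  exact evS_pull_one (t, 0) (ContinuousLinearMap.inr ℂ (Fin r → ℂ) ((Fin r → ℂ) × (Fin r → ℂ)))
    (add_inr_mem ht') ev eθ (zero_mem_normDom hp) ht e

/-- At `z = 0` both components reduce to `g(p, p-t)⁻¹`, so the connection of the pair is the image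
of a single connection under `Δ`. -/
theorem evS_extConn_fst (hp : (p, p) ∈ U) (h0 : 0 ∈ extDom U p) :
    evS _ h0 (expS (op (holDir (extDom U p)) (extConn hφ) (fun i => (dualVec i, 0))
      (fun i => comul (LieAlg E G) (hvec b i))) 1) =
    evS _ hp (PowerSeries.map (lT (Hol U) (comul (LieAlg E G))).toRingHom
      (serX hφ (dirSnd r) (hvec b))) := by
  let V' := affPre (extDom U p) 0 (ContinuousLinearMap.inl ℂ (Fin r → ℂ) ((Fin r → ℂ) × (Fin r → ℂ)))
  have hV' : ∀ t ∈ V', (p, p - t) ∈ U := fun t ht => by simpa using (mem_extDom.mp ht).1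
  have hχ : ∀ t ∈ V', GHolAt E (fun t : Fin r → ℂ => (g p (p - t))⁻¹) t := fun t ht =>
    gholAt_neg hφ (hV' t ht)
  have h0' : (0 : Fin r → ℂ) ∈ V' := by
    rw [mem_affPre, map_zero, add_zero]
    exact h0
  rw [map_serX]
  have e₁ : ∀ w, rT _ (pull 0 (ContinuousLinearMap.inl ℂ (Fin r → ℂ)
      ((Fin r → ℂ) × (Fin r → ℂ))) (fun q (hq : q ∈ V') => hq)) (extConn hφ
        (ContinuousLinearMap.inl ℂ (Fin r → ℂ) ((Fin r → ℂ) × (Fin r → ℂ)) w)) =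
      connMap hχ (comul (LieAlg E G)) w := fun w => by
    rw [connMap_add hχ (fun y => comul_iotaVec y) (j₁ := includeLeft) (j₂ := includeRight)]
    exact rT_pairConn (h₁ := gholAt_ext hφ (gholAt_compA hφ))
      (h₂ := gholAt_ext hφ (gholAt_compB hφ)) (k₁ := hχ) (k₂ := hχ) (fun q (hq : q ∈ V') => hq)
      (fun q _ w => logVec_ext_fst compA_zero q w) (fun q _ w => logVec_ext_fst compB_zero q w) w
  have e₂ : ∀ w, rT _ (pull (p, p) (mapNeg r)
      (fun q (hq : q ∈ V') => by rw [add_mapNeg]; exact hV' q hq))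
        (connMap hφ (comul (LieAlg E G)) (mapNeg r w)) = connMap hχ (comul (LieAlg E G)) w :=
    fun w => rT_connMap hφ (p, p) _ _ (fun q => by rw [add_mapNeg]) hχ _ w
  have v₁ : ∀ i : Fin r, (dualVec i, (0 : (Fin r → ℂ) × (Fin r → ℂ))) =
      ContinuousLinearMap.inl ℂ (Fin r → ℂ) ((Fin r → ℂ) × (Fin r → ℂ)) (dualVec i) := fun _ => rfl
  have v₂ : ∀ i : Fin r, dirSnd r i = mapNeg r (dualVec i) := fun i => by simp [mapNeg, dirSnd]
  have z₁ : (0 : (Fin r → ℂ) × ((Fin r → ℂ) × (Fin r → ℂ))) =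
      0 + ContinuousLinearMap.inl ℂ (Fin r → ℂ) ((Fin r → ℂ) × (Fin r → ℂ)) 0 := by
    rw [map_zero, add_zero]
  have z₂ : (p, p) = (p, p) + mapNeg r 0 := by rw [map_zero, add_zero]
  have k₁ := evS_pull_one (c := fun i => comul (LieAlg E G) (hvec b i)) 0
    (ContinuousLinearMap.inl ℂ (Fin r → ℂ) ((Fin r → ℂ) × (Fin r → ℂ))) _ v₁ e₁ h0' h0 z₁
  have k₂ := evS_pull_one (c := fun i => comul (LieAlg E G) (hvec b i)) (p, p) (mapNeg r) _ v₂ e₂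
    h0' hp z₂
  rw [k₁, k₂]

/-- `z ↦ (z₁ + z₂, z)` -/
def mapGraph (r : ℕ) : (Fin r → ℂ) × (Fin r → ℂ) →L[ℂ]
    (Fin r → ℂ) × ((Fin r → ℂ) × (Fin r → ℂ)) :=
  (ContinuousLinearMap.fst ℂ (Fin r → ℂ) (Fin r → ℂ) +
    ContinuousLinearMap.snd ℂ (Fin r → ℂ) (Fin r → ℂ)).prod (ContinuousLinearMap.id ℂ _)

/-- As `Δ(h) = h⁽¹⁾ + h⁽²⁾`, moving `t` by `Δ(h)` and `z` by `(h⁽¹⁾, h⁽²⁾)` is a motion along the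
graph `t = z₁ + z₂`. -/
theorem op_graph : op (holDir (extDom U p)) (extConn hφ) (fun i => (dualVec i, 0))
      (fun i => comul (LieAlg E G) (hvec b i)) +
    op (holDir (extDom U p)) (extConn hφ) (fun k => (0, dirs₂ r k)) (coef₂ b) =
    op (holDir (extDom U p)) (extConn hφ) (fun k => mapGraph r (dirs₂ r k)) (coef₂ b) := by
  have e1 : (fun k => ((0 : Fin r → ℂ), dirs₂ r k)) =
      Sum.elim (fun i => (0, (dualVec i, 0))) (fun i => (0, (0, dualVec i))) := by
    funext k
    rcases k with k | k <;> rfl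
  have e2 : (fun k => mapGraph r (dirs₂ r k)) =
      Sum.elim (fun i => (dualVec i, 0) + (0, (dualVec i, 0)))
        (fun i => (dualVec i, 0) + (0, (0, dualVec i))) := by
    funext k
    rcases k with k | k <;> simp [mapGraph]
  simp only [comul_hvec, e1, e2, coef₂]
  rw [op_add_coeff, op_sumElim, op_sumElim, op_add_dir, op_add_dir]
  abel

/-- Both sides are the transport of `(g(p,p-t)⁻¹ A(z), g(p,p-t)⁻¹ B(z))` along the graph `t = z₁ +
z₂`: once with the motions in `t` and `z` separated, once restricted to the graph. -/
theorem comul_mul_normalForm (hp : (p, p) ∈ U) (hI : Intertwines b g f U) :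
    evS _ hp (PowerSeries.map (lT (Hol U) (comul (LieAlg E G))).toRingHom
      (serX hφ (dirSnd r) (hvec b))) * normalOrdered₂ b (compA g p) (compB g p) =
    evS _ hp (PowerSeries.map (lT (Hol U)
        (includeRight : Env E G →ₐ[ℂ] Env E G ⊗[ℂ] Env E G)).toRingHom
          (serX hφ (dirSnd r) (hvec b)) * normM b hφ) := by
  have h0 : 0 ∈ extDom U p := by
    rw [mem_extDom]
    refine ⟨by simpa using hp, zero_mem_normDom hp⟩
  have hcΔ : ∀ i j, Commute (comul (LieAlg E G) (hvec b i)) (comul (LieAlg E G) (hvec b j)) :=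
    fun i j => (hvec_commute b i j).map _
  have hcd : ∀ i j, Commute (comul (LieAlg E G) (hvec b i)) (coef₂ b j) := fun i j => by
    rw [comul_hvec]
    exact (coef₂_commute b (Sum.inl i) j).add_left (coef₂_commute b (Sum.inr i) j)
  -- The factorisation needs the constant transport in `z` to commute with the coefficients `Δ(h)`
  -- of the motion in `t`. This is the zero weight of the normal form, the only way the relation
  -- between `f` and `g` enters here.
  have h := evS_expS_add_of_const (isFlat_pairConn (gholAt_ext hφ (gholAt_compA hφ))
    (gholAt_ext hφ (gholAt_compB hφ))) (ContinuousLinearMap.inl ℂ _ _)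
    (w := fun i : Fin r => dualVec i) hcΔ hcd h0 (fun t ht => evS_extConn_const b hφ ht hp)
    (fun n j => coeff_normalForm_commute b hφ hI hp n j)
  have h' := evS_extConn_fst b hφ hp h0
  rw [← h']
  refine h.symm.trans ?_
  refine (congrArg (fun T => evS _ h0 (expS T 1)) (op_graph b hφ)).trans ?_
  let V' := affPre (extDom U p) 0 (mapGraph r)
  have hV' : ∀ z ∈ V', z ∈ normDom U p := fun z hz => by simpa [mapGraph] using (mem_extDom.mp hz).2
  have hα : ∀ z ∈ V', GHolAt E
      (fun z : (Fin r → ℂ) × (Fin r → ℂ) => (g (p - z.2) (p - (z.1 + z.2)))⁻¹) z := fun z hz =>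
    gholAt_diagonal hφ (mem_normDom.mp (hV' z hz)).2.1
  have hβ : ∀ z ∈ V', GHolAt E (fun z : (Fin r → ℂ) × (Fin r → ℂ) => (g p (p - z.2))⁻¹) z :=
    fun z hz => gholAt_snd hφ (mem_normDom.mp (hV' z hz)).2.2
  have h0' : 0 ∈ V' := by
    rw [mem_affPre, map_zero, add_zero]
    exact h0
  rw [← evS_pairConn_eq b hφ hα hβ hp h0' (fun z hz => (mem_normDom.mp (hV' z hz)).2.1)
    (fun z hz => (mem_normDom.mp (hV' z hz)).2.2)]
  -- On the graph the common factor of `A` and `B` cancels, which leaves `g(p-z₂, p-z₁-z₂)⁻¹` and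
  -- `g(p, p-z₂)⁻¹`.
  exact evS_pull_one 0 (mapGraph r) (fun q hq => hq) (fun k => rfl)
    (rT_pairConn _ (fun q _ w => by simp [mapGraph, compA])
      fun q _ w => by simp [mapGraph, compB]) h0' h0 (by simp)

variable {D : Opens (Fin r → ℂ)} (hD : ∀ p ∈ D, (p, p) ∈ U)

-- The transform and the normal form satisfy the same equation, with the same right side, and `Δ(X)`
-- is invertible.
include hφ hI hD in
theorem transform_eq_normalForm (hp : p ∈ D) :
    transform b (quasiGrouplike b g) p = normalOrdered₂ b (compA g p) (compB g p) := by
  have h1 := comul_mul_normalForm b hφ (hD p hp) hI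
  have h2 := congrArg (evS _ (hD p hp)) (map_comul_mul_serJ b hφ)
  rw [← h2, evS_mul, ← transform_eq_evS b hφ hD hp, evS_map] at h1
  have hu : IsUnit (PowerSeries.map (comul (LieAlg E G)).toRingHom
      (evS _ (hD p hp) (serX hφ (dirSnd r) (hvec b)))) := by
    rw [← normX_ser b hφ (hD p hp)]
    exact (OnePlus.isUnit_ser _).map _
  exact (hu.mul_left_cancel h1).symm

end NormalForm

end VertexIRF

namespace VertexIRF

set_option linter.unusedSectionVars false

/-! ### Assembly of the proposition. -/

section Main

open TopologicalSpace PowerSeries Algebra.TensorProduct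

variable {E : Type*} [NormedAddCommGroup E] [NormedSpace ℂ E] [CompleteSpace E]
  [FiniteDimensional ℂ E]
  {G : Type*} [TopologicalSpace G] [ChartedSpace E G] [Group G] [LieGroup 𝓘(ℂ, E) ω G]
  {a : LieSubalgebra ℂ (LieAlg E G)} [IsLieAbelian a] {r : ℕ} (b : Module.Basis (Fin r) ℂ a)
  {g : (Fin r → ℂ) → (Fin r → ℂ) → G} {U : Opens ((Fin r → ℂ) × (Fin r → ℂ))}
  (hφ : ∀ z ∈ U, GHolAt E (fun z : (Fin r → ℂ) × (Fin r → ℂ) => (g z.1 z.2)⁻¹) z)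
  {f : (Fin r → ℂ) → (Fin r → ℂ)}
  {D : Opens (Fin r → ℂ)} (hD : ∀ p ∈ D, (p, p) ∈ U) (hI : Intertwines b g f U)

include hφ hI hD in
theorem coeff_transform_commute {p : Fin r → ℂ} (hp : p ∈ D) (n : ℕ) (i : Fin r) :
    Commute (coeff n (transform b (quasiGrouplike b g) p)) (comul (LieAlg E G) (hvec b i)) := by
  rw [transform_eq_normalForm b hφ hI hD hp]
  exact coeff_normalForm_commute b hφ hI (hD p hp) n i

include hφ hI hD in
theorem zeroWeightOn_transform : ZeroWeightOn a (transform b (quasiGrouplike b g)) D :=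
  zeroWeightOn_of_commute b fun _ hp n i => coeff_transform_commute b hφ hD hI hp n i

include hφ hI hD in
theorem isVertexIRF : IsVertexIRF b (quasiGrouplike b g) D where
  holomorphic_group := by
    have h : ∀ p, (quasiGrouplike b g p).right = g p p := fun p => by rw [quasiGrouplike_eq]
    simp only [h]
    exact fun p hp => (gholAt_diag hφ hD p hp).contMDiffWithinAt
  holomorphic_series := holSeriesOn_left b hφ hD
  counit_eq _ hp := counit_left_series b hφ hD hp
  zero_weight := zeroWeightOn_transform b hφ hD hI

include hφ hI hD in
theorem isFormalDynamicalTwist :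
    IsFormalDynamicalTwist b (transform b (quasiGrouplike b g)) D where
  holomorphic := holSeriesOn_transform b hφ hD
  zero_weight := zeroWeightOn_transform b hφ hD hI
  constantCoeff_eq _ _ := OnePlus.constantCoeff_ser _
  twist _ hp := transform_twist b hφ hD hp fun n i => coeff_transform_commute b hφ hD hI hp n i
  counit_left _ hp := transform_counit_left b hφ hD hp
  counit_right _ hp := transform_counit_right b hφ hD hp

end Main

end VertexIRF

theorem proposition3p5
    {E : Type*} [NormedAddCommGroup E] [NormedSpace ℂ E] [CompleteSpace E]
    [FiniteDimensional ℂ E]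
    {G : Type*} [TopologicalSpace G] [ChartedSpace E G] [Group G] [LieGroup 𝓘(ℂ, E) ω G]
    (a : LieSubalgebra ℂ (VertexIRF.LieAlg E G)) [IsLieAbelian a]
    {r : ℕ} (b : Module.Basis (Fin r) ℂ a)
    (D : Set (Fin r → ℂ)) (hD : IsOpen D)
    (Ω : Set ((Fin r → ℂ) × (Fin r → ℂ))) (hΩ : IsOpen Ω)
    (hDΩ : ∀ lam ∈ D, (lam, lam) ∈ Ω)
    (f : (Fin r → ℂ) → (Fin r → ℂ)) (hf : AnalyticOnNhd ℂ f D)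
    (g : (Fin r → ℂ) → (Fin r → ℂ) → G)
    (hg : ContMDiffOn 𝓘(ℂ, (Fin r → ℂ) × (Fin r → ℂ)) 𝓘(ℂ, E) ω
      (fun p : (Fin r → ℂ) × (Fin r → ℂ) => g p.1 p.2) Ω)
    (hgf : ∀ lam ∈ D, ∀ mu ∈ D, (lam, mu) ∈ Ω → ∀ y : a, ∃ z : a,
      (z : VertexIRF.LieAlg E G) = VertexIRF.AdLin E (g lam mu) y ∧
      b.constr ℂ (lam - mu) z = b.constr ℂ (f lam - f mu) y) :
    VertexIRF.IsVertexIRF b (VertexIRF.quasiGrouplike b g) D ∧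
    VertexIRF.Realizes b (VertexIRF.quasiGrouplike b g) f D ∧
    VertexIRF.IsFormalDynamicalTwist b
      (VertexIRF.transform b (VertexIRF.quasiGrouplike b g)) D ∧
    ∀ lam ∈ D, VertexIRF.transform b (VertexIRF.quasiGrouplike b g) lam =
      VertexIRF.normalOrdered₂ b
        (fun z => g lam (lam - (z.1 + z.2)) * (g (lam - z.2) (lam - (z.1 + z.2)))⁻¹)
        (fun z => g lam (lam - (z.1 + z.2)) * (g lam (lam - z.2))⁻¹) := by
  let D' : TopologicalSpace.Opens (Fin r → ℂ) := ⟨D, hD⟩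
  -- The relation between `f` and `g` is only available where both arguments lie in `D`, so `Ω` is
  -- cut down accordingly; the diagonal of `D` remains inside.
  let U : TopologicalSpace.Opens ((Fin r → ℂ) × (Fin r → ℂ)) :=
    ⟨Ω ∩ D ×ˢ D, hΩ.inter (hD.prod hD)⟩
  have hφ : ∀ z ∈ U, VertexIRF.GHolAt E
      (fun z : (Fin r → ℂ) × (Fin r → ℂ) => (g z.1 z.2)⁻¹) z := fun z hz =>
    VertexIRF.GHolAt.inv (φ := fun z : (Fin r → ℂ) × (Fin r → ℂ) => g z.1 z.2)
      ((hg z hz.1).contMDiffAt (hΩ.mem_nhds hz.1))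
  have hDU : ∀ p ∈ D', (p, p) ∈ U := fun p hp => ⟨hDΩ p hp, hp, hp⟩
  have hUD : ∀ z ∈ U, z.1 ∈ D' ∧ z.2 ∈ D' := fun z hz => hz.2
  have hI : VertexIRF.Intertwines b g f U :=
    { mem := fun z hz y hy => by
        obtain ⟨z', h1, -⟩ := hgf z.1 hz.2.1 z.2 hz.2.2 hz.1 ⟨y, hy⟩
        have h2 := z'.2
        rw [h1] at h2
        exact h2
      pairing_eq := fun z hz y hy => by
        obtain ⟨z', h1, h2⟩ := hgf z.1 hz.2.1 z.2 hz.2.2 hz.1 ⟨y, hy⟩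
        rw [← VertexIRF.pairing_coe, ← VertexIRF.pairing_coe, h1] at h2
        exact h2 }
  exact ⟨VertexIRF.isVertexIRF b hφ (D := D') hDU hI,
    VertexIRF.realizes b hφ (D := D') hDU hUD hf hI,
    VertexIRF.isFormalDynamicalTwist b hφ (D := D') hDU hI,
    fun lam hlam => VertexIRF.transform_eq_normalForm b hφ hI (D := D') hDU hlam⟩
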